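/- **Setting.** Let $K$ be a skew field of characteristic $\neq 2$ with an involution $a\mapsto\bar a$ (a bijection with $\bar{\bar a}=a$, $\overline{a+b}=\bar a+\bar b$, $\overline{ab}=\bar b\,\bar a$; it may be the identity if $K$ is a field), and let $P$ be the center of $K$. Vector spaces are right and finite-dimensional; $V^*$ is the right vector space of all semilinear forms $\varphi\colon V\to K$ (additive, $\varphi(xa)=\bar a\,\varphi(x)$), $A^*\varphi=\varphi A$ for a linear map $A$, and $V$ is identified with $V^{**}$ ($x\in V$ acts by $\varphi\mapsto\overline{\varphi(x)}$). Let $\mathcal C$ be a $P$-linear category with involution: objects $u\mapsto u^*$ and morphisms $(\alpha\colon u\to v)\mapsto(\alpha^*\colon v^*\to u^*)$ with $u^{**}=u\ne u^*$, $\alpha^{**}=\alpha$, $(\alpha\beta)^*=\beta^*\alpha^*$, $1^*=1$, $(\alpha+\beta)^*=\alpha^*+\beta^*$, $(\alpha a)^*=\alpha^*\bar a$ $(a\in P)$. Fix a set $S_0$ of objects containing exactly one member of each pair $u,u^*$. A representation is a $P$-linear functor $A$ from $\mathcal C$ to finite-dimensional right $K$-vector spaces with $\sum_u\dim A_u<\infty$;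 morphisms are natural transformations. The adjoint representation is $A^\circ_u=(A_{u^*})^*$, $A^\circ_\alpha=(A_{\alpha^*})^*$, and the adjoint of a morphism $f$ is $f^\circ_u=(f_{u^*})^*$. A selfadjoint representation is a representation $A$ with an identification $A=A^\circ$, that is, for all $u$ the spaces $A_u$ and $A_{u^*}$ are identified, compatibly with $V=V^{**}$, with each other's adjoint spaces so that $A_{\alpha}=(A_{\alpha^*})^*$. Two selfadjoint representations are congruent if there is an isomorphism $f$ between them with $f^\circ=f^{-1}$. The orthogonal sum of selfadjoint representations is their direct sum with $(\varphi+\psi)(a+b)=\varphi(a)+\psi(b)$. For a representation $A$, $A^+$ is $A\oplus A^\circ$ with the identification in which $(y,\psi)\in A_{v^*}\oplus (A_v)^*$ acts on $(x,\varphi)\in A_v\oplus (A_{v^*})^*$ as $\psi(x)+\overline{\varphi(y)}$. For a selfadjoint representation $B$ and an automorphism $f=f^\circ$ of $B$, $B^f$ is the selfadjoint representation with $B^f_v=B_v$ (with the same identifications) and $B^f_\alpha=\tilde f_v^{-1}B_\alpha\tilde f_u$ for $\alpha\colon u\to v$, where $\tilde f_v=f_v$ if $v\in S_0$ and $\tilde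 f_{v}=1$ if $v\notin S_0$. Let $\operatorname{ind}(\mathcal C)$ be a complete system of pairwise nonisomorphic direct-sum-indecomposable representations. Let $\operatorname{ind}_0(\mathcal C)$ be obtained by choosing, for each member of $\operatorname{ind}(\mathcal C)$ isomorphic to a selfadjoint representation, one selfadjoint representation isomorphic to it. Let $\operatorname{ind}_1(\mathcal C)$ consist of the members of $\operatorname{ind}(\mathcal C)$ isomorphic to their adjoints but not to a selfadjoint representation, together with one representation from each pair $\{A,B\}\subset\operatorname{ind}(\mathcal C)$ such that $A\not\simeq A^\circ$ and $A\simeq B^\circ$. For $B\in\operatorname{ind}_0(\mathcal C)$ let $R$ be the radical of $\operatorname{End}(B)$ (the set of its noninvertible elements) and $T(B)=\operatorname{End}(B)/R$, a skew field with involution $(f+R)^\circ=f^\circ+R$. For each $0\ne a=a^\circ\in T(B)$ fix an automorphism $f_a=f_a^\circ\in a$ of $B$ and put $B^a=B^{f_a}$. **Theorem 2.** Let $K$, of characteristic not $2$, be one of the following: (a) an algebraically closed field with the identity involution; (b) an algebraically closed field with nonidentity involution; (c) a real closed field or the algebra of quaternions over a real closed field (with any involution); (d) a finite field (with any involution). Then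 every selfadjoint representation of $\mathcal C$ over $K$ is congruent to an orthogonal sum, uniquely determined up to permutation of summands, of representations of the following form, where $A\in\operatorname{ind}_1(\mathcal C)$ and $B\in\operatorname{ind}_0(\mathcal C)$: (a) $A^+$, $B$; (b) $A^+$, $B$, $B^{-1}$ (that is, $B^f$ with $f=-1\in\operatorname{Aut}(B)$); (c) $A^+$, $B^t$, where $t=1$ if $T(B)$ is an algebraically closed field with the identity involution or the algebra of quaternions (over the real closed field $P$) with an involution other than the standard one $a+bi+cj+dk\mapsto a-bi-cj-dk$, and $t=\pm1$ otherwise; (d) $A^+$, $B^t$, where $t=1$ if the involution on the field $T(B)$ is not the identity, and $t$ is $1$ or a fixed nonsquare of $T(B)$ if it is the identity, while for each $B$ the orthogonal sum has at most one summand $B^t$ with $t\ne1$. -/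

import Mathlib

open CategoryTheory MulOpposite

universe k p v u

namespace SelfAdj

/-! ## Right vector spaces and semilinear forms

A right vector space over `K` is a module over `Kᵐᵒᵖ`: the product `x a` is `op a • x`. -/

/-- The ring homomorphism `op a ↦ ā` from `Kᵐᵒᵖ` to `K`. -/
def starOp (K : Type k) [DivisionRing K] [StarRing K] : Kᵐᵒᵖ →+* K :=
  ((starRingEquiv (R := K)).symm : Kᵐᵒᵖ →+* K)

@[simp] theorem starOp_apply {K : Type k} [DivisionRing K] [StarRing K] (a : Kᵐᵒᵖ) :
    starOp K a = star a.unop := rfl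

theorem finrank_self_op {K : Type k} [DivisionRing K] : Module.finrank Kᵐᵒᵖ K = 1 := by
  refine finrank_eq_one (1 : K) one_ne_zero fun w => ⟨op w, by simp⟩

theorem finite_self_op {K : Type k} [DivisionRing K] : Module.Finite Kᵐᵒᵖ K :=
  Module.finite_of_finrank_pos (by rw [finrank_self_op]; exact one_pos)

section Dual

variable (K : Type k) [DivisionRing K] [StarRing K]
variable (V : Type k) [AddCommGroup V] [Module Kᵐᵒᵖ V]

/-- The adjoint space `V*`: additive maps `φ : V → K` with `φ (x a) = ā φ x`. It is a right
vector space through `(φ a) x = φ x a`. -/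
abbrev SemiDual : Type k := V →ₛₗ[starOp K] K

variable {K V}

/-- The adjoint `φ ↦ φ ∘ A` of a linear map `A`. -/
def dualMap {W : Type k} [AddCommGroup W] [Module Kᵐᵒᵖ W] (A : V →ₗ[Kᵐᵒᵖ] W) :
    SemiDual K W →ₗ[Kᵐᵒᵖ] SemiDual K V where
  toFun φ := φ.comp A
  map_add' _ _ := rfl
  map_smul' _ _ := rfl

@[simp] theorem dualMap_apply {W : Type k} [AddCommGroup W] [Module Kᵐᵒᵖ W]
    (A : V →ₗ[Kᵐᵒᵖ] W) (φ : SemiDual K W) (x : V) : dualMap A φ x = φ (A x) := rfl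

/-- The evaluation map `V → V**`, where `x` acts on `V*` by `φ ↦ conj (φ x)`. -/
def evalMap : V →ₗ[Kᵐᵒᵖ] SemiDual K (SemiDual K V) where
  toFun x :=
    { toFun := fun φ => star (φ x)
      map_add' := fun φ ψ => by simp
      map_smul' := fun a φ => by simp }
  map_add' x y := by
    ext φ
    change star (φ (x + y)) = star (φ x) + star (φ y)
    simp
  map_smul' a x := by
    ext φ
    change star (φ (a • x)) = star (φ x) * a.unop
    simp

@[simp] theorem evalMap_apply (x : V) (φ : SemiDual K V) : evalMap x φ = star (φ x) := rfl

/-- Restriction of a semilinear form to a finite basis. -/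
def restrictBasis {ι : Type*} (b : ι → V) : SemiDual K V →ₗ[Kᵐᵒᵖ] (ι → K) where
  toFun φ i := φ (b i)
  map_add' _ _ := rfl
  map_smul' _ _ := rfl

theorem restrictBasis_injective {ι : Type*} (b : Module.Basis ι Kᵐᵒᵖ V) :
    Function.Injective (restrictBasis (K := K) b) := by
  intro φ ψ h
  exact b.ext fun i => congrFun h i

instance finite_semiDual [Module.Finite Kᵐᵒᵖ V] : Module.Finite Kᵐᵒᵖ (SemiDual K V) := by
  have := finite_self_op (K := K)
  exact Module.Finite.of_injective _ (restrictBasis_injective (Module.finBasis Kᵐᵒᵖ V))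

theorem finrank_semiDual_le [Module.Finite Kᵐᵒᵖ V] :
    Module.finrank Kᵐᵒᵖ (SemiDual K V) ≤ Module.finrank Kᵐᵒᵖ V := by
  have := finite_self_op (K := K)
  refine (LinearMap.finrank_le_finrank_of_injective
    (restrictBasis_injective (K := K) (Module.finBasis Kᵐᵒᵖ V))).trans ?_
  rw [Module.finrank_pi_fintype]
  simp [finrank_self_op]

theorem evalMap_injective : Function.Injective (evalMap (K := K) (V := V)) := by
  rw [injective_iff_map_eq_zero]
  intro x hx
  let b := Module.Basis.ofVectorSpace Kᵐᵒᵖ V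
  refine (Module.Basis.forall_coord_eq_zero_iff b).1 fun i => ?_
  let φ : SemiDual K V :=
    { toFun := fun y => star (b.coord i y).unop
      map_add' := fun y z => by simp
      map_smul' := fun a y => by simp }
  have h : star (φ x) = 0 := by
    have := LinearMap.congr_fun hx φ
    simpa using this
  simpa [φ] using h

theorem evalMap_bijective [Module.Finite Kᵐᵒᵖ V] :
    Function.Bijective (evalMap (K := K) (V := V)) := by
  refine ⟨evalMap_injective, ?_⟩
  refine (LinearMap.injective_iff_surjective_of_finrank_eq_finrank
    (le_antisymm ?_ ?_)).1 evalMap_injective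
  · exact LinearMap.finrank_le_finrank_of_injective evalMap_injective
  · exact (finrank_semiDual_le (K := K) (V := SemiDual K V)).trans finrank_semiDual_le

end Dual

/-! ## Linear categories with involution -/

/-- An involution on a linear category `C` over the field `P` with involution. -/
structure LinearInvolution (P : Type p) [Field P] [StarRing P] (C : Type u) [Category.{v} C]
    [Preadditive C] [Linear P C] where
  /-- `u ↦ u*` -/
  obj : C → C
  /-- `α ↦ α*` -/
  map : ∀ {a b : C}, (a ⟶ b) → (obj b ⟶ obj a)
  obj_obj : ∀ a, obj (obj a) = a
  obj_ne : ∀ a, a ≠ obj a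
  map_map : ∀ {a b : C} (α : a ⟶ b),
    map (map α) = eqToHom (obj_obj a) ≫ α ≫ eqToHom (obj_obj b).symm
  map_id : ∀ a, map (𝟙 a) = 𝟙 (obj a)
  map_comp : ∀ {a b c : C} (α : a ⟶ b) (β : b ⟶ c), map (α ≫ β) = map β ≫ map α
  map_add : ∀ {a b : C} (α β : a ⟶ b), map (α + β) = map α + map β
  map_smul : ∀ {a b : C} (r : P) (α : a ⟶ b), map (r • α) = star r • map α

section Reps

variable {P : Type p} [Field P] [StarRing P]
variable {K : Type k} [DivisionRing K] [StarRing K]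
variable {C : Type u} [Category.{v} C] [Preadditive C] [Linear P C]

/-- The object `a` is identified with `a**`. -/
def LinearInvolution.toSS (J : LinearInvolution P C) (a : C) : a ⟶ J.obj (J.obj a) :=
  eqToHom (J.obj_obj a).symm

theorem LinearInvolution.toSS_naturality (J : LinearInvolution P C) {a b : C} (α : a ⟶ b) :
    J.toSS a ≫ J.map (J.map α) = α ≫ J.toSS b := by
  simp [toSS, J.map_map]

theorem LinearInvolution.map_eqToHom (J : LinearInvolution P C) {a b : C} (h : a = b) :
    J.map (eqToHom h) = eqToHom (congrArg J.obj h.symm) := by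
  subst h
  exact J.map_id a

theorem LinearInvolution.toSS_map_toSS (J : LinearInvolution P C) (a : C) :
    J.toSS (J.obj a) ≫ J.map (J.toSS a) = 𝟙 (J.obj a) := by
  simp [toSS, J.map_eqToHom]

/-- `S₀` contains exactly one member of each pair `u, u*`. -/
def LinearInvolution.IsHalf (J : LinearInvolution P C) (S₀ : Set C) : Prop :=
  ∀ a, J.obj a ∈ S₀ ↔ a ∉ S₀

/-- The adjoint functor: `A°_u = (A_{u*})*`, `A°_α = (A_{α*})*`. -/
def LinearInvolution.adj (J : LinearInvolution P C) (A : C ⥤ ModuleCat.{k} Kᵐᵒᵖ) :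
    C ⥤ ModuleCat.{k} Kᵐᵒᵖ where
  obj a := ModuleCat.of Kᵐᵒᵖ (SemiDual K (A.obj (J.obj a)))
  map α := ModuleCat.ofHom (dualMap (A.map (J.map α)).hom)
  map_id a := by ext φ x; simp [J.map_id]
  map_comp α β := by ext φ x; simp [J.map_comp]

/-- An element of `A°_u`, regarded as a semilinear form on `A_{u*}`. -/
def LinearInvolution.toForm (J : LinearInvolution P C) {A : C ⥤ ModuleCat.{k} Kᵐᵒᵖ} {a : C} :
    (J.adj A).obj a ≃ₗ[Kᵐᵒᵖ] SemiDual K (A.obj (J.obj a)) := LinearEquiv.refl _ _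

theorem LinearInvolution.toForm_map (J : LinearInvolution P C) {A : C ⥤ ModuleCat.{k} Kᵐᵒᵖ}
    {a b : C} (α : a ⟶ b) (φ : (J.adj A).obj a) (x : A.obj (J.obj b)) :
    J.toForm ((J.adj A).map α φ) x = J.toForm φ (A.map (J.map α) x) := rfl

/-- The adjoint morphism: `f°_u = (f_{u*})*`. -/
def LinearInvolution.adjMap (J : LinearInvolution P C) {A B : C ⥤ ModuleCat.{k} Kᵐᵒᵖ}
    (f : A ⟶ B) : J.adj B ⟶ J.adj A where
  app a := ModuleCat.ofHom (dualMap (f.app (J.obj a)).hom)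
  naturality a b α := by
    refine ModuleCat.hom_ext (LinearMap.ext fun φ => J.toForm.injective (LinearMap.ext fun x => ?_))
    exact (congrArg (J.toForm φ) (ConcreteCategory.congr_hom (f.naturality (J.map α)) x)).symm

theorem LinearInvolution.toForm_adjMap (J : LinearInvolution P C)
    {A B : C ⥤ ModuleCat.{k} Kᵐᵒᵖ} (f : A ⟶ B) {a : C} (φ : (J.adj B).obj a)
    (x : A.obj (J.obj a)) :
    J.toForm ((J.adjMap f).app a φ) x = J.toForm φ (f.app (J.obj a) x) := rfl

variable [Algebra P K]

variable (P K C) in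
/-- A representation of `C` over `K`. Morphisms of representations are the morphisms
(natural transformations) of the underlying functors. -/
structure Rep where
  functor : C ⥤ ModuleCat.{k} Kᵐᵒᵖ
  finite : ∀ a, Module.Finite Kᵐᵒᵖ (functor.obj a)
  finite_support : {a : C | Nontrivial (functor.obj a)}.Finite
  map_add : ∀ {a b : C} (α β : a ⟶ b), functor.map (α + β) = functor.map α + functor.map β
  map_smul : ∀ {a b : C} (r : P) (α : a ⟶ b) (x : functor.obj a),
    functor.map (r • α) x = op (algebraMap P K r) • functor.map α x

attribute [instance] Rep.finite

/-- Isomorphism of representations. -/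
def Rep.Isom (A B : Rep P K C) : Prop := Nonempty (A.functor ≅ B.functor)

/-- Direct-sum indecomposability: the representation is nonzero and is not a direct sum of two
nonzero ones. (Direct summands of a representation in the functor category are themselves
linear, finite-dimensional and of finite support.) -/
def Rep.IsIndec (A : Rep P K C) : Prop := Indecomposable A.functor

/-- The adjoint representation `A°`. -/
def Rep.adjoint [StarModule P K] (J : LinearInvolution P C) (A : Rep P K C) : Rep P K C where
  functor := J.adj A.functor
  finite a := inferInstanceAs (Module.Finite Kᵐᵒᵖ (SemiDual K (A.functor.obj (J.obj a))))
  finite_support := by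
    refine (A.finite_support.image J.obj).subset fun a ha => ⟨J.obj a, ?_, J.obj_obj a⟩
    by_contra hn
    have hs : Subsingleton (A.functor.obj (J.obj a)) := not_nontrivial_iff_subsingleton.1 hn
    refine not_subsingleton_iff_nontrivial.2 ha ⟨fun φ ψ => ?_⟩
    refine LinearMap.ext (f := (φ : SemiDual K (A.functor.obj (J.obj a)))) fun x => ?_
    rw [Subsingleton.elim x 0]
    exact (LinearMap.map_zero _).trans (LinearMap.map_zero _).symm
  map_add α β := by
    refine ModuleCat.hom_ext (LinearMap.ext fun φ => J.toForm.injective (LinearMap.ext fun x => ?_))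
    change J.toForm φ (A.functor.map (J.map (α + β)) x) =
      J.toForm φ (A.functor.map (J.map α) x) + J.toForm φ (A.functor.map (J.map β) x)
    rw [J.map_add, A.map_add, ← LinearMap.map_add]
    rfl
  map_smul {a b} r α φ := by
    refine J.toForm.injective (LinearMap.ext fun x => ?_)
    change J.toForm φ (A.functor.map (J.map (r • α)) x) =
      J.toForm φ (A.functor.map (J.map α) x) * algebraMap P K r
    have h1 : star (algebraMap P K (star r)) = algebraMap P K r := by
      rw [Algebra.algebraMap_eq_smul_one, star_smul, star_star, star_one,
        Algebra.algebraMap_eq_smul_one]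
    rw [J.map_smul, A.map_smul, LinearMap.map_smulₛₗ, starOp_apply, unop_op, h1, smul_eq_mul]
    exact Algebra.commutes _ _

/-- A selfadjoint representation: a representation `A` together with an identification of `A`
with `A°`. For `x ∈ A_u`, `y ∈ A_{u*}` the value at `y` of `x`, regarded as a form on `A_{u*}`,
is `J.toForm (form.hom.app u x) y`; the condition `form_symm` says that the identifications of
`A_u` with `(A_{u*})*` and of `A_{u*}` with `(A_u)*` correspond under the identification of a
space `V` with `V**` (where `x ∈ V` acts on `V*` by `φ ↦ conj (φ x)`). -/
structure SelfAdjRep (K : Type k) [DivisionRing K] [StarRing K] [Algebra P K]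
    (J : LinearInvolution P C) extends Rep P K C where
  form : functor ≅ J.adj functor
  form_symm : ∀ (a : C) (x : functor.obj a) (y : functor.obj (J.obj a)),
    J.toForm (form.hom.app a x) y =
      star (J.toForm (form.hom.app (J.obj a) y) (functor.map (J.toSS a) x))

/-- Build a selfadjoint representation from its pairing. -/
noncomputable def SelfAdjRep.ofPairing {J : LinearInvolution P C} (A : Rep P K C)
    (θ : ∀ a, A.functor.obj a →ₗ[Kᵐᵒᵖ] SemiDual K (A.functor.obj (J.obj a)))
    (bij : ∀ a, Function.Bijective (θ a))
    (nat : ∀ {a b : C} (α : a ⟶ b) (x : A.functor.obj a) (y : A.functor.obj (J.obj b)),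
      θ b (A.functor.map α x) y = θ a x (A.functor.map (J.map α) y))
    (symm : ∀ (a : C) (x : A.functor.obj a) (y : A.functor.obj (J.obj a)),
      θ a x y = star (θ (J.obj a) y (A.functor.map (J.toSS a) x))) : SelfAdjRep K J where
  toRep := A
  form := NatIso.ofComponents
    (fun a => (LinearEquiv.ofBijective (θ a) (bij a)).toModuleIso)
    (fun α => by
      refine ModuleCat.hom_ext (LinearMap.ext fun x =>
        J.toForm.injective (LinearMap.ext fun y => ?_))
      exact nat α x y)
  form_symm := symm

namespace SelfAdjRep

variable {J : LinearInvolution P C}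

/-- The pairing of `A_u` with `A_{u*}`. -/
def pair (A : SelfAdjRep K J) (a : C) :
    A.functor.obj a →ₗ[Kᵐᵒᵖ] SemiDual K (A.functor.obj (J.obj a)) :=
  J.toForm.toLinearMap ∘ₗ (A.form.hom.app a).hom

theorem pair_bijective (A : SelfAdjRep K J) (a : C) : Function.Bijective (A.pair a) :=
  J.toForm.bijective.comp (A.form.app a).toLinearEquiv.bijective

theorem pair_map (A : SelfAdjRep K J) {a b : C} (α : a ⟶ b) (x : A.functor.obj a)
    (y : A.functor.obj (J.obj b)) :
    A.pair b (A.functor.map α x) y = A.pair a x (A.functor.map (J.map α) y) :=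
  LinearMap.congr_fun
    (congrArg J.toForm (ConcreteCategory.congr_hom (A.form.hom.naturality α) x)) y

theorem pair_symm (A : SelfAdjRep K J) (a : C) (x : A.functor.obj a)
    (y : A.functor.obj (J.obj a)) :
    A.pair a x y = star (A.pair (J.obj a) y (A.functor.map (J.toSS a) x)) :=
  A.form_symm a x y

/-- The adjoint morphism `f° : B → A` of `f : A → B`, after the identifications `A = A°` and
`B = B°`. -/
def adjoint {A B : SelfAdjRep K J} (f : A.functor ⟶ B.functor) : B.functor ⟶ A.functor :=
  B.form.hom ≫ J.adjMap f ≫ A.form.inv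

theorem pair_adjoint {A B : SelfAdjRep K J} (f : A.functor ⟶ B.functor) {a : C}
    (x : B.functor.obj a) (y : A.functor.obj (J.obj a)) :
    A.pair a ((adjoint f).app a x) y = B.pair a x (f.app (J.obj a) y) := by
  have h : adjoint f ≫ A.form.hom = B.form.hom ≫ J.adjMap f := by simp [adjoint]
  exact LinearMap.congr_fun
    (congrArg J.toForm (ConcreteCategory.congr_hom (NatTrans.congr_app h a) x)) y

theorem hom_ext {A B : SelfAdjRep K J} {f g : A.functor ⟶ B.functor}
    (h : ∀ (a : C) (x : A.functor.obj a) (y : B.functor.obj (J.obj a)),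
      B.pair a (f.app a x) y = B.pair a (g.app a x) y) : f = g := by
  ext a x
  exact (B.pair_bijective a).1 (LinearMap.ext (h a x))

theorem adjoint_comp {A B D : SelfAdjRep K J} (f : A.functor ⟶ B.functor)
    (g : B.functor ⟶ D.functor) :
    adjoint (A := A) (B := D) (f ≫ g) = adjoint (B := D) g ≫ adjoint (B := B) f := by
  refine hom_ext fun a x y => ?_
  rw [pair_adjoint]
  refine Eq.trans ?_ (pair_adjoint f ((adjoint g).app a x) y).symm
  exact (pair_adjoint g x _).symm

theorem adjoint_add {A B : SelfAdjRep K J} (f g : A.functor ⟶ B.functor) :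
    adjoint (f + g) = adjoint (A := A) (B := B) f + adjoint (A := A) (B := B) g := by
  refine hom_ext fun a x y => ?_
  rw [pair_adjoint]
  have h : A.pair a ((adjoint f + adjoint (A := A) (B := B) g).app a x) y =
      A.pair a ((adjoint f).app a x) y + A.pair a ((adjoint (A := A) (B := B) g).app a x) y := by
    rw [← LinearMap.add_apply, ← map_add]; rfl
  rw [h, pair_adjoint, pair_adjoint, ← map_add]
  rfl

theorem adjoint_adjoint {A B : SelfAdjRep K J} (f : A.functor ⟶ B.functor) :
    adjoint (A := B) (B := A) (adjoint f) = f := by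
  refine hom_ext fun a x y => ?_
  rw [pair_adjoint, pair_symm A, pair_adjoint, pair_symm B a (f.app a x) y]
  exact congrArg (fun z => star (B.pair (J.obj a) y z))
    (ConcreteCategory.congr_hom (f.naturality (J.toSS a)) x)

/-- Congruence: an isomorphism `f` with `f° = f⁻¹`. -/
def Congruent (A B : SelfAdjRep K J) : Prop :=
  ∃ f : A.functor ≅ B.functor, adjoint f.hom = f.inv

end SelfAdjRep

/-! ## Direct and orthogonal sums -/

/-- The direct sum of a finite family of representations. -/
def Rep.sum {ι : Type} [Fintype ι] (A : ι → Rep P K C) : Rep P K C where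
  functor :=
    { obj := fun a => ModuleCat.of Kᵐᵒᵖ (∀ i, (A i).functor.obj a)
      map := fun α => ModuleCat.ofHom
        (LinearMap.pi fun i => ((A i).functor.map α).hom ∘ₗ LinearMap.proj i)
      map_id := fun a => by ext x i; simp
      map_comp := fun α β => by ext x i; simp }
  finite a := (inferInstance : Module.Finite Kᵐᵒᵖ (∀ i, (A i).functor.obj a))
  finite_support := by
    refine (Set.finite_iUnion fun i => (A i).finite_support).subset fun a ha => ?_
    by_contra hn
    simp only [Set.mem_iUnion, Set.mem_ofPred_eq, not_exists, not_nontrivial_iff_subsingleton] at hn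
    exact not_subsingleton_iff_nontrivial.2 ha
      (inferInstanceAs (Subsingleton (∀ i, (A i).functor.obj a)))
  map_add α β := by
    refine ModuleCat.hom_ext (LinearMap.ext fun x => funext fun i => ?_)
    exact ConcreteCategory.congr_hom ((A i).map_add α β) (x i)
  map_smul r α x := funext fun i => (A i).map_smul r α (x i)

/-- The direct sum of two representations. -/
def Rep.prod (A B : Rep P K C) : Rep P K C where
  functor :=
    { obj := fun a => ModuleCat.of Kᵐᵒᵖ (A.functor.obj a × B.functor.obj a)
      map := fun α => ModuleCat.ofHom
        (LinearMap.prodMap (A.functor.map α).hom (B.functor.map α).hom)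
      map_id := fun a => by
        refine ModuleCat.hom_ext (LinearMap.ext fun x => ?_)
        simp
      map_comp := fun α β => by
        refine ModuleCat.hom_ext (LinearMap.ext fun x => ?_)
        simp }
  finite a := (inferInstance : Module.Finite Kᵐᵒᵖ (A.functor.obj a × B.functor.obj a))
  finite_support := by
    refine (A.finite_support.union B.finite_support).subset fun a ha => ?_
    by_contra hn
    simp only [Set.mem_union, Set.mem_ofPred_eq, not_or, not_nontrivial_iff_subsingleton] at hn
    have := hn.1
    have := hn.2
    exact not_subsingleton_iff_nontrivial.2 ha
      (inferInstanceAs (Subsingleton (A.functor.obj a × B.functor.obj a)))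
  map_add α β := by
    refine ModuleCat.hom_ext (LinearMap.ext fun x => Prod.ext ?_ ?_)
    · exact ConcreteCategory.congr_hom (A.map_add α β) x.1
    · exact ConcreteCategory.congr_hom (B.map_add α β) x.2
  map_smul r α x := Prod.ext (A.map_smul r α x.1) (B.map_smul r α x.2)

/-- The pairing `(x, y) ↦ ∑ i, ⟨x i, y i⟩`. -/
def SelfAdjRep.sumPair {J : LinearInvolution P C} {ι : Type} [Fintype ι]
    (A : ι → SelfAdjRep K J) (a : C) :
    (∀ i, (A i).functor.obj a) →ₗ[Kᵐᵒᵖ] SemiDual K (∀ i, (A i).functor.obj (J.obj a)) :=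
  ∑ i, dualMap (LinearMap.proj i) ∘ₗ (A i).pair a ∘ₗ LinearMap.proj i

theorem SelfAdjRep.sumPair_apply {J : LinearInvolution P C} {ι : Type} [Fintype ι]
    (A : ι → SelfAdjRep K J) (a : C) (x : ∀ i, (A i).functor.obj a)
    (y : ∀ i, (A i).functor.obj (J.obj a)) :
    sumPair A a x y = ∑ i, (A i).pair a (x i) (y i) := by
  simp [sumPair]

theorem SelfAdjRep.sumPair_single {J : LinearInvolution P C} {ι : Type} [Fintype ι]
    [DecidableEq ι] (A : ι → SelfAdjRep K J) (a : C) (x : ∀ i, (A i).functor.obj a) (i : ι)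
    (y : (A i).functor.obj (J.obj a)) :
    sumPair A a x (Pi.single i y) = (A i).pair a (x i) y := by
  rw [sumPair_apply, Finset.sum_eq_single i]
  · simp
  · intro j _ hj
    simp [Pi.single_eq_of_ne hj]
  · simp

theorem SelfAdjRep.sumPair_bijective {J : LinearInvolution P C} {ι : Type} [Fintype ι]
    (A : ι → SelfAdjRep K J) (a : C) : Function.Bijective (sumPair A a) := by
  classical
  constructor
  · intro x x' h
    funext i
    refine ((A i).pair_bijective a).1 (LinearMap.ext fun y => ?_)
    rw [← sumPair_single A a x, ← sumPair_single A a x', h]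
  · intro φ
    choose x hx using fun i => ((A i).pair_bijective a).2
      (dualMap (LinearMap.single Kᵐᵒᵖ (fun i => (A i).functor.obj (J.obj a)) i) φ)
    refine ⟨x, LinearMap.ext fun y => ?_⟩
    rw [sumPair_apply]
    simp only [hx, dualMap_apply]
    rw [← map_sum]
    congr 1
    exact LinearMap.sum_single_apply _ y

/-- The orthogonal sum of a finite family of selfadjoint representations: the direct sum, on
which an element `y` of the component at `u*` acts on an element `x` of the component at `u`
summand by summand. -/
noncomputable def SelfAdjRep.orthSum {J : LinearInvolution P C} {ι : Type} [Fintype ι]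
    (A : ι → SelfAdjRep K J) : SelfAdjRep K J :=
  SelfAdjRep.ofPairing (Rep.sum fun i => (A i).toRep) (sumPair A) (sumPair_bijective A)
    (fun {a b} α x y => by
      refine (sumPair_apply A b _ y).trans (Eq.trans ?_ (sumPair_apply A a x _).symm)
      exact Finset.sum_congr rfl fun i _ => (A i).pair_map α (x i) (y i))
    (fun a x y => by
      refine (sumPair_apply A a x y).trans ?_
      refine Eq.trans ?_ (congrArg star (sumPair_apply A (J.obj a) y _).symm)
      rw [star_sum]
      exact Finset.sum_congr rfl fun i _ => (A i).pair_symm a (x i) (y i))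

/-- The pairing of `A ⊕ A°` at `u`: for `(x, φ) ∈ A_u ⊕ (A_{u*})*` and
`(y, ψ) ∈ A_{u*} ⊕ (A_{u**})*` it is `φ y + conj (ψ x)`. -/
def Rep.plusPair (J : LinearInvolution P C) (A : Rep P K C) (a : C) :
    (A.functor.obj a × SemiDual K (A.functor.obj (J.obj a))) →ₗ[Kᵐᵒᵖ]
      SemiDual K (A.functor.obj (J.obj a) × SemiDual K (A.functor.obj (J.obj (J.obj a)))) :=
  dualMap (LinearMap.fst _ _ _) ∘ₗ LinearMap.snd _ _ _ +
    dualMap (LinearMap.snd _ _ _) ∘ₗ evalMap ∘ₗ (A.functor.map (J.toSS a)).hom ∘ₗ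
      LinearMap.fst _ _ _

theorem Rep.plusPair_apply (J : LinearInvolution P C) (A : Rep P K C) (a : C)
    (x : A.functor.obj a × SemiDual K (A.functor.obj (J.obj a)))
    (y : A.functor.obj (J.obj a) × SemiDual K (A.functor.obj (J.obj (J.obj a)))) :
    A.plusPair J a x y = x.2 y.1 + star (y.2 (A.functor.map (J.toSS a) x.1)) := rfl

theorem LinearInvolution.toSS_bijective {K : Type k} [DivisionRing K]
    (J : LinearInvolution P C) (A : C ⥤ ModuleCat.{k} Kᵐᵒᵖ) (a : C) :
    Function.Bijective (A.map (J.toSS a)) :=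
  (A.mapIso (eqToIso (J.obj_obj a).symm)).toLinearEquiv.bijective

theorem Rep.plusPair_bijective (J : LinearInvolution P C) (A : Rep P K C) (a : C) :
    Function.Bijective (A.plusPair J a) := by
  have hb := (evalMap_bijective (K := K)
    (V := A.functor.obj (J.obj (J.obj a)))).comp (J.toSS_bijective A.functor a)
  constructor
  · intro x x' h
    refine Prod.ext (hb.1 (LinearMap.ext fun ψ => ?_)) (LinearMap.ext fun y => ?_)
    · simpa [plusPair_apply] using LinearMap.congr_fun h (0, ψ)
    · simpa [plusPair_apply] using LinearMap.congr_fun h (y, 0)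
  · intro Φ
    obtain ⟨x, hx⟩ := hb.2 (dualMap (LinearMap.inr _ _ _) Φ)
    refine ⟨(x, dualMap (LinearMap.inl _ _ _) Φ), LinearMap.ext fun y => ?_⟩
    have h2 := LinearMap.congr_fun hx y.2
    simp only [Function.comp_apply, evalMap_apply, dualMap_apply, LinearMap.inr_apply] at h2
    rw [plusPair_apply, h2, dualMap_apply, ← LinearMap.map_add]
    simp

/-- The selfadjoint representation `A⁺`, which is `A ⊕ A°` with the natural pairing. -/
noncomputable def Rep.plus [StarModule P K] (J : LinearInvolution P C) (A : Rep P K C) :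
    SelfAdjRep K J :=
  SelfAdjRep.ofPairing (A.prod (A.adjoint J)) (A.plusPair J) (A.plusPair_bijective J)
    (fun {a b} α x y => by
      have h := ConcreteCategory.congr_hom (congrArg A.functor.map (J.toSS_naturality α)) x.1
      simp only [Functor.map_comp] at h
      exact congrArg (fun z => J.toForm x.2 (A.functor.map (J.map α) y.1) +
        star (J.toForm y.2 z)) h.symm)
    (fun a x y => by
      have h := ConcreteCategory.congr_hom (congrArg A.functor.map (J.toSS_map_toSS a)) y.1
      simp only [Functor.map_comp, CategoryTheory.Functor.map_id] at h
      change J.toForm x.2 y.1 + star (J.toForm y.2 (A.functor.map (J.toSS a) x.1)) =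
        star (J.toForm y.2 (A.functor.map (J.toSS a) x.1) + star (J.toForm x.2
          (A.functor.map (J.map (J.toSS a)) (A.functor.map (J.toSS (J.obj a)) y.1))))
      rw [star_add, star_star, add_comm]
      exact congrArg (fun z => _ + J.toForm x.2 z) h.symm)

/-! ## Twisting by a selfadjoint automorphism -/

/-- A selfadjoint automorphism `f = f°` of a selfadjoint representation. -/
structure SelfAdjAut {J : LinearInvolution P C} (B : SelfAdjRep K J) where
  iso : B.functor ≅ B.functor
  adjoint_eq : SelfAdjRep.adjoint iso.hom = iso.hom

namespace SelfAdjAut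

variable {J : LinearInvolution P C} {B : SelfAdjRep K J}

theorem pair_hom (f : SelfAdjAut B) {a : C} (x : B.functor.obj a)
    (y : B.functor.obj (J.obj a)) :
    B.pair a (f.iso.hom.app a x) y = B.pair a x (f.iso.hom.app (J.obj a) y) := by
  have h := B.pair_adjoint f.iso.hom x y
  rwa [f.adjoint_eq] at h

variable (B) in
/-- The automorphism `-1`. -/
def negOne : SelfAdjAut B where
  iso := ⟨-𝟙 _, -𝟙 _, by simp, by simp⟩
  adjoint_eq := by
    refine SelfAdjRep.hom_ext fun a x y => ?_
    rw [SelfAdjRep.pair_adjoint]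
    change B.pair a x (-y) = B.pair a (-x) y
    simp

open Classical in
/-- The isomorphisms `f̃_v`, equal to `f_v` for `v ∈ S₀` and to `1` otherwise. -/
noncomputable def tilde (S₀ : Set C) (f : SelfAdjAut B) (a : C) :
    B.functor.obj a ≅ B.functor.obj a :=
  if a ∈ S₀ then f.iso.app a else Iso.refl _

end SelfAdjAut

open SelfAdjAut in
/-- The representation with `A^f_v = A_v` and `A^f_α = f̃_v⁻¹ A_α f̃_u` for `α : u → v`. -/
noncomputable def Rep.twist {J : LinearInvolution P C} (B : SelfAdjRep K J) (S₀ : Set C)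
    (f : SelfAdjAut B) : Rep P K C where
  functor :=
    { obj := B.functor.obj
      map := fun {a b} α => (f.tilde S₀ a).hom ≫ B.functor.map α ≫ (f.tilde S₀ b).inv
      map_id := fun a => by simp
      map_comp := fun α β => by simp }
  finite := B.finite
  finite_support := B.finite_support
  map_add α β := by simp [B.map_add]
  map_smul {a b} r α x := by
    change (f.tilde S₀ b).inv (B.functor.map (r • α) ((f.tilde S₀ a).hom x)) =
      _ • (f.tilde S₀ b).inv (B.functor.map α ((f.tilde S₀ a).hom x))
    rw [B.map_smul]
    exact LinearMap.map_smul _ _ _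

namespace SelfAdjAut

variable {J : LinearInvolution P C} {B : SelfAdjRep K J}

theorem pair_tilde {S₀ : Set C} (hS₀ : J.IsHalf S₀) (f : SelfAdjAut B) {a : C}
    (x : B.functor.obj a) (y : B.functor.obj (J.obj a)) :
    B.pair a ((f.tilde S₀ a).hom x) ((f.tilde S₀ (J.obj a)).hom y) =
      B.pair a (f.iso.hom.app a x) y := by
  by_cases h : a ∈ S₀
  · have h' : J.obj a ∉ S₀ := fun h' => (hS₀ a).1 h' h
    rw [tilde, tilde, if_pos h, if_neg h']
    rfl
  · rw [tilde, tilde, if_neg h, if_pos ((hS₀ a).2 h), f.pair_hom]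
    rfl

theorem tilde_comm (S₀ : Set C) (f : SelfAdjAut B) (a : C) :
    (f.tilde S₀ a).hom ≫ f.iso.hom.app a = f.iso.hom.app a ≫ (f.tilde S₀ a).hom := by
  by_cases h : a ∈ S₀ <;> simp [tilde, h]

theorem tilde_eqToHom (S₀ : Set C) (f : SelfAdjAut B) {a b : C} (h : a = b) :
    (f.tilde S₀ a).hom ≫ B.functor.map (eqToHom h) ≫ (f.tilde S₀ b).inv =
      B.functor.map (eqToHom h) := by
  subst h
  simp

theorem twist_nat {S₀ : Set C} (hS₀ : J.IsHalf S₀) (f : SelfAdjAut B) {a b : C} (α : a ⟶ b)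
    (x : B.functor.obj a) (y : B.functor.obj (J.obj b)) :
    B.pair b ((f.tilde S₀ b).inv (B.functor.map α ((f.tilde S₀ a).hom x))) y =
      B.pair a x ((f.tilde S₀ (J.obj a)).inv
        (B.functor.map (J.map α) ((f.tilde S₀ (J.obj b)).hom y))) := by
  obtain ⟨x, rfl⟩ : ∃ x', x = f.iso.hom.app a x' :=
    ⟨f.iso.inv.app a x, by rw [← ConcreteCategory.comp_apply]; simp⟩
  -- `f̃_u f_u x = f_u f̃_u x`, and `f` is natural
  have h1 : (f.tilde S₀ b).inv (B.functor.map α ((f.tilde S₀ a).hom (f.iso.hom.app a x))) =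
      f.iso.hom.app b ((f.tilde S₀ b).inv (B.functor.map α ((f.tilde S₀ a).hom x))) := by
    have h : f.iso.hom.app a ≫ (f.tilde S₀ a).hom ≫ B.functor.map α ≫ (f.tilde S₀ b).inv =
        ((f.tilde S₀ a).hom ≫ B.functor.map α ≫ (f.tilde S₀ b).inv) ≫ f.iso.hom.app b := by
      have h2 : (f.tilde S₀ b).inv ≫ f.iso.hom.app b = f.iso.hom.app b ≫ (f.tilde S₀ b).inv := by
        rw [Iso.inv_comp_eq, ← Category.assoc, f.tilde_comm, Category.assoc, Iso.hom_inv_id,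
          Category.comp_id]
      rw [Category.assoc, Category.assoc, h2, ← Category.assoc, ← f.tilde_comm, Category.assoc,
        ← f.iso.hom.naturality_assoc]
    exact ConcreteCategory.congr_hom h x
  rw [h1, ← f.pair_tilde hS₀, ← f.pair_tilde hS₀]
  have h3 : ∀ (c : C) (z : B.functor.obj c), (f.tilde S₀ c).hom ((f.tilde S₀ c).inv z) = z :=
    fun c z => by rw [← ConcreteCategory.comp_apply]; simp
  rw [h3, h3, B.pair_map]

end SelfAdjAut

/-- The selfadjoint representation `A^f`; its components at `u` and `u*` are paired as those of
`A` are. -/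
noncomputable def SelfAdjRep.twist {J : LinearInvolution P C} (B : SelfAdjRep K J) {S₀ : Set C}
    (hS₀ : J.IsHalf S₀) (f : SelfAdjAut B) : SelfAdjRep K J :=
  SelfAdjRep.ofPairing (Rep.twist B S₀ f) B.pair B.pair_bijective
    (fun α x y => f.twist_nat hS₀ α x y)
    (fun a x y => by
      have h : (Rep.twist B S₀ f).functor.map (J.toSS a) = B.functor.map (J.toSS a) :=
        f.tilde_eqToHom S₀ _
      rw [h]
      exact B.pair_symm a x y)

/-! ## The skew field `T(B)` -/

theorem star_mem_jacobson {R : Type*} [Ring R] [StarRing R] {x : R}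
    (hx : x ∈ Ring.jacobson R) : star x ∈ Ring.jacobson R := by
  rw [← Ideal.jacobson_bot, Ideal.mem_jacobson_iff]
  intro y
  have hJ : -(x * star y) ∈ Ring.jacobson R :=
    neg_mem (Ideal.mul_mem_right _ _ hx)
  have key : ∀ r : R, r - 1 ∈ Ring.jacobson R → ∃ s, s * r = 1 := fun r hr => by
    rw [← Ideal.jacobson_bot] at hr
    obtain ⟨s, hs⟩ := Ideal.exists_mul_sub_mem_of_sub_one_mem_jacobson r hr
    exact ⟨s, sub_eq_zero.1 ((Submodule.mem_bot R).1 hs)⟩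
  obtain ⟨w, hw⟩ := key (1 + x * star y) (by simpa using neg_mem hJ)
  obtain ⟨z, hz⟩ := key w (by
    have h : w - 1 = w * -(x * star y) := by
      rw [mul_add, mul_one] at hw
      rw [mul_neg, ← hw]
      abel
    rw [h]
    exact Ideal.mul_mem_left _ _ hJ)
  have hzw : z = 1 + x * star y := left_inv_eq_right_inv hz hw
  rw [hzw] at hz
  refine ⟨star w, (Submodule.mem_bot R).2 ?_⟩
  have h := congrArg star hz
  simp only [star_mul, star_add, star_one, star_star] at h
  rw [mul_add, mul_one] at h
  rw [← h, mul_assoc]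
  abel

namespace SelfAdjRep

variable {J : LinearInvolution P C}

/-- The involution `f ↦ f°` of the endomorphism ring. -/
@[reducible] def endStarRing (B : SelfAdjRep K J) : StarRing (End B.functor) where
  star f := adjoint (A := B) (B := B) f
  star_involutive f := adjoint_adjoint (A := B) (B := B) f
  star_mul f g := adjoint_comp (A := B) (B := B) (D := B) g f
  star_add f g := adjoint_add (A := B) (B := B) f g

/-- `T(B)`: the quotient of the endomorphism ring of `B` by its radical. -/
def T (B : SelfAdjRep K J) : Type _ := End B.functor ⧸ Ring.jacobson (End B.functor)

noncomputable instance (B : SelfAdjRep K J) : Ring B.T :=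
  inferInstanceAs (Ring (End B.functor ⧸ Ring.jacobson (End B.functor)))

/-- The class `f + R` in `T(B)` of an endomorphism `f`. -/
noncomputable def toT (B : SelfAdjRep K J) : End B.functor →+* B.T :=
  Ideal.Quotient.mk (Ring.jacobson (End B.functor))

/-- The involution `(f + R)° = f° + R` of `T(B)`. -/
noncomputable instance (B : SelfAdjRep K J) : Star B.T where
  star := Quotient.lift (fun f : End B.functor => B.toT (adjoint (A := B) (B := B) f)) (by
    intro f g h
    let _ := B.endStarRing
    have h' : f - g ∈ Ring.jacobson (End B.functor) := (Submodule.quotientRel_def _).1 h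
    have h2 := star_mem_jacobson h'
    rw [star_sub] at h2
    exact Ideal.Quotient.eq.2 h2)

theorem star_toT (B : SelfAdjRep K J) (f : End B.functor) :
    star (B.toT f) = B.toT (adjoint (A := B) (B := B) f) := rfl

end SelfAdjRep

/-! ## Systems of indecomposable representations -/

/-- `ind` is a complete system of pairwise nonisomorphic indecomposable representations. -/
structure IsInd (ind : Set (Rep P K C)) : Prop where
  indec : ∀ A ∈ ind, A.IsIndec
  inj : ∀ A ∈ ind, ∀ B ∈ ind, A.Isom B → A = B
  complete : ∀ A : Rep P K C, A.IsIndec → ∃ B ∈ ind, A.Isom B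

/-- `A` is isomorphic to a selfadjoint representation. -/
def Rep.IsoToSelfAdj (J : LinearInvolution P C) (A : Rep P K C) : Prop :=
  ∃ S : SelfAdjRep K J, A.Isom S.toRep

/-- `ind₀` is obtained by replacing each member of `ind` that is isomorphic to a selfadjoint
representation by one (isomorphic to it) that is actually selfadjoint. -/
structure IsInd₀ (J : LinearInvolution P C) (ind : Set (Rep P K C))
    (ind₀ : Set (SelfAdjRep K J)) : Prop where
  mem : ∀ B ∈ ind₀, ∃ A ∈ ind, A.Isom B.toRep
  existsUnique : ∀ A ∈ ind, A.IsoToSelfAdj J → ∃! B, B ∈ ind₀ ∧ A.Isom B.toRep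

/-- `ind₁` consists of the members of `ind` that are isomorphic to their adjoints but not to a
selfadjoint representation, together with one representation from each pair `{A, B} ⊆ ind` such
that `A` is not isomorphic to `A°` but is isomorphic to `B°`. -/
structure IsInd₁ [StarModule P K] (J : LinearInvolution P C) (ind : Set (Rep P K C))
    (ind₁ : Set (Rep P K C)) : Prop where
  subset : ind₁ ⊆ ind
  not_selfAdj : ∀ A ∈ ind₁, ¬ A.IsoToSelfAdj J
  mem_of_isom : ∀ A ∈ ind, A.Isom (A.adjoint J) → ¬ A.IsoToSelfAdj J → A ∈ ind₁
  one_of_pair : ∀ A ∈ ind, ∀ B ∈ ind, ¬ A.Isom (A.adjoint J) → A.Isom (B.adjoint J) →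
    Xor (A ∈ ind₁) (B ∈ ind₁)

/-- A choice of a selfadjoint automorphism `f_a = f_a° ∈ a` for every `B ∈ ind₀` and every
`0 ≠ a = a° ∈ T(B)`. -/
structure AutChoice {J : LinearInvolution P C} (ind₀ : Set (SelfAdjRep K J)) where
  aut : ∀ (B : ind₀), {a : B.1.T // star a = a ∧ a ≠ 0} → SelfAdjAut B.1
  toT_aut : ∀ (B : ind₀) (a : {a : B.1.T // star a = a ∧ a ≠ 0}),
    B.1.toT (aut B a).iso.hom = a.1

/-- Labels of the summands `A⁺` (`A ∈ ind₁`) and `B^a` (`B ∈ ind₀`, `0 ≠ a = a° ∈ T(B)`). -/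
abbrev Label {J : LinearInvolution P C} (ind₁ : Set (Rep P K C)) (ind₀ : Set (SelfAdjRep K J)) :=
  ind₁ ⊕ (Σ B : ind₀, {a : B.1.T // star a = a ∧ a ≠ 0})

/-- The summand with a given label: `A⁺`, or `B^a`, which is `B^f` for `f = f_a`. -/
noncomputable def AutChoice.summand [StarModule P K] {J : LinearInvolution P C}
    {ind₀ : Set (SelfAdjRep K J)} (c : AutChoice ind₀) (ind₁ : Set (Rep P K C))
    {S₀ : Set C} (hS₀ : J.IsHalf S₀) : Label ind₁ ind₀ → SelfAdjRep K J
  | Sum.inl A => A.1.plus J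
  | Sum.inr ⟨B, a⟩ => B.1.twist hS₀ (c.aut B a)

/-- Every selfadjoint representation is congruent to an orthogonal sum of summands `X l` over an
admissible finite family of labels `l`, and this family is unique up to permutation. -/
def HasUniqueOrthDecomp {J : LinearInvolution P C} {L : Type*} (X : L → SelfAdjRep K J)
    (Admissible : ∀ n : ℕ, (Fin n → L) → Prop) : Prop :=
  ∀ S : SelfAdjRep K J,
    (∃ (n : ℕ) (l : Fin n → L), Admissible n l ∧
      S.Congruent (SelfAdjRep.orthSum fun i => X (l i))) ∧
    ∀ (n m : ℕ) (l : Fin n → L) (l' : Fin m → L), Admissible n l → Admissible m l' →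
      S.Congruent (SelfAdjRep.orthSum fun i => X (l i)) →
      S.Congruent (SelfAdjRep.orthSum fun i => X (l' i)) →
      ∃ e : Fin n ≃ Fin m, ∀ i, l i = l' (e i)

end Reps

/-! ## The classes of skew fields -/

/-- The ring `T` is an algebraically closed field. -/
def IsAlgClosedField (T : Type*) [Ring T] : Prop :=
  ∃ h : IsField T, @IsAlgClosed T h.toField

/-- The ring `T` is a real closed field. -/
def IsRealClosedField (T : Type*) [Ring T] : Prop :=
  ∃ h : IsField T, @IsRealClosed T h.toField

/-- The involution of `T` is the identity. -/
def IdInvolution (T : Type*) [Star T] : Prop := ∀ t : T, star t = t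

/-- The ring `T` is the algebra of quaternions over `P`, with an involution that is not the
standard one `a + bi + cj + dk ↦ a - bi - cj - dk`. -/
def IsNonstdQuaternion (P : Type*) [Field P] (T : Type*) [Ring T] [Star T] : Prop :=
  ∃ e : T ≃+* Quaternion P, ∃ t : T, e (star t) ≠ star (e t)

end SelfAdj

set_option linter.unusedSectionVars false

namespace SelfAdj

/-! ## Rings in which every element is invertible or nilpotent -/

section Ring

/-! Selfadjoint representations with all natural transformations as morphisms form a category in
which `f ↦ f°` is a dagger. Congruence is unitary isomorphism, and an orthogonal decomposition of
`S` is a family of isometries into `S` with orthogonal images whose projections add up to `1`. In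
each of the four cases `K` is finite over its centre `P`. Hence endomorphism rings are
finite-dimensional over `P`, every endomorphism of an indecomposable is a unit or nilpotent
(`isUnit_or_isNilpotent_of_idempotents`), and `T(B)` is a finite-dimensional division algebra with
involution.

Since `2` is invertible, `1 + r` is congruent to `1` for every selfadjoint nilpotent `r`
(`exists_conj_one_add`), so a form on `B` matters only through its class in `T(B)`.

Existence. Let `A` be an indecomposable summand of `S` with inclusion `i` and projection `p`, and
consider the endomorphism `i ≫ (p ≫ i)° ≫ p` of `A`. If it is a unit, the form of `S` is
nondegenerate on `A`, and `A` is isomorphic to a selfadjoint representation. If it is nilpotent, `A`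
and a copy of `A°` span a hyperbolic subobject, and `A⁺` embeds isometrically
(`exists_isometry_of_hyperbolic`). A selfadjoint `B` can be placed in `S` with invertible Gram
endomorphism even in the nilpotent case, because `B⁺` represents the form of `B` itself. An
isometric subobject has an orthogonal complement with smaller endomorphism algebra, so induction
applies (`IsSummandFamily.exists_decomp`). Which `B^a` are needed is decided by the classes of `a`
under `a ↦ ȳ a y` in `T(B)`.

Uniqueness. The number of summands with a given `A` or `B` is found by a Krull–Schmidt count, as a
rank over the residue division ring (`card_key_le`). Two decompositions of `S` yield, for each `B`,
a matrix over `T(B)` relating two diagonal hermitian forms (`exists_gram`), so everything reduces to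
diagonal forms over `T(B)`.

These are classified as follows. For `P` algebraically closed, `T(B) = P`: with identity involution
every nonzero coefficient becomes `1`; otherwise sums of norms are anisotropic, the coefficients
become `±1`, and Sylvester's inertia holds. For `P` real closed, if all selfadjoint elements of
`T(B)` lie in `P`, then `∑ x x̄` is anisotropic and inertia holds again; if some lie outside, every
selfadjoint element is the square of a selfadjoint one, and by Frobenius' theorem these are exactly
the exceptional algebras of (c). For `P` finite, `T(B)` is a field by Wedderburn: either every fixed
element is a norm, or forms are classified by rank and discriminant. -/

theorem exists_selfAdjoint_half {E : Type*} [Ring E] [StarRing E] (h2 : IsUnit (2 : E)) :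
    ∃ h : E, h + h = 1 ∧ star h = h ∧ ∀ x : E, h * x = x * h := by
  obtain ⟨u, hu⟩ := h2
  refine ⟨↑u⁻¹, by rw [← mul_two, ← hu]; simp, ?_, fun x => ?_⟩
  · have h3 : (u : E) * star (↑u⁻¹ : E) = 1 := by
      have : star (u : E) = u := by rw [hu]; exact star_ofNat 2
      rw [← this, ← star_mul]; simp
    exact (Units.inv_eq_of_mul_eq_one_right h3).symm
  · have : Commute (u : E) x := by rw [hu]; exact (Commute.ofNat_left 2 x)
    exact (this.units_inv_left).eq

/-- In a ring with involution where `2` is invertible, `1 + r` is congruent to `1` for every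
selfadjoint nilpotent `r`. -/
theorem exists_conj_one_add_of_pow {E : Type*} [Ring E] [StarRing E] (h2 : IsUnit (2 : E)) :
    ∀ (n : ℕ) (r : E), star r = r → r ^ n = 0 →
      ∃ g : E, IsUnit g ∧ star g * (1 + r) * g = 1 := by
  intro n
  induction n using Nat.strong_induction_on with
  | _ n ih =>
    intro r hr hn
    by_cases h1 : n ≤ 1
    · have h0 : r = 0 := by
        interval_cases n
        · rw [← mul_one r, ← pow_zero r, hn, mul_zero]
        · simpa using hn
      exact ⟨1, isUnit_one, by simp [h0]⟩
    · obtain ⟨h, hh1, hs, hc⟩ := exists_selfAdjoint_half h2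
      -- Newton's method for `(1 + r)^(-1/2)`: `1 - r/2` is correct to first order, so the new error
      -- `r'` is divisible by the square of `r/2` and has about half the nilpotency exponent.
      set g := 1 - h * r with hg
      have hgs : star g = g := by
        rw [hg, star_sub, star_one, star_mul, hr, hs, hc]
      have hzn : (h * r) ^ n = 0 := by
        have : Commute h r := hc r
        rw [this.mul_pow, hn, mul_zero]
      have hgu : IsUnit g := IsNilpotent.isUnit_one_sub ⟨n, hzn⟩
      set r' := g * (1 + r) * g - 1 with hr'
      have hr's : star r' = r' := by
        rw [hr', star_sub, star_mul, star_mul, star_add, hgs, hr, star_one, mul_assoc]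
      -- With `z = r/2`, this is `(1 - z)(1 + 2z)(1 - z) - 1 = 2z³ - 3z²`.
      have hfac : r' = (h * r) ^ 2 * (2 * (h * r) - 3) := by
        have e1 : r = h * r + h * r := by rw [← add_mul, hh1, one_mul]
        generalize h * r = z at *
        rw [hr', hg, e1]
        noncomm_ring
      have hpow : r' ^ ((n + 1) / 2) = 0 := by
        have hc2 : Commute ((h * r) ^ 2) (2 * (h * r) - 3) :=
          (((Commute.ofNat_right _ 2).mul_right (Commute.refl _)).sub_right
            (Commute.ofNat_right _ 3)).pow_left 2
        rw [hfac, hc2.mul_pow, ← pow_mul]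
        -- Half of `n` is rounded up, which is still smaller than `n` because `n ≥ 2` here.
        have : n ≤ 2 * ((n + 1) / 2) := by omega
        rw [pow_eq_zero_of_le this hzn, zero_mul]
      obtain ⟨g', hg'u, hg'⟩ := ih ((n + 1) / 2) (by omega) r' hr's hpow
      refine ⟨g * g', hgu.mul hg'u, ?_⟩
      have : 1 + r' = g * (1 + r) * g := by rw [hr']; abel
      rw [this] at hg'
      rw [star_mul, hgs]
      simpa only [mul_assoc] using hg'

theorem exists_conj_one_add {E : Type*} [Ring E] [StarRing E] (h2 : IsUnit (2 : E)) {r : E}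
    (hr : star r = r) (hn : IsNilpotent r) : ∃ g : E, IsUnit g ∧ star g * (1 + r) * g = 1 := by
  obtain ⟨n, hn⟩ := hn
  exact exists_conj_one_add_of_pow h2 n r hr hn

/-- A finite-dimensional algebra without nontrivial idempotents consists of units and nilpotent
elements. -/
theorem isUnit_or_isNilpotent_of_idempotents {P E : Type*} [Field P] [Ring E] [Algebra P E]
    [Module.Finite P E] (h : ∀ e : E, e * e = e → e = 0 ∨ e = 1) (r : E) :
    IsUnit r ∨ IsNilpotent r := by
  open Polynomial in
  have hintegral : IsIntegral P r := Algebra.IsIntegral.isIntegral r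
  -- Fitting's lemma: write the minimal polynomial as `X ^ n * q` with `q` prime to `X`. Bézout for
  -- `X ^ n` and `q` gives an idempotent; Bézout for `X` and `q` gives the inverse of `r` when `q(r)
  -- = 0`.
  obtain ⟨q, hq, hXq⟩ := exists_eq_pow_rootMultiplicity_mul_and_not_dvd (minpoly P r)
    (minpoly.ne_zero hintegral) 0
  set n := rootMultiplicity 0 (minpoly P r)
  rw [C_0, sub_zero] at hq hXq
  have hcop : IsCoprime (X : P[X]) q := (Prime.coprime_iff_not_dvd prime_X).2 hXq
  have hzero : r ^ n * aeval r q = 0 := by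
    have := minpoly.aeval P r
    rw [hq] at this
    simpa using this
  obtain ⟨a, b, hab⟩ := hcop.pow_left (m := n)
  obtain ⟨a', b', hab'⟩ := hcop
  have hc : ∀ s t : P[X], aeval r s * aeval r t = aeval r t * aeval r s := fun s t => by
    rw [← map_mul, mul_comm, map_mul]
  have h1 : aeval r a * r ^ n + aeval r b * aeval r q = 1 := by
    simpa using congrArg (aeval r) hab
  have h1' : aeval r a' * r + aeval r b' * aeval r q = 1 := by
    simpa using congrArg (aeval r) hab'
  have hXc : ∀ s : P[X], aeval r s * r = r * aeval r s := fun s => by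
    simpa using hc s X
  have hXnc : ∀ s : P[X], aeval r s * r ^ n = r ^ n * aeval r s := fun s => by
    simpa using hc s (X ^ n)
  have hid : aeval r a * r ^ n * (aeval r a * r ^ n) = aeval r a * r ^ n := by
    have : aeval r a * r ^ n * (aeval r b * aeval r q) = 0 := by
      rw [mul_assoc, ← mul_assoc (r ^ n), ← hXnc, mul_assoc, hzero, mul_zero, mul_zero]
    calc _ = aeval r a * r ^ n * (aeval r a * r ^ n)
          + aeval r a * r ^ n * (aeval r b * aeval r q) := by rw [this, add_zero]
      _ = _ := by rw [← mul_add, h1, mul_one]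
  rcases h _ hid with h0 | h0
  · right
    refine ⟨n, ?_⟩
    rw [h0, zero_add] at h1
    rw [← mul_one (r ^ n), ← h1, hc, ← mul_assoc, hzero, zero_mul]
  · left
    have hq0 : aeval r q = 0 := by
      rw [← one_mul (aeval r q), ← h0, mul_assoc, hzero, mul_zero]
    rw [hq0, mul_zero, add_zero] at h1'
    exact ⟨⟨r, aeval r a', by rw [← hXc, h1'], h1'⟩, rfl⟩

theorem isNilpotent_of_mem_jacobson {P E : Type*} [Field P] [Ring E] [Algebra P E]
    [Module.Finite P E] {r : E} (hr : r ∈ Ring.jacobson E) : IsNilpotent r := by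
  have : IsArtinianRing E := IsArtinianRing.of_finite P E
  obtain ⟨n, hn⟩ := IsArtinianRing.isNilpotent_jacobson_bot (R := E)
  refine ⟨n, ?_⟩
  rw [Ideal.jacobson_bot] at hn
  have := Ideal.pow_mem_pow hr n
  rw [hn] at this
  simpa using this

/-- Nontrivial rings in which every element is invertible or nilpotent. -/
structure UnitOrNil (E : Type*) [Ring E] : Prop where
  nontrivial : Nontrivial E
  unit_or_nil : ∀ r : E, IsUnit r ∨ IsNilpotent r

namespace UnitOrNil

variable {E : Type*} [Ring E]

/-- If `y` were nilpotent, `x ^ n * y ^ n = 1` would fail for large `n`. -/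
theorem isUnit_of_mul_eq_one_right (hE : UnitOrNil E) {x y : E} (h : x * y = 1) : IsUnit y := by
  have := hE.nontrivial
  refine (hE.unit_or_nil y).resolve_right fun ⟨n, hn⟩ => ?_
  have : ∀ m : ℕ, x ^ m * y ^ m = 1 := by
    intro m
    induction m with
    | zero => simp
    | succ m ih =>
      rw [pow_succ, pow_succ', mul_assoc, ← mul_assoc x y, h, one_mul, ih]
  have h1 := this n
  rw [hn, mul_zero] at h1
  exact zero_ne_one h1

theorem isUnit_right (hE : UnitOrNil E) {x y : E} (h : IsUnit (x * y)) : IsUnit y := by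
  obtain ⟨u, hu⟩ := h
  refine hE.isUnit_of_mul_eq_one_right (x := ↑u⁻¹ * x) ?_
  rw [mul_assoc, ← hu]; simp

/-- For a nonunit `r`, no `y * r` is a unit, so `y * r` is nilpotent and `1 + y * r` is invertible.
-/
theorem mem_jacobson (hE : UnitOrNil E) {r : E} : r ∈ Ring.jacobson E ↔ ¬ IsUnit r := by
  have := hE.nontrivial
  constructor
  · intro hr hu
    have htop := Ideal.eq_top_of_isUnit_mem _ hr hu
    rw [← Ideal.jacobson_bot, Ideal.jacobson_eq_top_iff] at htop
    exact bot_ne_top htop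
  · intro hr
    rw [← Ideal.jacobson_bot, Ideal.mem_jacobson_iff]
    intro y
    have h1 : IsNilpotent (y * r) :=
      (hE.unit_or_nil _).resolve_left fun h => hr (hE.isUnit_right h)
    obtain ⟨z, hz⟩ := h1.isUnit_one_add.exists_left_inv
    refine ⟨z, (Submodule.mem_bot E).2 ?_⟩
    rw [mul_assoc, sub_eq_zero, ← hz, mul_add, mul_one, add_comm]

end UnitOrNil

end Ring

/-! ## Matrices over a division ring -/

/-- If `M N = 1`, then `v ↦ v M` is injective, and dimensions over a division ring can be compared.
This is the rank argument behind the comparison of multiplicities. -/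
theorem card_le_of_matrix {T : Type*} [DivisionRing T] {I J : Type*} [Fintype I] [Fintype J]
    [DecidableEq I] (M : I → J → T) (N : J → I → T)
    (h : ∀ i k, ∑ j, M i j * N j k = if i = k then 1 else 0) :
    Fintype.card I ≤ Fintype.card J := by
  have hMN : (Matrix.of M) * (Matrix.of N) = 1 := by
    ext i k
    rw [Matrix.mul_apply, Matrix.one_apply]
    exact h i k
  have hinj : Function.Injective (Matrix.vecMulLinear (R := T) (Matrix.of M)) := by
    refine Function.LeftInverse.injective (g := fun v => Matrix.vecMul v (Matrix.of N)) fun v => ?_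
    change Matrix.vecMul (Matrix.vecMul v (Matrix.of M)) (Matrix.of N) = v
    rw [Matrix.vecMul_vecMul, hMN, Matrix.vecMul_one]
  simpa using LinearMap.finrank_le_finrank_of_injective hinj

theorem exists_left_kernel {T : Type*} [DivisionRing T] {I J : Type*} [Fintype I] [Fintype J]
    (M : I → J → T) (h : Fintype.card J < Fintype.card I) :
    ∃ x : I → T, x ≠ 0 ∧ ∀ j, ∑ i, x i * M i j = 0 := by
  have hni : ¬ Function.Injective (Matrix.vecMulLinear (R := T) (Matrix.of M)) := fun hinj => by
    have := LinearMap.finrank_le_finrank_of_injective hinj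
    simp at this
    omega
  rw [injective_iff_map_eq_zero] at hni
  push Not at hni
  obtain ⟨x, hx, hx0⟩ := hni
  refine ⟨x, hx0, fun j => ?_⟩
  exact congrFun hx j

/-! ## Multiplicities of an object with local endomorphism ring -/

section Copies

variable {𝓕 : Type*} [Category 𝓕] [Preadditive 𝓕]

/-- The residue ring of the endomorphism ring. -/
abbrev Res (A : 𝓕) := End A ⧸ Ring.jacobson (End A)

/-- The class of an endomorphism in the residue ring. -/
abbrev res (A : 𝓕) : End A →+* Res A := Ideal.Quotient.mk (Ring.jacobson (End A))

/-- The order is reversed because multiplication in `End` is opposite to `≫`. -/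
theorem res_comp {A : 𝓕} (f g : A ⟶ A) : res A (f ≫ g) = res A g * res A f :=
  map_mul (res A) (End.of g) (End.of f)

theorem res_eq_zero_iff {A : 𝓕} (hA : UnitOrNil (End A)) {f : End A} :
    res A f = 0 ↔ ¬ IsUnit f := by
  rw [Ideal.Quotient.eq_zero_iff_mem, hA.mem_jacobson]

theorem res_isUnit_or_eq_zero {A : 𝓕} (hA : UnitOrNil (End A)) (t : Res A) :
    IsUnit t ∨ t = 0 := by
  obtain ⟨f, rfl⟩ := Ideal.Quotient.mk_surjective t
  by_cases h : IsUnit f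
  · exact Or.inl (h.map (res A))
  · exact Or.inr ((res_eq_zero_iff hA).2 h)

theorem res_nontrivial {A : 𝓕} (hA : UnitOrNil (End A)) : Nontrivial (Res A) :=
  ⟨1, 0, fun h => (res_eq_zero_iff hA).1 ((map_one (res A)).trans h) isUnit_one⟩

/-- Up to a part without direct summand `A`, the object `F` is a direct sum of copies of `A`
indexed by `M`. -/
def HasCopies (A F : 𝓕) (M : Type) [Fintype M] [DecidableEq M] : Prop :=
  ∃ (x : M → (A ⟶ F)) (y : M → (F ⟶ A)),
    (∀ m m', res A (x m ≫ y m') = if m = m' then 1 else 0) ∧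
    ∀ (a : A ⟶ F) (b : F ⟶ A), res A (a ≫ b) = ∑ m, res A (x m ≫ b) * res A (a ≫ y m)

/-- Modulo the radical, `x` and `y` are dual bases for the pairing `(a, b) ↦ res (a ≫ b)`. Expanding
one system in terms of the other gives two matrices with product `1`. -/
theorem HasCopies.card_le {A F : 𝓕} (hA : UnitOrNil (End A)) {M M' : Type} [Fintype M]
    [DecidableEq M] [Fintype M'] [DecidableEq M'] (h : HasCopies A F M)
    (h' : HasCopies A F M') : Fintype.card M ≤ Fintype.card M' := by
  obtain ⟨x, y, hxy, -⟩ := h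
  obtain ⟨x', y', -, h'⟩ := h'
  have := res_nontrivial hA
  let _ : DivisionRing (Res A) := DivisionRing.ofIsUnitOrEqZero (res_isUnit_or_eq_zero hA)
  refine card_le_of_matrix (fun m m' => res A (x' m' ≫ y m)) (fun m' m => res A (x m ≫ y' m'))
    fun i k => ?_
  rw [← h', hxy]
  simp only [eq_comm]

/-- Inserting `∑ p j ≫ i j = 1` between `a` and `b` splits the pairing into those of the summands.
-/
theorem HasCopies.sum {A S : 𝓕} {J : Type} [Fintype J] [DecidableEq J] {F : J → 𝓕}
    (i : ∀ j, F j ⟶ S) (p : ∀ j, S ⟶ F j) (hip : ∀ j, i j ≫ p j = 𝟙 _)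
    (hne : ∀ j k, j ≠ k → i j ≫ p k = 0) (hsum : ∑ j, p j ≫ i j = 𝟙 S)
    {M : J → Type} [∀ j, Fintype (M j)] [∀ j, DecidableEq (M j)]
    (h : ∀ j, HasCopies A (F j) (M j)) : HasCopies A S (Σ j, M j) := by
  choose x y hxy h using h
  refine ⟨fun m => x m.1 m.2 ≫ i m.1, fun m => p m.1 ≫ y m.1 m.2, ?_, fun a b => ?_⟩
  · rintro ⟨j, m⟩ ⟨k, m'⟩
    by_cases hjk : j = k
    · subst hjk
      have : (x j m ≫ i j) ≫ p j ≫ y j m' = x j m ≫ y j m' := by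
        rw [Category.assoc, ← Category.assoc (i j), hip, Category.id_comp]
      dsimp only
      rw [this, hxy]
      simp
    · have : (x j m ≫ i j) ≫ p k ≫ y k m' = 0 := by
        rw [Category.assoc, ← Category.assoc (i j), hne j k hjk]
        simp
      dsimp only
      rw [this, if_neg (fun h => hjk (congrArg Sigma.fst h))]
      exact map_zero _
  · have h1 : a ≫ b = ∑ j, (a ≫ p j) ≫ (i j ≫ b) := by
      conv_lhs => rw [← Category.id_comp b, ← hsum, Preadditive.sum_comp, Preadditive.comp_sum]
      simp
    rw [Fintype.sum_sigma, h1]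
    refine (map_sum (res A) _ _).trans (Finset.sum_congr rfl fun j _ => ?_)
    rw [h j]
    simp

theorem HasCopies.of_iso {A F : 𝓕} (e : A ≅ F) : HasCopies A F Unit := by
  refine ⟨fun _ => e.hom, fun _ => e.inv, fun _ _ => ?_, fun a b => ?_⟩
  · rw [e.hom_inv_id]; simpa using map_one (res A)
  · rw [Fintype.sum_unique, ← res_comp]
    simp

theorem HasCopies.empty {A F : 𝓕} (h : ∀ (a : A ⟶ F) (b : F ⟶ A), res A (a ≫ b) = 0) :
    HasCopies A F Empty :=
  ⟨fun m => m.elim, fun m => m.elim, fun m => m.elim, fun a b => by simp [h]⟩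

/-! ### Copies of `A` in a direct sum `A ⊕ A'` -/

section Biprod

/-- `X` is the direct sum of `A` and `A'`. -/
structure IsBiprod {A A' X : 𝓕} (e₀ : A ⟶ X) (p₀ : X ⟶ A) (e₁ : A' ⟶ X) (p₁ : X ⟶ A') :
    Prop where
  inl_fst : e₀ ≫ p₀ = 𝟙 A
  inr_snd : e₁ ≫ p₁ = 𝟙 A'
  inl_snd : e₀ ≫ p₁ = 0
  inr_fst : e₁ ≫ p₀ = 0
  sum : p₀ ≫ e₀ + p₁ ≫ e₁ = 𝟙 X

variable {A A' X : 𝓕} {e₀ : A ⟶ X} {p₀ : X ⟶ A} {e₁ : A' ⟶ X} {p₁ : X ⟶ A'}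

theorem IsBiprod.comp_eq (hX : IsBiprod e₀ p₀ e₁ p₁) {R R' : 𝓕} (a : R ⟶ X) (b : X ⟶ R') :
    a ≫ b = (a ≫ p₀) ≫ e₀ ≫ b + (a ≫ p₁) ≫ e₁ ≫ b := by
  conv_lhs => rw [← Category.id_comp b, ← hX.sum]
  simp [Preadditive.add_comp, Preadditive.comp_add]

theorem HasCopies.biprod_unit (hX : IsBiprod e₀ p₀ e₁ p₁)
    (h : ∀ (a : A ⟶ A') (b : A' ⟶ A), res A (a ≫ b) = 0) :
    HasCopies A X Unit := by
  refine ⟨fun _ => e₀, fun _ => p₀, fun _ _ => ?_, fun a b => ?_⟩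
  · rw [hX.inl_fst]; simpa using map_one (res A)
  · rw [hX.comp_eq a b]
    refine (map_add (res A) _ _).trans ?_
    rw [h, add_zero, Fintype.sum_unique, ← res_comp]

theorem HasCopies.biprod_bool (hX : IsBiprod e₀ p₀ e₁ p₁) (g : A ≅ A') : HasCopies A X Bool := by
  refine ⟨fun m => cond m e₀ (g.hom ≫ e₁), fun m => cond m p₀ (p₁ ≫ g.inv), ?_, fun a b => ?_⟩
  · rintro (_ | _) (_ | _)
    · have : (g.hom ≫ e₁) ≫ p₁ ≫ g.inv = 𝟙 A := by
        rw [Category.assoc, ← Category.assoc e₁, hX.inr_snd]; simp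
      simp only [cond_false, this]
      simpa using map_one (res A)
    · have : (g.hom ≫ e₁) ≫ p₀ = 0 := by rw [Category.assoc, hX.inr_fst]; simp
      simp only [cond_false, cond_true, this]
      simp
    · have : e₀ ≫ p₁ ≫ g.inv = 0 := by rw [← Category.assoc, hX.inl_snd]; simp
      simp only [cond_false, cond_true, this]
      simp
    · simp only [cond_true, hX.inl_fst]
      simpa using map_one (res A)
  · rw [hX.comp_eq a b]
    refine (map_add (res A) _ _).trans ?_
    rw [Fintype.sum_bool]
    simp only [cond_true, cond_false, ← res_comp]
    simp

end Biprod

/-- Objects with local endomorphism rings are isomorphic as soon as an automorphism of one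
factors through the other. -/
theorem nonempty_iso_of_isUnit_comp {A B : 𝓕} (hB : UnitOrNil (End B)) (a : A ⟶ B) (b : B ⟶ A)
    (h : IsUnit (End.of (a ≫ b))) (hA : Nontrivial (End A)) : Nonempty (A ≅ B) := by
  obtain ⟨u, hu⟩ := h
  let c : A ⟶ A := (↑u⁻¹ : End A)
  have hc1 : (a ≫ b) ≫ c = 𝟙 A := by
    have := u.inv_mul
    rw [hu] at this
    exact this
  have hc2 : c ≫ a ≫ b = 𝟙 A := by
    have := u.mul_inv
    rw [hu] at this
    exact this
  -- The idempotent of `B` cut out by `A`. It is `1` if it is a unit and `0` if it is nilpotent, and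
  -- `0` would make the automorphism `a ≫ b` vanish.
  let e : End B := b ≫ c ≫ a
  have he : e * e = e := by
    change (b ≫ c ≫ a) ≫ (b ≫ c ≫ a) = b ≫ c ≫ a
    simp only [Category.assoc]
    have h3 : c ≫ a ≫ b ≫ c ≫ a = c ≫ a := by
      have : c ≫ (a ≫ b) ≫ c ≫ a = (c ≫ a ≫ b) ≫ c ≫ a := by simp
      rw [hc2, Category.id_comp] at this
      simpa using this
    rw [h3]
  have he1 : e = 1 := by
    rcases hB.unit_or_nil e with hu' | ⟨n, hn⟩
    · exact hu'.mul_left_cancel (by rw [he, mul_one])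
    · exfalso
      have h0 : e = 0 := by
        rw [← IsIdempotentElem.pow_succ_eq n he, pow_succ, hn, zero_mul]
      have h4 : a ≫ e ≫ b = a ≫ b := by
        change a ≫ (b ≫ c ≫ a) ≫ b = a ≫ b
        have : a ≫ (b ≫ c ≫ a) ≫ b = ((a ≫ b) ≫ c) ≫ a ≫ b := by simp
        rw [this, hc1, Category.id_comp]
      have h5 : a ≫ b = 0 := by
        rw [← h4]
        rw [h0]
        change a ≫ (0 : B ⟶ B) ≫ b = 0
        simp
      rw [h5] at hc1
      have h6 : (1 : End A) = 0 := by
        change 𝟙 A = 0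
        rw [← hc1]; simp
      exact one_ne_zero h6
  exact ⟨⟨a, b ≫ c, by rw [← Category.assoc, hc1], by rw [Category.assoc]; exact he1⟩⟩

/-- `(ab)^(n+1) = a (ba)^n b`. -/
theorem isNilpotent_comp_swap {A B : 𝓕} (a : A ⟶ B) (b : B ⟶ A)
    (h : IsNilpotent (End.of (b ≫ a))) : IsNilpotent (End.of (a ≫ b)) := by
  obtain ⟨n, hn⟩ := h
  refine ⟨n + 1, ?_⟩
  have : ∀ n : ℕ, ((End.of (a ≫ b)) ^ (n + 1) : End A) =
      a ≫ ((End.of (b ≫ a)) ^ n : End B) ≫ b := by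
    intro n
    induction n with
    | zero =>
      rw [zero_add, pow_one, pow_zero]
      exact (congrArg (a ≫ ·) (Category.id_comp b)).symm
    | succ n ih =>
      rw [pow_succ', ih, pow_succ]
      change (a ≫ ((End.of (b ≫ a)) ^ n : End B) ≫ b) ≫ (a ≫ b) =
        a ≫ ((b ≫ a) ≫ ((End.of (b ≫ a)) ^ n : End B)) ≫ b
      have hc : ((End.of (b ≫ a)) ^ n : End B) ≫ (b ≫ a) =
          (b ≫ a) ≫ ((End.of (b ≫ a)) ^ n : End B) := (pow_mul_comm' (End.of (b ≫ a)) n).symm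
      rw [← hc]
      simp
  rw [this, hn]
  change a ≫ (0 : B ⟶ B) ≫ b = 0
  simp

end Copies

/-! ## Preadditive dagger categories -/

/-- A preadditive category with an additive involution on morphisms that is the identity on
objects. -/
class DagCat (H : Type*) [Category H] [Preadditive H] where
  /-- the adjoint morphism -/
  dag : ∀ {X Y : H}, (X ⟶ Y) → (Y ⟶ X)
  dag_dag : ∀ {X Y : H} (f : X ⟶ Y), dag (dag f) = f
  dag_comp : ∀ {X Y Z : H} (f : X ⟶ Y) (g : Y ⟶ Z), dag (f ≫ g) = dag g ≫ dag f
  dag_add : ∀ {X Y : H} (f g : X ⟶ Y), dag (f + g) = dag f + dag g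

section Dagger

open DagCat

local postfix:max "†" => DagCat.dag

variable {H : Type*} [Category H] [Preadditive H] [DagCat H]

/-- The involution of the endomorphism ring of an object of a dagger category. -/
instance dagStarRing (X : H) : StarRing (End X) where
  star f := dag f
  star_involutive f := dag_dag f
  star_mul f g := dag_comp g f
  star_add f g := dag_add f g

theorem dag_id (X : H) : (𝟙 X)† = 𝟙 X := star_one (End X)

theorem dag_zero (X Y : H) : (0 : X ⟶ Y)† = 0 := by
  have h := dag_add (0 : X ⟶ Y) 0
  simpa using h

theorem dag_sum {X Y : H} {ι : Type*} (s : Finset ι) (f : ι → (X ⟶ Y)) :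
    (∑ i ∈ s, f i)† = ∑ i ∈ s, (f i)† :=
  map_sum (AddMonoidHom.mk' (dag : (X ⟶ Y) → (Y ⟶ X)) dag_add) f s

/-- A morphism `w` with `w† w = 1`. -/
def IsIsometry {X S : H} (w : X ⟶ S) : Prop := w ≫ w† = 𝟙 X

theorem IsIsometry.comp {X Y Z : H} {f : X ⟶ Y} {g : Y ⟶ Z} (hf : IsIsometry f)
    (hg : IsIsometry g) : IsIsometry (f ≫ g) := by
  unfold IsIsometry at *
  rw [dag_comp, Category.assoc, ← Category.assoc g, hg, Category.id_comp, hf]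

/-- A morphism whose Gram endomorphism differs from `1` by a nilpotent one can be corrected to an
isometry. -/
theorem exists_isometry_of_isNilpotent {X S : H} (h2 : IsUnit (2 : End X)) (w : X ⟶ S)
    (hn : IsNilpotent (End.of (w ≫ w† - 𝟙 X))) : ∃ z : X ⟶ S, IsIsometry z := by
  have hs : star (End.of (w ≫ w† - 𝟙 X)) = (End.of (w ≫ w† - 𝟙 X)) := by
    refine (star_sub (End.of (w ≫ w†)) (1 : End X)).trans ?_
    rw [star_one]
    refine congrArg (fun t : End X => t - 1) ?_
    change (w ≫ w†)† = w ≫ w†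
    rw [dag_comp, dag_dag]
  obtain ⟨g, -, hg⟩ := exists_conj_one_add h2 hs hn
  refine ⟨(show X ⟶ X from g) ≫ w, ?_⟩
  have h1 : (1 : End X) + (End.of (w ≫ w† - 𝟙 X)) = (End.of (w ≫ w†)) :=
    add_sub_cancel (1 : End X) (End.of (w ≫ w†))
  rw [h1] at hg
  change ((show X ⟶ X from g) ≫ w) ≫ ((show X ⟶ X from g) ≫ w)† = 𝟙 X
  rw [dag_comp, Category.assoc]
  refine Eq.trans ?_ hg
  change _ = (show X ⟶ X from g) ≫ (w ≫ w†) ≫ (show X ⟶ X from g)†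
  simp

/-- If the hyperbolic object `X` is the sum of the images of the idempotents `ε` and `ε†`, and the
image of `ε` is a direct summand of `S` on which the form is degenerate enough, then `X` embeds
isometrically into `S`. -/
theorem exists_isometry_of_hyperbolic {X S : H} (h2 : IsUnit (2 : End X)) (ε : X ⟶ X)
    (hε : ε ≫ ε = ε) (hεd : ε + ε† = 𝟙 X) (a : X ⟶ S) (b : S ⟶ X) (hab : a ≫ b = ε)
    (ha : ε ≫ a = a) (hb : b ≫ ε = b)
    (hn : IsNilpotent (End.of ((b ≫ a)† ≫ b ≫ a))) : ∃ z : X ⟶ S, IsIsometry z := by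
  have hd : ε† = 𝟙 X - ε := by rw [← hεd]; abel
  have h01 : ε ≫ ε† = 0 := by rw [hd, Preadditive.comp_sub, hε, Category.comp_id, sub_self]
  have h10 : ε† ≫ ε = 0 := by rw [hd, Preadditive.sub_comp, hε, Category.id_comp, sub_self]
  have haa : a† ≫ a = 0 := by
    have : a† ≫ a = a† ≫ (ε† ≫ ε) ≫ a := by
      conv_lhs => rw [← ha, dag_comp]
      simp
    rw [this, h10]; simp
  have hbb : b ≫ b† = 0 := by
    have : b ≫ b† = b ≫ (ε ≫ ε†) ≫ b† := by
      conv_lhs => rw [← hb, dag_comp]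
      simp
    rw [this, h01]; simp
  -- Let `a` act on the image of `ε` and `b†` on that of `ε†`. The cross terms `ab + (ab)†` give `ε
  -- + ε† = 1`, so the Gram endomorphism has error `a a† + b† b`, which must be shown nilpotent.
  refine exists_isometry_of_isNilpotent h2 (a + b†) ?_
  have hgram : (a + b†) ≫ (a + b†)† - 𝟙 X = a ≫ a† + b† ≫ b := by
    rw [dag_add, dag_dag, Preadditive.add_comp, Preadditive.comp_add, Preadditive.comp_add, hab,
      ← dag_comp, hab, ← hεd]
    abel
  rw [hgram]
  set μ : End X := a ≫ (b ≫ a)† ≫ b with hμ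
  -- Since `a† a = 0` and `b b† = 0`, only mixed terms survive in the square. They are `μ` and its
  -- adjoint, which annihilate each other; `μ` is nilpotent as a cyclic shift of the endomorphism in
  -- `hn`.
  have hsq : (End.of (a ≫ a† + b† ≫ b)) ^ 2 = μ + star μ := by
    rw [pow_two]
    change (a ≫ a† + b† ≫ b) ≫ (a ≫ a† + b† ≫ b) =
      a ≫ (b ≫ a)† ≫ b + (a ≫ (b ≫ a)† ≫ b)†
    have e1 : (a ≫ a†) ≫ a ≫ a† = 0 := by
      rw [Category.assoc, ← Category.assoc (a†), haa]; simp
    have e2 : (b† ≫ b) ≫ b† ≫ b = 0 := by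
      rw [Category.assoc, ← Category.assoc b, hbb]; simp
    rw [Preadditive.add_comp, Preadditive.comp_add, Preadditive.comp_add, e1, e2]
    simp [dag_comp, dag_dag]
  have hμn : IsNilpotent μ := by
    have := isNilpotent_comp_swap a ((b ≫ a)† ≫ b) (by simpa using hn)
    simpa [hμ] using this
  have hstar : star μ = (b† ≫ (b ≫ a) ≫ a† : X ⟶ X) := by
    change (a ≫ (b ≫ a)† ≫ b)† = _
    rw [dag_comp, dag_comp, dag_dag, Category.assoc]
  have m1 : μ * star μ = 0 := by
    rw [hstar]
    change (b† ≫ (b ≫ a) ≫ a†) ≫ a ≫ (b ≫ a)† ≫ b = 0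
    have : (b† ≫ (b ≫ a) ≫ a†) ≫ a ≫ (b ≫ a)† ≫ b =
        b† ≫ (b ≫ a) ≫ (a† ≫ a) ≫ (b ≫ a)† ≫ b := by simp
    rw [this, haa]; simp
  have m2 : star μ * μ = 0 := by
    rw [hstar]
    change (a ≫ (b ≫ a)† ≫ b) ≫ b† ≫ (b ≫ a) ≫ a† = 0
    have : (a ≫ (b ≫ a)† ≫ b) ≫ b† ≫ (b ≫ a) ≫ a† =
        a ≫ (b ≫ a)† ≫ (b ≫ b†) ≫ (b ≫ a) ≫ a† := by simp
    rw [this, hbb]; simp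
  have hcomm : Commute μ (star μ) := by
    change μ * star μ = star μ * μ
    rw [m1, m2]
  have hsn : IsNilpotent (star μ) := by
    obtain ⟨n, hn⟩ := hμn
    exact ⟨n, by rw [← star_pow, hn, star_zero]⟩
  have := hcomm.isNilpotent_add hμn hsn
  rw [← hsq] at this
  exact (IsNilpotent.pow_iff_pos two_ne_zero).1 this

/-- A hyperbolic object with selfadjoint half `B` contains `B`. -/
theorem exists_isometry_of_half {B X : H} (h : End B) (hh : h + h = 1) (hhs : star h = h)
    (ε : X ⟶ X) (hε : ε ≫ ε = ε)
    (hεd : ε + ε† = 𝟙 X) (x : B ⟶ X) (y : X ⟶ B) (hxy : x ≫ y = 𝟙 B) (hx : x ≫ ε = x)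
    (hy : ε ≫ y = y) : ∃ w : B ⟶ X, IsIsometry w := by
  have hd : ε† = 𝟙 X - ε := by rw [← hεd]; abel
  have h01 : ε ≫ ε† = 0 := by rw [hd, Preadditive.comp_sub, hε, Category.comp_id, sub_self]
  have h10 : ε† ≫ ε = 0 := by rw [hd, Preadditive.sub_comp, hε, Category.id_comp, sub_self]
  have hxx : x ≫ x† = 0 := by
    have : x ≫ x† = x ≫ (ε ≫ ε†) ≫ x† := by
      conv_lhs => rw [← hx, dag_comp]
      simp
    rw [this, h01]; simp
  have hyy : y† ≫ y = 0 := by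
    have : y† ≫ y = y† ≫ (ε† ≫ ε) ≫ y := by
      conv_lhs => rw [← hy, dag_comp]
      simp
    rw [this, h10]; simp
  let h' : B ⟶ B := h
  have hs : h'† = h' := hhs
  -- In a hyperbolic plane with isotropic dual vectors `e`, `f`, the vector `e + f/2` has norm `1`.
  -- Here `x` and `y†` play the roles of `e` and `f`, and `h` that of `1/2`.
  refine ⟨x + h' ≫ y†, ?_⟩
  unfold IsIsometry
  rw [dag_add, dag_comp, dag_dag, hs, Preadditive.add_comp, Preadditive.comp_add,
    Preadditive.comp_add, hxx]
  have e1 : x ≫ y ≫ h' = h' := by rw [← Category.assoc, hxy, Category.id_comp]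
  have e2 : (h' ≫ y†) ≫ x† = h' := by
    rw [Category.assoc, ← dag_comp, hxy, dag_id, Category.comp_id]
  have e3 : (h' ≫ y†) ≫ y ≫ h' = 0 := by
    rw [Category.assoc, ← Category.assoc (y†), hyy]; simp
  rw [e1, e2, e3, zero_add, add_zero]
  exact hh

/-- Two forms on `B` that agree modulo the radical are equivalent. -/
theorem exists_isometry_of_sub_mem {B Z S : H} (h2 : IsUnit (2 : End Z))
    (hB : ∀ r ∈ Ring.jacobson (End B), IsNilpotent r) (τ : B ≅ Z) (w : B ⟶ S)
    (h : (End.of (w ≫ w† - τ.hom ≫ τ.hom†)) ∈ Ring.jacobson (End B)) :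
    ∃ z : Z ⟶ S, IsIsometry z := by
  refine exists_isometry_of_isNilpotent h2 (τ.inv ≫ w) ?_
  have e : (τ.inv ≫ w) ≫ (τ.inv ≫ w)† - 𝟙 Z =
      τ.inv ≫ (w ≫ w† - τ.hom ≫ τ.hom†) ≫ τ.inv† := by
    rw [dag_comp, Preadditive.sub_comp, Preadditive.comp_sub]
    congr 1
    · simp
    · rw [← Category.assoc, ← Category.assoc, τ.inv_hom_id, Category.id_comp, ← dag_comp,
        τ.inv_hom_id, dag_id]
  rw [e]
  -- A cyclic shift moves the error from `End Z` to `End B`, where it is a multiple of an element of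
  -- the radical.
  refine isNilpotent_comp_swap τ.inv ((w ≫ w† - τ.hom ≫ τ.hom†) ≫ τ.inv†) ?_
  rw [Category.assoc]
  exact hB _ (Ideal.mul_mem_left _ (End.of (τ.inv† ≫ τ.inv)) h)

/-- The morphisms `w i` exhibit `S` as the orthogonal sum of the objects `X i`. -/
structure IsOrthSum {ι : Type*} [Fintype ι] (X : ι → H) (S : H) (w : ∀ i, X i ⟶ S) : Prop where
  isometry : ∀ i, w i ≫ (w i)† = 𝟙 (X i)
  orth : ∀ i j, i ≠ j → w i ≫ (w j)† = 0
  sum : ∑ i, (w i)† ≫ w i = 𝟙 S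

/-- The unitary isomorphism is `∑ (w i)† ≫ w' i`: it carries each summand of `S` to the
corresponding one of `S'`. -/
theorem IsOrthSum.exists_iso {ι : Type*} [Fintype ι] {X : ι → H} {S S' : H}
    {w : ∀ i, X i ⟶ S} {w' : ∀ i, X i ⟶ S'} (hw : IsOrthSum X S w) (hw' : IsOrthSum X S' w') :
    ∃ f : S ≅ S', f.hom† = f.inv := by
  classical
  have key : ∀ {S S' : H} {w : ∀ i, X i ⟶ S} {w' : ∀ i, X i ⟶ S'}, IsOrthSum X S w →
      IsOrthSum X S' w' → (∑ i, (w i)† ≫ w' i) ≫ (∑ i, (w' i)† ≫ w i) = 𝟙 S := by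
    intro S S' w w' hw hw'
    rw [Preadditive.sum_comp, ← hw.sum]
    refine Finset.sum_congr rfl fun i _ => ?_
    rw [Preadditive.comp_sum, Finset.sum_eq_single i]
    · rw [Category.assoc, ← Category.assoc (w' i), hw'.isometry, Category.id_comp]
    · intro j _ hj
      rw [Category.assoc, ← Category.assoc (w' i), hw'.orth i j hj.symm]
      simp
    · simp
  refine ⟨⟨∑ i, (w i)† ≫ w' i, ∑ i, (w' i)† ≫ w i, key hw hw', key hw' hw⟩, ?_⟩
  simp only [dag_sum, dag_comp, dag_dag]

theorem IsOrthSum.of_iso {ι : Type*} [Fintype ι] {X : ι → H} {S S' : H}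
    {w : ∀ i, X i ⟶ S} (hw : IsOrthSum X S w) (f : S' ≅ S) (hf : f.hom† = f.inv) :
    IsOrthSum X S' fun i => w i ≫ f.inv := by
  have hf' : f.inv† = f.hom := by rw [← hf, dag_dag]
  refine ⟨fun i => ?_, fun i j hij => ?_, ?_⟩
  · rw [dag_comp, hf', Category.assoc, f.inv_hom_id_assoc, hw.isometry]
  · rw [dag_comp, hf', Category.assoc, f.inv_hom_id_assoc, hw.orth i j hij]
  · have : ∀ i, (w i ≫ f.inv)† ≫ w i ≫ f.inv = f.hom ≫ ((w i)† ≫ w i) ≫ f.inv := fun i => by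
      rw [dag_comp, hf']; simp
    simp only [this]
    rw [← Preadditive.comp_sum, ← Preadditive.sum_comp, hw.sum]
    simp

/-- Splitting off an isometric summand. -/
theorem IsOrthSum.cons {S S' : H} {n : ℕ} {Y : Fin (n + 1) → H} {w : Y 0 ⟶ S}
    (hw : w ≫ w† = 𝟙 (Y 0)) {v : S' ⟶ S} (hv : v ≫ v† = 𝟙 S') (hvw : v† ≫ v + w† ≫ w = 𝟙 S)
    {y : ∀ i : Fin n, Y i.succ ⟶ S'} (hy : IsOrthSum (fun i : Fin n => Y i.succ) S' y) :
    IsOrthSum Y S (Fin.cases (motive := fun i => Y i ⟶ S) w fun i => y i ≫ v) := by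
  -- Placing `w` before and `v†` after the resolution of the identity gives `w v† + w v† = w v†`.
  have h1 : w ≫ v† = 0 := by
    have h := congrArg (fun t => w ≫ t ≫ v†) hvw
    simp only [Preadditive.add_comp, Preadditive.comp_add, Category.id_comp, Category.assoc, hv,
      Category.comp_id] at h
    rw [← Category.assoc w (w†), hw, Category.id_comp] at h
    simpa using h
  have h2 : v ≫ w† = 0 := by
    rw [← dag_dag v, ← dag_comp, h1, dag_zero]
  refine ⟨fun i => ?_, fun i j hij => ?_, ?_⟩
  · refine Fin.cases ?_ (fun i => ?_) i
    · exact hw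
    · change (y i ≫ v) ≫ (y i ≫ v)† = 𝟙 _
      rw [dag_comp, Category.assoc, ← Category.assoc v, hv, Category.id_comp, hy.isometry]
  · revert hij
    refine Fin.cases ?_ (fun i => ?_) i <;> refine Fin.cases ?_ (fun j => ?_) j <;> intro hij
    · exact absurd rfl hij
    · change w ≫ (y j ≫ v)† = 0
      rw [dag_comp, ← Category.assoc, h1, Limits.zero_comp]
    · change (y i ≫ v) ≫ w† = 0
      rw [Category.assoc, h2, Limits.comp_zero]
    · change (y i ≫ v) ≫ (y j ≫ v)† = 0
      rw [dag_comp, Category.assoc, ← Category.assoc v, hv, Category.id_comp,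
        hy.orth i j (fun h => hij (congrArg _ h))]
  · rw [Fin.sum_univ_succ]
    change w† ≫ w + ∑ i, (y i ≫ v)† ≫ (y i ≫ v) = 𝟙 S
    have : ∀ i, (y i ≫ v)† ≫ (y i ≫ v) = v† ≫ ((y i)† ≫ y i) ≫ v := fun i => by
      rw [dag_comp]; simp
    simp only [this]
    rw [← Preadditive.comp_sum, ← Preadditive.sum_comp, hy.sum, Category.id_comp, add_comm, hvw]

/-- Two orthogonal decompositions of `S` give a congruence of the diagonal forms over the residue
ring of `B` that they define. -/
theorem exists_gram {B S : H} {T : Type*} [Ring T] [Star T] (cl : End B →+* T)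
    (hcl : ∀ f : End B, cl (star f) = star (cl f))
    {ι ι' : Type*} [Fintype ι] [Fintype ι'] {X : ι → H} {X' : ι' → H}
    {w : ∀ i, X i ⟶ S} {w' : ∀ j, X' j ⟶ S} (hw : IsOrthSum X S w) (hw' : IsOrthSum X' S w')
    {I J : Type*} [DecidableEq I] [Fintype J] (α : I → ι) (hα : Function.Injective α)
    (τ : ∀ i, B ≅ X (α i)) (β : J → ι') (hβ : Function.Injective β) (τ' : ∀ j, B ≅ X' (β j))
    (hzero : ∀ j, j ∉ Set.range β → ∀ (a : B ⟶ X' j) (b : X' j ⟶ B), cl (a ≫ b) = 0) :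
    ∃ W : I → J → T, ∀ i k, ∑ j, W i j * cl ((τ' j).hom ≫ (τ' j).hom†) * star (W k j) =
      if i = k then cl ((τ i).hom ≫ (τ i).hom†) else 0 := by
  classical
  have hmul : ∀ f g : B ⟶ B, cl (f ≫ g) = cl g * cl f := fun f g => map_mul cl (End.of g) (End.of f)
  -- The matrix coefficients of the change of decomposition, read as endomorphisms of `B`. Their
  -- adjoints are used for `W` so that the order of multiplication in `End B` comes out right.
  let y : I → J → (B ⟶ B) := fun i j => (τ i).hom ≫ w (α i) ≫ (w' (β j))† ≫ (τ' j).inv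
  have hy : ∀ i j, y i j ≫ (τ' j).hom = (τ i).hom ≫ w (α i) ≫ (w' (β j))† := fun i j => by
    simp [y]
  refine ⟨fun i j => cl (y i j)†, fun i k => ?_⟩
  have h1 : (τ k).hom ≫ w (α k) ≫ ((τ i).hom ≫ w (α i))† =
      ∑ j', ((τ k).hom ≫ w (α k) ≫ (w' j')†) ≫ ((τ i).hom ≫ w (α i) ≫ (w' j')†)† := by
    have : ∀ j', ((τ k).hom ≫ w (α k) ≫ (w' j')†) ≫ ((τ i).hom ≫ w (α i) ≫ (w' j')†)† =
        ((τ k).hom ≫ w (α k)) ≫ ((w' j')† ≫ w' j') ≫ ((τ i).hom ≫ w (α i))† := fun j' => by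
      simp [dag_comp, dag_dag]
    simp only [this]
    rw [← Preadditive.comp_sum, ← Preadditive.sum_comp, hw'.sum]
    simp
  have h2 : cl ((τ k).hom ≫ w (α k) ≫ ((τ i).hom ≫ w (α i))†) =
      ∑ j, cl (y i j)† * cl ((τ' j).hom ≫ (τ' j).hom†) * star (cl (y k j)†) := by
    rw [h1]
    refine (map_sum cl _ _).trans ?_
    -- The sum runs over all summands of the second decomposition; those outside the range of `β`
    -- contribute elements killed by `cl`.
    rw [← Finset.sum_subset (Finset.subset_univ (Finset.univ.image β)), Finset.sum_image]
    · refine Finset.sum_congr rfl fun j _ => ?_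
      rw [← hy, ← hy, dag_comp]
      have : star (cl (y k j)†) = cl (y k j) := by
        rw [← hcl]
        exact congrArg cl (dag_dag (y k j))
      rw [this, mul_assoc, ← hmul, ← hmul]
      simp
    · exact fun a _ b _ h => hβ h
    · intro j' _ hj'
      have hj : j' ∉ Set.range β := by
        rintro ⟨j, rfl⟩
        exact hj' (Finset.mem_image_of_mem β (Finset.mem_univ j))
      exact hzero j' hj _ _
  rw [← h2]
  split_ifs with hik
  · subst hik
    rw [dag_comp, ← Category.assoc (w (α i)), hw.isometry, Category.id_comp]
  · rw [dag_comp, ← Category.assoc (w (α k)),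
      hw.orth _ _ (fun h => hik (hα h).symm)]
    simp

end Dagger

/-! ## Indecomposable objects and idempotents -/

section Indec

open Limits

variable {𝓐 : Type*} [Category 𝓐] [Preadditive 𝓐] [HasBinaryBiproducts 𝓐]

/-- Splitting both `e` and `1 - e` gives `X ≅ Y ⊞ Z`, and one of the two parts is zero. -/
theorem Indecomposable.idempotent [IsIdempotentComplete 𝓐] {X : 𝓐} (hX : Indecomposable X)
    (e : End X) (he : e * e = e) : e = 0 ∨ e = 1 := by
  obtain ⟨Y, i, p, hip, hpi⟩ := IsIdempotentComplete.idempotents_split X e he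
  obtain ⟨Z, j, q, hjq, hqj⟩ := IsIdempotentComplete.idempotents_split X
    (𝟙 X - e.asHom) (IsIdempotentElem.one_sub (a := e) he)
  have hsum : p ≫ i + q ≫ j = 𝟙 X := by rw [hpi, hqj]; exact add_sub_cancel e (𝟙 X)
  have h1 : i ≫ q = 0 := by
    have : i ≫ q = i ≫ (p ≫ i) ≫ (q ≫ j) ≫ q := by
      simp only [Category.assoc, hjq, Category.comp_id]
      rw [← Category.assoc i p, hip, Category.id_comp]
    rw [this, hpi, hqj]
    have h0 : e.asHom ≫ (𝟙 X - e.asHom) = 0 := by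
      rw [Preadditive.comp_sub, Category.comp_id]
      exact sub_eq_zero.2 he.symm
    rw [← Category.assoc e.asHom, h0]
    simp
  have h2 : j ≫ p = 0 := by
    have : j ≫ p = j ≫ (q ≫ j) ≫ (p ≫ i) ≫ p := by
      simp only [Category.assoc, hip, Category.comp_id]
      rw [← Category.assoc j q, hjq, Category.id_comp]
    rw [this, hpi, hqj]
    have h0 : (𝟙 X - e.asHom) ≫ e.asHom = 0 := by
      rw [Preadditive.sub_comp, Category.id_comp]
      exact sub_eq_zero.2 he.symm
    rw [← Category.assoc _ e.asHom, h0]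
    simp
  have hiso : X ≅ Y ⊞ Z :=
    ⟨biprod.lift p q, biprod.desc i j, by rw [biprod.lift_desc, hsum], by
      ext <;> simp [hip, hjq, h1, h2]⟩
  rcases hX.2 Y Z hiso with h | h
  · left
    rw [← hpi, h.eq_of_src i 0]
    exact comp_zero
  · right
    have : q ≫ j = 0 := by rw [h.eq_of_src j 0, comp_zero]
    rw [this, add_zero, hpi] at hsum
    exact hsum

theorem indecomposable_of_idempotents {X : 𝓐} (h0 : ¬ IsZero X)
    (h : ∀ e : End X, e * e = e → e = 0 ∨ e = 1) : Indecomposable X := by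
  refine ⟨h0, fun Y Z f => ?_⟩
  let e : End X := (f.hom ≫ biprod.fst) ≫ biprod.inl ≫ f.inv
  have he : e * e = e := by
    change ((f.hom ≫ biprod.fst) ≫ biprod.inl ≫ f.inv) ≫ (f.hom ≫ biprod.fst) ≫ biprod.inl ≫ f.inv
      = (f.hom ≫ biprod.fst) ≫ biprod.inl ≫ f.inv
    simp
  rcases h e he with h | h
  · left
    rw [IsZero.iff_id_eq_zero]
    have : 𝟙 Y = (biprod.inl ≫ f.inv) ≫ e ≫ (f.hom ≫ biprod.fst) := by
      change 𝟙 Y = (biprod.inl ≫ f.inv) ≫ ((f.hom ≫ biprod.fst) ≫ biprod.inl ≫ f.inv) ≫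
        (f.hom ≫ biprod.fst)
      simp
    rw [this, h]
    change (biprod.inl ≫ f.inv) ≫ (0 : X ⟶ X) ≫ (f.hom ≫ biprod.fst) = 0
    simp
  · right
    rw [IsZero.iff_id_eq_zero]
    have h0 : (biprod.inr ≫ f.inv) ≫ e ≫ (f.hom ≫ biprod.snd) = (0 : Z ⟶ Z) := by
      change (biprod.inr ≫ f.inv) ≫ ((f.hom ≫ biprod.fst) ≫ biprod.inl ≫ f.inv) ≫
        (f.hom ≫ biprod.snd) = 0
      simp
    rw [h] at h0
    have h1 : (biprod.inr ≫ f.inv) ≫ 𝟙 X ≫ (f.hom ≫ biprod.snd) = (0 : Z ⟶ Z) := h0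
    simpa using h1

end Indec

section Reps

variable {P : Type p} [Field P] [StarRing P]
variable {K : Type k} [DivisionRing K] [StarRing K]
variable {C : Type u} [Category.{v} C] [Preadditive C] [Linear P C]
variable [Algebra P K]

/-! ## Finite dimension of the spaces of morphisms -/

section Finite

open ModuleCat

/-- The components of a morphism, as linear maps over the base field. -/
def appLinear (F G : C ⥤ ModuleCat.{k} Kᵐᵒᵖ) (a : C) : (F ⟶ G) →ₗ[P] (F.obj a →ₗ[P] G.obj a) where
  toFun f := (f.app a).hom.restrictScalars P
  map_add' _ _ := rfl
  map_smul' _ _ := rfl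

/-- A morphism is determined by its components on the finite support of `A`, each in a Hom space of
finite dimension over `P`. -/
instance finite_hom [Module.Finite P K] (A B : Rep P K C) :
    Module.Finite P (A.functor ⟶ B.functor) := by
  have hK : Module.Finite P Kᵐᵒᵖ := Module.Finite.equiv (opLinearEquiv P : K ≃ₗ[P] Kᵐᵒᵖ)
  have hA : ∀ a, Module.Finite P (A.functor.obj a) := fun a => Module.Finite.trans Kᵐᵒᵖ _
  have hB : ∀ a, Module.Finite P (B.functor.obj a) := fun a => Module.Finite.trans Kᵐᵒᵖ _
  have := A.finite_support.to_subtype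
  let Φ : (A.functor ⟶ B.functor) →ₗ[P]
      (∀ a : {a : C | Nontrivial (A.functor.obj a)}, A.functor.obj a →ₗ[P] B.functor.obj a) :=
    LinearMap.pi fun a => appLinear A.functor B.functor a
  refine Module.Finite.of_injective Φ fun f g h => ?_
  ext a x
  by_cases ha : Nontrivial (A.functor.obj a)
  · exact LinearMap.congr_fun (congrFun h ⟨a, ha⟩) x
  · have := not_nontrivial_iff_subsingleton.1 ha
    rw [Subsingleton.elim x 0, map_zero, map_zero]

instance finite_end [Module.Finite P K] (A : Rep P K C) : Module.Finite P (End A.functor) :=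
  finite_hom A A

end Finite

/-! ## Direct summands of representations -/

/-- The structure maps of a summand are compressions of those of `A`, so additivity and
`P`-linearity are inherited. -/
theorem map_eq_of_retract {A : Rep P K C} {Y : C ⥤ ModuleCat.{k} Kᵐᵒᵖ} (i : Y ⟶ A.functor)
    (p : A.functor ⟶ Y) (h : i ≫ p = 𝟙 Y) {a b : C} (α : a ⟶ b) :
    Y.map α = i.app a ≫ A.functor.map α ≫ p.app b := by
  rw [p.naturality, ← Category.assoc, ← NatTrans.comp_app, h]
  simp

/-- A direct summand of a representation. -/
def Rep.ofRetract (A : Rep P K C) (Y : C ⥤ ModuleCat.{k} Kᵐᵒᵖ) (i : Y ⟶ A.functor)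
    (p : A.functor ⟶ Y) (h : i ≫ p = 𝟙 Y) : Rep P K C where
  functor := Y
  finite a := Module.Finite.of_injective (i.app a).hom (Function.LeftInverse.injective
    (g := (p.app a).hom) fun x => by
      have := ConcreteCategory.congr_hom (NatTrans.congr_app h a) x
      simpa using this)
  finite_support := by
    refine A.finite_support.subset fun a ha => ?_
    have hinj : Function.Injective (i.app a).hom := Function.LeftInverse.injective
      (g := (p.app a).hom) fun x => by
        have := ConcreteCategory.congr_hom (NatTrans.congr_app h a) x
        simpa using this
    have : Nontrivial (Y.obj a) := ha
    exact hinj.nontrivial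
  map_add α β := by
    simp only [map_eq_of_retract i p h, A.map_add, Preadditive.add_comp, Preadditive.comp_add]
  map_smul r α x := by
    rw [map_eq_of_retract i p h, map_eq_of_retract i p h α]
    simp only [ModuleCat.comp_apply]
    exact (congrArg (p.app _).hom (A.map_smul r α _)).trans (LinearMap.map_smul _ _ _)

theorem Rep.exists_split (A : Rep P K C) (e : End A.functor) (he : e * e = e) :
    ∃ (B : Rep P K C) (i : B.functor ⟶ A.functor) (p : A.functor ⟶ B.functor),
      i ≫ p = 𝟙 _ ∧ p ≫ i = e := by
  obtain ⟨Y, i, p, hip, hpi⟩ := IsIdempotentComplete.idempotents_split A.functor e he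
  exact ⟨A.ofRetract Y i p hip, i, p, hip, hpi⟩

theorem isUnit_two (h2 : (2 : P) ≠ 0) (F : C ⥤ ModuleCat.{k} Kᵐᵒᵖ) : IsUnit (2 : End F) := by
  have h := (IsUnit.mk0 (2 : P) h2).map (algebraMap P (End F))
  rwa [map_ofNat] at h

section

variable [Module.Finite P K]

theorem Rep.IsIndec.unitOrNil {A : Rep P K C} (hA : A.IsIndec) : UnitOrNil (End A.functor) where
  nontrivial := by
    refine ⟨1, 0, fun h => hA.1 ?_⟩
    rw [Limits.IsZero.iff_id_eq_zero]
    exact h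
  unit_or_nil := isUnit_or_isNilpotent_of_idempotents (P := P)
    fun e he => Indecomposable.idempotent hA e he

/-- `f ↦ p f i` embeds `End B` into `End A`, and its image consists of elements fixed by composition
with `p i`, so it misses `1`. The dimension of the endomorphism algebra thus serves as the measure
for splitting off summands. -/
theorem finrank_end_lt_of_retract {A B : Rep P K C} (i : B.functor ⟶ A.functor)
    (p : A.functor ⟶ B.functor) (h : i ≫ p = 𝟙 _) (hne : p ≫ i ≠ 𝟙 _) :
    Module.finrank P (End B.functor) < Module.finrank P (End A.functor) := by
  let Φ : (B.functor ⟶ B.functor) →ₗ[P] (A.functor ⟶ A.functor) :=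
    { toFun := fun f => p ≫ f ≫ i
      map_add' := fun f g => by simp
      map_smul' := fun r f => by simp }
  have hinj : Function.Injective Φ := by
    intro f g hfg
    have h1 : ∀ f : B.functor ⟶ B.functor, i ≫ Φ f ≫ p = f := fun f => by
      change i ≫ (p ≫ f ≫ i) ≫ p = f
      simp only [Category.assoc, h, Category.comp_id]
      rw [← Category.assoc, h, Category.id_comp]
    rw [← h1 f, hfg, h1]
  refine lt_of_le_of_ne (LinearMap.finrank_le_finrank_of_injective hinj) fun heq => ?_
  obtain ⟨f, hf⟩ := (LinearMap.injective_iff_surjective_of_finrank_eq_finrank heq).1 hinj (𝟙 _)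
  refine hne ?_
  have h2 : (p ≫ i) ≫ Φ f = Φ f := by
    change (p ≫ i) ≫ p ≫ f ≫ i = p ≫ f ≫ i
    simp only [Category.assoc]
    rw [← Category.assoc i p, h, Category.id_comp]
  rw [hf, Category.comp_id] at h2
  exact h2

/-- Every nonzero representation has an indecomposable direct summand. -/
theorem Rep.exists_indec_summand (A : Rep P K C) (hA : ¬ Limits.IsZero A.functor) :
    ∃ (B : Rep P K C) (i : B.functor ⟶ A.functor) (p : A.functor ⟶ B.functor),
      B.IsIndec ∧ i ≫ p = 𝟙 _ := by
  induction hn : Module.finrank P (End A.functor) using Nat.strong_induction_on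
    generalizing A with
  | _ n ih =>
    by_cases hI : A.IsIndec
    · exact ⟨A, 𝟙 _, 𝟙 _, hI, by simp⟩
    · have : ∃ e : End A.functor, e * e = e ∧ e ≠ 0 ∧ e ≠ 1 := by
        by_contra hcon
        push Not at hcon
        exact hI (indecomposable_of_idempotents hA fun e he => by
          by_cases h0 : e = 0
          · exact Or.inl h0
          · exact Or.inr (hcon e he h0))
      obtain ⟨e, he, he0, he1⟩ := this
      obtain ⟨A', i, p, hip, hpi⟩ := A.exists_split e he
      have hlt : Module.finrank P (End A'.functor) < n := by
        rw [← hn]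
        exact finrank_end_lt_of_retract (A := A) (B := A') i p hip (fun h => he1 (by
          rw [← hpi]; exact h))
      have hA' : ¬ Limits.IsZero A'.functor := fun h => he0 (by
        rw [← hpi, h.eq_of_src i 0]
        exact Limits.comp_zero)
      obtain ⟨B, j, q, hB, hjq⟩ := ih _ hlt A' hA' rfl
      refine ⟨B, j ≫ i, p ≫ q, hB, ?_⟩
      have : (j ≫ i) ≫ p ≫ q = j ≫ (i ≫ p) ≫ q := by simp
      rw [this, hip, Category.id_comp, hjq]

end

/-! ## Selfadjoint representations as a dagger category -/

variable {J : LinearInvolution P C}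

/-- Morphisms of selfadjoint representations are the morphisms of the representations. -/
instance : Category (SelfAdjRep K J) where
  Hom A B := A.functor ⟶ B.functor
  id A := 𝟙 A.functor
  comp f g := NatTrans.vcomp f g

instance : Preadditive (SelfAdjRep K J) where
  homGroup A B := inferInstanceAs (AddCommGroup (A.functor ⟶ B.functor))
  add_comp A B D f g h := Preadditive.add_comp A.functor B.functor D.functor f g h
  comp_add A B D f g h := Preadditive.comp_add A.functor B.functor D.functor f g h

noncomputable instance : DagCat (SelfAdjRep K J) where
  dag f := SelfAdjRep.adjoint f
  dag_dag f := SelfAdjRep.adjoint_adjoint f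
  dag_comp f g := SelfAdjRep.adjoint_comp f g
  dag_add f g := SelfAdjRep.adjoint_add f g

/-- An isomorphism of the underlying representations. -/
def SelfAdjRep.isoOf {A B : SelfAdjRep K J} (f : A.functor ≅ B.functor) : A ≅ B :=
  ⟨f.hom, f.inv, f.hom_inv_id, f.inv_hom_id⟩

theorem SelfAdjRep.isUnit_two (h2 : (2 : P) ≠ 0) (X : SelfAdjRep K J) : IsUnit (2 : End X) :=
  SelfAdj.isUnit_two (P := P) h2 X.functor

end Reps

section Reps

open DagCat

variable {P : Type p} [Field P] [StarRing P]
variable {K : Type k} [DivisionRing K] [StarRing K]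
variable {C : Type u} [Category.{v} C] [Preadditive C] [Linear P C]
variable [Algebra P K] {J : LinearInvolution P C}

/-! ## Orthogonal sums -/

namespace SelfAdjRep

/-- A morphism of the underlying representations. -/
abbrev ofHom {A B : SelfAdjRep K J} (f : A.functor ⟶ B.functor) : A ⟶ B := f

/-- The inclusion of a summand into an orthogonal sum. -/
noncomputable def incl {ι : Type} [Fintype ι] [DecidableEq ι] (X : ι → SelfAdjRep K J) (i : ι) :
    X i ⟶ orthSum X :=
  ({ app := fun a => ModuleCat.ofHom
      (LinearMap.single Kᵐᵒᵖ (fun j => (X j).functor.obj a) i)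
     naturality := fun a b α => by
      refine ModuleCat.hom_ext (LinearMap.ext fun x => funext fun j => ?_)
      change Pi.single (M := fun j => (X j).functor.obj b) i ((X i).functor.map α x) j =
        (X j).functor.map α (Pi.single (M := fun j => (X j).functor.obj a) i x j)
      by_cases h : j = i
      · subst h; simp
      · simp [Pi.single_eq_of_ne h] } : (X i).functor ⟶ (Rep.sum fun i => (X i).toRep).functor)

/-- The projection of an orthogonal sum onto a summand. -/
noncomputable def proj {ι : Type} [Fintype ι] (X : ι → SelfAdjRep K J) (i : ι) :
    orthSum X ⟶ X i :=
  ({ app := fun a => ModuleCat.ofHom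
      (LinearMap.proj (R := Kᵐᵒᵖ) (φ := fun j => (X j).functor.obj a) i)
     naturality := fun _ _ _ => rfl } :
    (Rep.sum fun i => (X i).toRep).functor ⟶ (X i).functor)

theorem dag_incl {ι : Type} [Fintype ι] [DecidableEq ι] (X : ι → SelfAdjRep K J) (i : ι) :
    dag (incl X i) = proj X i :=
  hom_ext fun a x y => (pair_adjoint _ x y).trans (sumPair_single X a x i y)

theorem isOrthSum_incl {ι : Type} [Fintype ι] [DecidableEq ι] (X : ι → SelfAdjRep K J) :
    IsOrthSum X (orthSum X) (incl X) := by
  refine ⟨fun i => ?_, fun i j hij => ?_, ?_⟩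
  · rw [dag_incl]
    refine NatTrans.ext (funext fun a => ModuleCat.hom_ext (LinearMap.ext fun x => ?_))
    exact Pi.single_eq_same (M := fun j => (X j).functor.obj a) i x
  · rw [dag_incl]
    refine NatTrans.ext (funext fun a => ModuleCat.hom_ext (LinearMap.ext fun x => ?_))
    exact Pi.single_eq_of_ne (M := fun j => (X j).functor.obj a) hij.symm x
  · simp only [dag_incl]
    refine NatTrans.ext (funext fun a => ModuleCat.hom_ext (LinearMap.ext fun x => ?_))
    -- Evaluation at an object is additive, hence commutes with the finite sum of morphisms.
    let Φ : (orthSum X ⟶ orthSum X) →+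
        ((orthSum X).functor.obj a →ₗ[Kᵐᵒᵖ] (orthSum X).functor.obj a) :=
      { toFun := fun f => (NatTrans.app f a).hom
        map_zero' := rfl
        map_add' := fun _ _ => rfl }
    change Φ (∑ i, proj X i ≫ incl X i) x = x
    rw [map_sum, LinearMap.sum_apply]
    exact LinearMap.sum_single_apply (fun j => (X j).functor.obj a) x

theorem congruent_iff {A B : SelfAdjRep K J} :
    A.Congruent B ↔ ∃ f : A ≅ B, dag f.hom = f.inv :=
  ⟨fun ⟨f, hf⟩ => ⟨isoOf f, hf⟩, fun ⟨f, hf⟩ => ⟨⟨f.hom, f.inv, f.hom_inv_id, f.inv_hom_id⟩, hf⟩⟩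

/-- Translates the statement about congruence into the dagger category, where both halves of the
proof take place. -/
theorem congruent_orthSum_iff {ι : Type} [Fintype ι] (X : ι → SelfAdjRep K J)
    (S : SelfAdjRep K J) :
    S.Congruent (orthSum X) ↔ ∃ w : ∀ i, X i ⟶ S, IsOrthSum X S w := by
  classical
  rw [congruent_iff]
  constructor
  · rintro ⟨f, hf⟩
    exact ⟨_, (isOrthSum_incl X).of_iso f hf⟩
  · rintro ⟨w, hw⟩
    exact hw.exists_iso (isOrthSum_incl X)

/-! ## Restriction of the form -/

/-- The form of `S` restricts to a nondegenerate form on `A`. -/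
theorem exists_restrict (S : SelfAdjRep K J) (A : Rep P K C) (i : A.functor ⟶ S.functor)
    (p : S.functor ⟶ A.functor)
    (h : ∀ a, Function.Injective ((i ≫ adjoint (A := S) (B := S) (p ≫ i) ≫ p).app a)) :
    ∃ (A' : SelfAdjRep K J) (g : A.functor ≅ A'.functor),
      IsIsometry (ofHom (A := A') (B := S) (g.inv ≫ i)) := by
  let θ : ∀ a, A.functor.obj a →ₗ[Kᵐᵒᵖ] SemiDual K (A.functor.obj (J.obj a)) := fun a =>
    dualMap (i.app (J.obj a)).hom ∘ₗ S.pair a ∘ₗ (i.app a).hom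
  have hθ : ∀ a x y, θ a x y = S.pair a (i.app a x) (i.app (J.obj a) y) := fun _ _ _ => rfl
  have hinj : ∀ a, Function.Injective (θ a) := by
    intro a
    rw [injective_iff_map_eq_zero]
    intro x hx
    -- If `i x` is orthogonal to the image of `i`, then the adjoint of `p ≫ i` kills it, and so `x`
    -- lies in the kernel of the Gram endomorphism.
    have h1 : (adjoint (A := S) (B := S) (p ≫ i)).app a (i.app a x) = 0 := by
      refine (S.pair_bijective a).1 (LinearMap.ext fun z => ?_)
      rw [pair_adjoint, map_zero]
      exact LinearMap.congr_fun hx (p.app (J.obj a) z)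
    refine (injective_iff_map_eq_zero _).1 (h a) x ?_
    change p.app a ((adjoint (A := S) (B := S) (p ≫ i)).app a (i.app a x)) = 0
    rw [h1]
    exact map_zero (p.app a).hom
  -- Injectivity at `u` and at `u*` gives `dim A_u ≤ dim A_{u*} ≤ dim A_{u**} = dim A_u`, so the
  -- injections into dual spaces are bijections.
  have hle : ∀ a, Module.finrank Kᵐᵒᵖ (A.functor.obj a) ≤
      Module.finrank Kᵐᵒᵖ (A.functor.obj (J.obj a)) := fun a =>
    (LinearMap.finrank_le_finrank_of_injective (hinj a)).trans finrank_semiDual_le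
  have heq : ∀ a, Module.finrank Kᵐᵒᵖ (A.functor.obj a) =
      Module.finrank Kᵐᵒᵖ (SemiDual K (A.functor.obj (J.obj a))) := fun a => by
    refine le_antisymm (LinearMap.finrank_le_finrank_of_injective (hinj a))
      (finrank_semiDual_le.trans ((hle (J.obj a)).trans (le_of_eq ?_)))
    rw [J.obj_obj]
  refine ⟨ofPairing A θ
    (fun a => ⟨hinj a, (LinearMap.injective_iff_surjective_of_finrank_eq_finrank (heq a)).1
      (hinj a)⟩) (fun {a b} α x y => ?_) (fun a x y => ?_), Iso.refl _, ?_⟩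
  · rw [hθ, hθ]
    have h1 : i.app b (A.functor.map α x) = S.functor.map α (i.app a x) :=
      ConcreteCategory.congr_hom (i.naturality α) x
    have h2 : i.app (J.obj a) (A.functor.map (J.map α) y) =
        S.functor.map (J.map α) (i.app (J.obj b) y) :=
      ConcreteCategory.congr_hom (i.naturality (J.map α)) y
    rw [h1, h2, S.pair_map]
  · rw [hθ, hθ, S.pair_symm]
    have h1 : i.app (J.obj (J.obj a)) (A.functor.map (J.toSS a) x) =
        S.functor.map (J.toSS a) (i.app a x) :=
      ConcreteCategory.congr_hom (i.naturality (J.toSS a)) x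
    rw [h1]
  · refine hom_ext fun a x y => ?_
    exact pair_adjoint _ _ _

/-- The orthogonal complement of an isometric subobject. -/
theorem exists_complement {X S : SelfAdjRep K J} {w : X ⟶ S} (hw : IsIsometry w) :
    ∃ (S' : SelfAdjRep K J) (v : S' ⟶ S), v ≫ dag v = 𝟙 S' ∧ dag v ≫ v + dag w ≫ w = 𝟙 S := by
  let e : S ⟶ S := 𝟙 S - dag w ≫ w
  have hww : (dag w ≫ w) ≫ dag w ≫ w = dag w ≫ w := by
    rw [Category.assoc, ← Category.assoc w, show w ≫ dag w = 𝟙 X from hw, Category.id_comp]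
  have he : e ≫ e = e := by
    change (𝟙 S - dag w ≫ w) ≫ (𝟙 S - dag w ≫ w) = 𝟙 S - dag w ≫ w
    simp only [Preadditive.sub_comp, Preadditive.comp_sub, hww, Category.id_comp, Category.comp_id]
    abel
  have hed : dag e = e := by
    have h1 : dag (e + dag w ≫ w) = e + dag w ≫ w := by
      rw [show e + dag w ≫ w = 𝟙 S from sub_add_cancel _ _, dag_id]
    rw [dag_add, dag_comp, dag_dag] at h1
    exact add_right_cancel h1
  obtain ⟨B, i, p, hip, hpi⟩ := S.toRep.exists_split e he
  -- The idempotent `e = p ≫ i` is selfadjoint, so the Gram endomorphism of its image is the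
  -- identity and the form restricts to it.
  have hν : i ≫ adjoint (A := S) (B := S) (p ≫ i) ≫ p = 𝟙 _ := by
    have h2 : adjoint (A := S) (B := S) (p ≫ i) = p ≫ i := by
      rw [hpi]; exact hed
    rw [h2]
    have h3 : i ≫ (p ≫ i) ≫ p = (i ≫ p) ≫ i ≫ p := by simp
    rw [h3, hip, Category.comp_id]
  obtain ⟨S', g, hg⟩ := exists_restrict S B i p (fun a => by
    rw [hν]; exact Function.injective_id)
  let v : S' ⟶ S := ofHom (g.inv ≫ i)
  let q : S ⟶ S' := ofHom (p ≫ g.hom)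
  have hqv : q ≫ v = e := by
    refine Eq.trans ?_ hpi
    change (p ≫ g.hom) ≫ (g.inv ≫ i) = p ≫ i
    simp
  have hve : v ≫ e = v := by
    rw [← hqv]
    change (g.inv ≫ i) ≫ (p ≫ g.hom) ≫ (g.inv ≫ i) = g.inv ≫ i
    have h3 : (g.inv ≫ i) ≫ (p ≫ g.hom) ≫ (g.inv ≫ i) = g.inv ≫ (i ≫ p) ≫ i := by simp
    rw [h3, hip, Category.id_comp]
  have hv : v ≫ dag v = 𝟙 S' := hg
  refine ⟨S', v, hv, ?_⟩
  have h4 : dag v ≫ v = e := by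
    have h5 : dag v = e ≫ dag v := by
      conv_lhs => rw [← hve, dag_comp, hed]
    rw [h5, ← hqv, Category.assoc, Category.assoc, ← Category.assoc v, hv, Category.id_comp]
  rw [h4]
  exact sub_add_cancel _ _

end SelfAdjRep

/-! ## The adjoint representation -/

theorem adjMap_comp {A B D : C ⥤ ModuleCat.{k} Kᵐᵒᵖ} (f : A ⟶ B) (g : B ⟶ D) :
    J.adjMap (f ≫ g) = J.adjMap g ≫ J.adjMap f := rfl

theorem adjMap_id (A : C ⥤ ModuleCat.{k} Kᵐᵒᵖ) : J.adjMap (𝟙 A) = 𝟙 (J.adj A) := rfl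

theorem adjMap_zero (A B : C ⥤ ModuleCat.{k} Kᵐᵒᵖ) : J.adjMap (0 : A ⟶ B) = 0 := by
  refine NatTrans.ext (funext fun a => ModuleCat.hom_ext (LinearMap.ext fun φ =>
    J.toForm.injective (LinearMap.ext fun x => ?_)))
  exact map_zero (J.toForm φ)

/-- The adjoint of an isomorphism. -/
def adjIso (J : LinearInvolution P C) {A B : C ⥤ ModuleCat.{k} Kᵐᵒᵖ} (f : A ≅ B) :
    J.adj A ≅ J.adj B :=
  ⟨J.adjMap f.inv, J.adjMap f.hom, by rw [← adjMap_comp, f.hom_inv_id, adjMap_id],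
    by rw [← adjMap_comp, f.inv_hom_id, adjMap_id]⟩

theorem semiDual_separating {V : Type k} [AddCommGroup V] [Module Kᵐᵒᵖ V] {x y : V}
    (h : ∀ φ : SemiDual K V, φ x = φ y) : x = y :=
  evalMap_injective (LinearMap.ext fun φ => congrArg star (h φ))

/-- Semilinear forms separate points, and every object has the form `u*`. -/
theorem adjMap_injective {A B : C ⥤ ModuleCat.{k} Kᵐᵒᵖ} :
    Function.Injective (J.adjMap : (A ⟶ B) → (J.adj B ⟶ J.adj A)) := by
  intro f g h
  have key : ∀ a, f.app (J.obj a) = g.app (J.obj a) := fun a => by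
    refine ModuleCat.hom_ext (LinearMap.ext fun x => semiDual_separating (K := K) fun φ => ?_)
    exact LinearMap.congr_fun (congrArg J.toForm (ConcreteCategory.congr_hom
      (NatTrans.congr_app h a) (J.toForm.symm φ))) x
  ext a : 2
  rw [← J.obj_obj a]
  exact key _

/-- A representation is isomorphic to its second adjoint. -/
noncomputable def Rep.doubleAdj (J : LinearInvolution P C) (A : Rep P K C) :
    A.functor ≅ J.adj (J.adj A.functor) :=
  NatIso.ofComponents (fun a => (LinearEquiv.ofBijective
      ((evalMap (K := K) (V := A.functor.obj (J.obj (J.obj a)))) ∘ₗ (A.functor.map (J.toSS a)).hom)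
      (evalMap_bijective.comp (J.toSS_bijective A.functor a))).toModuleIso)
    (fun {a b} α => by
      refine ModuleCat.hom_ext (LinearMap.ext fun x =>
        J.toForm.injective (LinearMap.ext fun ψ => ?_))
      have h := ConcreteCategory.congr_hom (congrArg A.functor.map (J.toSS_naturality α)) x
      simp only [Functor.map_comp] at h
      exact congrArg (fun z => star (J.toForm ψ z)) h.symm)

/-- An idempotent of `A°` has as adjoint an idempotent of `A°° ≅ A`, which is trivial. -/
theorem indecomposable_adj {A : Rep P K C} (hA : A.IsIndec) :
    Indecomposable (J.adj A.functor) := by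
  let δ := A.doubleAdj J
  refine indecomposable_of_idempotents (fun h0 => hA.1 ?_) fun e he => ?_
  · rw [Limits.IsZero.iff_id_eq_zero] at h0 ⊢
    refine adjMap_injective (J := J) ?_
    rw [adjMap_id, h0, adjMap_zero]
  · have hee : J.adjMap e ≫ J.adjMap e = J.adjMap e :=
      (adjMap_comp (J := J) e.asHom e.asHom).symm.trans (congrArg J.adjMap he)
    let e' : End A.functor := δ.hom ≫ J.adjMap e ≫ δ.inv
    have he' : e' * e' = e' := by
      change (δ.hom ≫ J.adjMap e ≫ δ.inv) ≫ (δ.hom ≫ J.adjMap e ≫ δ.inv) =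
        δ.hom ≫ J.adjMap e ≫ δ.inv
      simp only [Category.assoc, Iso.inv_hom_id_assoc]
      rw [← Category.assoc (J.adjMap e) (J.adjMap e), hee]
    have hback : J.adjMap e = δ.inv ≫ e'.asHom ≫ δ.hom := by
      change J.adjMap e = δ.inv ≫ (δ.hom ≫ J.adjMap e ≫ δ.inv) ≫ δ.hom
      simp
    rcases Indecomposable.idempotent hA e' he' with h | h
    · left
      refine adjMap_injective (J := J) ?_
      rw [hback, h]
      refine Eq.trans ?_ (adjMap_zero _ _).symm
      change δ.inv ≫ (0 : A.functor ⟶ A.functor) ≫ δ.hom = 0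
      simp
    · right
      refine adjMap_injective (J := J) ?_
      rw [hback, h]
      change δ.inv ≫ 𝟙 A.functor ≫ δ.hom = 𝟙 _
      simp

theorem Rep.IsIndec.adjoint [StarModule P K] {A : Rep P K C} (hA : A.IsIndec) :
    (A.adjoint J).IsIndec :=
  indecomposable_adj hA

/-- The adjoint of a direct summand of a selfadjoint representation is a direct summand. -/
theorem exists_adjoint_summand {S : SelfAdjRep K J} {A : C ⥤ ModuleCat.{k} Kᵐᵒᵖ}
    (i : A ⟶ S.functor) (p : S.functor ⟶ A) (h : i ≫ p = 𝟙 A) :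
    ∃ (i' : J.adj A ⟶ S.functor) (p' : S.functor ⟶ J.adj A), i' ≫ p' = 𝟙 _ := by
  refine ⟨J.adjMap p ≫ S.form.inv, S.form.hom ≫ J.adjMap i, ?_⟩
  have : (J.adjMap p ≫ S.form.inv) ≫ S.form.hom ≫ J.adjMap i = J.adjMap p ≫ J.adjMap i := by simp
  rw [this, ← adjMap_comp, h, adjMap_id]

/-! ## The representation `A⁺` -/

section Plus

variable [StarModule P K] (J) (A : Rep P K C)

/-- The inclusion of `A` into `A⁺`. -/
noncomputable def plusInl : A.functor ⟶ (A.plus J).functor :=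
  ({ app := fun a => ModuleCat.ofHom (LinearMap.inl Kᵐᵒᵖ (A.functor.obj a)
      ((A.adjoint J).functor.obj a))
     naturality := fun a b α => by
      refine ModuleCat.hom_ext (LinearMap.ext fun x => Prod.ext rfl ?_)
      exact (map_zero ((A.adjoint J).functor.map α).hom).symm } :
    A.functor ⟶ (A.prod (A.adjoint J)).functor)

/-- The projection of `A⁺` onto `A`. -/
noncomputable def plusFst : (A.plus J).functor ⟶ A.functor :=
  ({ app := fun a => ModuleCat.ofHom (LinearMap.fst Kᵐᵒᵖ (A.functor.obj a)
      ((A.adjoint J).functor.obj a))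
     naturality := fun _ _ _ => rfl } : (A.prod (A.adjoint J)).functor ⟶ A.functor)

/-- The inclusion of `A°` into `A⁺`. -/
noncomputable def plusInr : (A.adjoint J).functor ⟶ (A.plus J).functor :=
  ({ app := fun a => ModuleCat.ofHom (LinearMap.inr Kᵐᵒᵖ (A.functor.obj a)
      ((A.adjoint J).functor.obj a))
     naturality := fun a b α => by
      refine ModuleCat.hom_ext (LinearMap.ext fun x => Prod.ext ?_ rfl)
      exact (map_zero (A.functor.map α).hom).symm } :
    (A.adjoint J).functor ⟶ (A.prod (A.adjoint J)).functor)

/-- The projection of `A⁺` onto `A°`. -/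
noncomputable def plusSnd : (A.plus J).functor ⟶ (A.adjoint J).functor :=
  ({ app := fun a => ModuleCat.ofHom (LinearMap.snd Kᵐᵒᵖ (A.functor.obj a)
      ((A.adjoint J).functor.obj a))
     naturality := fun _ _ _ => rfl } :
    (A.prod (A.adjoint J)).functor ⟶ (A.adjoint J).functor)

theorem plus_isBiprod : IsBiprod (plusInl J A) (plusFst J A) (plusInr J A) (plusSnd J A) where
  inl_fst := rfl
  inr_snd := rfl
  inl_snd := rfl
  inr_fst := rfl
  sum := by
    refine NatTrans.ext (funext fun a => ModuleCat.hom_ext (LinearMap.ext fun x => ?_))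
    exact Prod.ext (add_zero x.1) (zero_add x.2)

/-- The idempotent of `A⁺` with image `A`. -/
noncomputable def plusIdem : A.plus J ⟶ A.plus J :=
  SelfAdjRep.ofHom (plusFst J A ≫ plusInl J A)

theorem plusIdem_comp : plusIdem J A ≫ plusIdem J A = plusIdem J A := rfl

/-- The two terms on the left are the two halves of the hyperbolic pairing. -/
theorem plusPair_fst (a : C) (x : A.functor.obj a × SemiDual K (A.functor.obj (J.obj a)))
    (y : A.functor.obj (J.obj a) × SemiDual K (A.functor.obj (J.obj (J.obj a)))) :
    A.plusPair J a (x.1, 0) y + A.plusPair J a x (y.1, 0) = A.plusPair J a x y := by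
  simp [Rep.plusPair_apply, add_comm]

/-- `A` and `A°` are complementary and totally isotropic in `A⁺`, so the adjoint of the projection
onto `A` is the projection onto `A°`. -/
theorem plusIdem_add_dag : plusIdem J A + dag (plusIdem J A) = 𝟙 (A.plus J) := by
  refine SelfAdjRep.hom_ext fun a x y => ?_
  have h1 : (A.plus J).pair a ((SelfAdjRep.adjoint (A := A.plus J) (B := A.plus J)
      (plusIdem J A)).app a x) y = _ := SelfAdjRep.pair_adjoint _ _ _
  have h2 : (A.plus J).pair a ((plusIdem J A + dag (plusIdem J A) : A.plus J ⟶ A.plus J).app a x) y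
      = (A.plus J).pair a (NatTrans.app (plusIdem J A) a x) y +
        (A.plus J).pair a ((SelfAdjRep.adjoint (A := A.plus J) (B := A.plus J)
          (plusIdem J A)).app a x) y := by
    rw [← LinearMap.add_apply, ← map_add]
    rfl
  refine h2.trans ?_
  rw [h1]
  exact plusPair_fst J A a x y

end Plus

end Reps

section Reps

open DagCat

variable {P : Type p} [Field P] [StarRing P]
variable {K : Type k} [DivisionRing K] [StarRing K]
variable {C : Type u} [Category.{v} C] [Preadditive C] [Linear P C]
variable [Algebra P K] {J : LinearInvolution P C}

/-! ## Indecomposable direct summands of a selfadjoint representation -/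

theorem Rep.IsIndec.of_isom {A B : Rep P K C} (hA : A.IsIndec) (h : A.Isom B) : B.IsIndec := by
  obtain ⟨e⟩ := h
  exact ⟨fun h0 => hA.1 (h0.of_iso e), fun Y Z f => hA.2 Y Z (e.trans f)⟩

theorem Rep.Isom.symm {A B : Rep P K C} (h : A.Isom B) : B.Isom A := h.map Iso.symm

theorem Rep.Isom.trans {A B D : Rep P K C} (h : A.Isom B) (h' : B.Isom D) : A.Isom D := by
  obtain ⟨e⟩ := h
  obtain ⟨e'⟩ := h'
  exact ⟨e.trans e'⟩

theorem Rep.isom_adjoint_symm [StarModule P K] {A B : Rep P K C} (h : A.Isom (B.adjoint J)) :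
    B.Isom (A.adjoint J) := by
  obtain ⟨e⟩ := h
  exact ⟨(B.doubleAdj J).trans (adjIso J e).symm⟩

theorem SelfAdjRep.isom_adjoint [StarModule P K] (B : SelfAdjRep K J) :
    B.toRep.Isom (B.toRep.adjoint J) := ⟨B.form⟩

/-- The endomorphism of the direct summand `A` of `S` induced by the adjoint of the projection
onto `A`. -/
noncomputable def gramEnd {S : SelfAdjRep K J} {A : C ⥤ ModuleCat.{k} Kᵐᵒᵖ} (i : A ⟶ S.functor)
    (p : S.functor ⟶ A) : End A :=
  i ≫ SelfAdjRep.adjoint (A := S) (B := S) (p ≫ i) ≫ p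

/-- An invertible Gram endomorphism is injective at every object, so `A` carries the restricted
form. -/
theorem isoToSelfAdj_of_isUnit {S : SelfAdjRep K J} {A : Rep P K C} {i : A.functor ⟶ S.functor}
    {p : S.functor ⟶ A.functor} (h : IsUnit (gramEnd i p)) : A.IsoToSelfAdj J := by
  obtain ⟨u, hu⟩ := h
  have h1 : gramEnd i p ≫ (↑u⁻¹ : End A.functor).asHom = 𝟙 A.functor := by
    rw [← hu]; exact u.inv_mul
  obtain ⟨A', g, -⟩ := SelfAdjRep.exists_restrict S A i p (fun a => by
    refine Function.LeftInverse.injective (g := (↑u⁻¹ : End A.functor).asHom.app a) fun x => ?_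
    exact ConcreteCategory.congr_hom (NatTrans.congr_app h1 a) x)
  exact ⟨A', ⟨g⟩⟩

/-- This is `exists_isometry_of_hyperbolic` for `a`, the projection to `A` followed by `i`, and `b`,
the map `p` followed by the inclusion of `A`. -/
theorem exists_plus_isometry [StarModule P K] (h2 : (2 : P) ≠ 0) {S : SelfAdjRep K J}
    {A : Rep P K C} {i : A.functor ⟶ S.functor} {p : S.functor ⟶ A.functor} (hip : i ≫ p = 𝟙 _)
    (h : IsNilpotent (gramEnd i p)) : ∃ z : A.plus J ⟶ S, IsIsometry z := by
  have hX := plus_isBiprod J A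
  have e1 : ∀ {D : C ⥤ ModuleCat.{k} Kᵐᵒᵖ} (t : A.functor ⟶ D),
      plusInl J A ≫ plusFst J A ≫ t = t := fun t => by
    rw [← Category.assoc, hX.inl_fst, Category.id_comp]
  refine exists_isometry_of_hyperbolic (SelfAdjRep.isUnit_two h2 _) (plusIdem J A)
    (plusIdem_comp J A) (plusIdem_add_dag J A) (SelfAdjRep.ofHom (plusFst J A ≫ i))
    (SelfAdjRep.ofHom (p ≫ plusInl J A)) ?_ ?_ ?_ ?_
  · change (plusFst J A ≫ i) ≫ p ≫ plusInl J A = plusFst J A ≫ plusInl J A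
    rw [Category.assoc, ← Category.assoc i, hip, Category.id_comp]
  · change (plusFst J A ≫ plusInl J A) ≫ plusFst J A ≫ i = plusFst J A ≫ i
    rw [Category.assoc, e1]
  · change (p ≫ plusInl J A) ≫ plusFst J A ≫ plusInl J A = p ≫ plusInl J A
    rw [Category.assoc, e1]
  -- The endomorphism `(p i)° (p i)` of `S` is a cyclic shift of the Gram endomorphism of `A`.
  · have h3 : (p ≫ plusInl J A) ≫ plusFst J A ≫ i = p ≫ i := by rw [Category.assoc, e1]
    have h4 : IsNilpotent (End.of ((SelfAdjRep.adjoint (A := S) (B := S) (p ≫ i) ≫ p) ≫ i)) :=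
      isNilpotent_comp_swap _ _ h
    rw [Category.assoc] at h4
    have h5 : IsNilpotent (End.of (SelfAdjRep.adjoint (A := S) (B := S)
        ((p ≫ plusInl J A) ≫ plusFst J A ≫ i) ≫ ((p ≫ plusInl J A) ≫ plusFst J A ≫ i))) := by
      rwa [h3]
    obtain ⟨n, hn⟩ := h5
    exact ⟨n, hn⟩

section

variable [Module.Finite P K]

theorem SelfAdjRep.unitOrNil {B : SelfAdjRep K J} (hB : B.toRep.IsIndec) : UnitOrNil (End B) :=
  ⟨hB.unitOrNil.1, hB.unitOrNil.2⟩

theorem isoToSelfAdj_or_exists_plus_isometry [StarModule P K] (h2 : (2 : P) ≠ 0)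
    {S : SelfAdjRep K J} {A : Rep P K C} (hA : A.IsIndec) {i : A.functor ⟶ S.functor}
    {p : S.functor ⟶ A.functor} (hip : i ≫ p = 𝟙 _) :
    A.IsoToSelfAdj J ∨ ∃ z : A.plus J ⟶ S, IsIsometry z :=
  (hA.unitOrNil.unit_or_nil (gramEnd i p)).imp isoToSelfAdj_of_isUnit
    (exists_plus_isometry h2 hip)

/-- A selfadjoint indecomposable direct summand can be placed so that the form on it is
nondegenerate. -/
theorem exists_isUnit_gram [StarModule P K] (h2 : (2 : P) ≠ 0) {S B : SelfAdjRep K J}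
    (hB : B.toRep.IsIndec) {i : B.functor ⟶ S.functor} {p : S.functor ⟶ B.functor}
    (hip : i ≫ p = 𝟙 _) : ∃ w : B ⟶ S, IsUnit (End.of (w ≫ dag w)) := by
  rcases hB.unitOrNil.unit_or_nil (gramEnd i p) with h | h
  · refine ⟨i, ?_⟩
    let i' : B ⟶ S := i
    let p' : S ⟶ B := p
    -- The Gram endomorphism factors as `i i° p° p`; if it is a unit, so is its factor `i i°`.
    have h1 : IsUnit (End.of (dag p' ≫ p') * End.of (i' ≫ dag i')) := by
      have h3 : End.of (dag p' ≫ p') * End.of (i' ≫ dag i') = End.of (i' ≫ dag (p' ≫ i') ≫ p') := by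
        change (i' ≫ dag i') ≫ dag p' ≫ p' = _
        rw [dag_comp]
        simp
      rw [h3]
      obtain ⟨u, hu⟩ := h
      exact ⟨⟨u.1, u.2, u.3, u.4⟩, hu⟩
    exact (SelfAdjRep.unitOrNil hB).isUnit_right h1
  -- Otherwise `B⁺` embeds, and since `B` is selfadjoint, `B⁺` contains `B` isometrically.
  · obtain ⟨z, hz⟩ := exists_plus_isometry h2 hip h
    obtain ⟨c, hc, hcs, -⟩ := exists_selfAdjoint_half (SelfAdjRep.isUnit_two h2 B)
    have hX := plus_isBiprod J B.toRep
    obtain ⟨w, hw⟩ := exists_isometry_of_half c hc hcs (plusIdem J B.toRep)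
      (plusIdem_comp J B.toRep) (plusIdem_add_dag J B.toRep)
      (SelfAdjRep.ofHom (A := B) (plusInl J B.toRep)) (SelfAdjRep.ofHom (plusFst J B.toRep))
      hX.inl_fst (by
        change plusInl J B.toRep ≫ plusFst J B.toRep ≫ plusInl J B.toRep = plusInl J B.toRep
        rw [← Category.assoc, hX.inl_fst, Category.id_comp]) (by
        change (plusFst J B.toRep ≫ plusInl J B.toRep) ≫ plusFst J B.toRep = plusFst J B.toRep
        rw [Category.assoc, hX.inl_fst, Category.comp_id])
    refine ⟨w ≫ z, ?_⟩
    rw [show (w ≫ z) ≫ dag (w ≫ z) = 𝟙 B from hw.comp hz]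
    exact isUnit_one

end

/-! ## Forms on a selfadjoint indecomposable representation -/

namespace SelfAdjRep

/-- The class in `T(B)` of an endomorphism. -/
noncomputable def cl (B : SelfAdjRep K J) : End B →+* B.T where
  toFun f := B.toT f
  map_one' := map_one B.toT
  map_mul' f g := map_mul B.toT f g
  map_zero' := map_zero B.toT
  map_add' f g := map_add B.toT f g

theorem cl_star (B : SelfAdjRep K J) (f : End B) : B.cl (star f) = star (B.cl f) := rfl

theorem cl_surjective (B : SelfAdjRep K J) : Function.Surjective B.cl :=
  fun t => Quotient.inductionOn' t fun f => ⟨f, rfl⟩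

theorem cl_comp (B : SelfAdjRep K J) (f g : B ⟶ B) : B.cl (f ≫ g) = B.cl g * B.cl f :=
  map_mul B.cl (End.of g) (End.of f)

theorem cl_dag (B : SelfAdjRep K J) (f : B ⟶ B) : B.cl (dag f) = star (B.cl f) := rfl

noncomputable instance (B : SelfAdjRep K J) : StarRing B.T where
  star_involutive x := by
    obtain ⟨f, rfl⟩ := B.cl_surjective x
    rw [← cl_star, ← cl_star, star_star]
  star_mul x y := by
    obtain ⟨f, rfl⟩ := B.cl_surjective x
    obtain ⟨g, rfl⟩ := B.cl_surjective y
    rw [← RingHom.map_mul, ← cl_star, star_mul, RingHom.map_mul, cl_star, cl_star]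
  star_add x y := by
    obtain ⟨f, rfl⟩ := B.cl_surjective x
    obtain ⟨g, rfl⟩ := B.cl_surjective y
    rw [← RingHom.map_add, ← cl_star, star_add, RingHom.map_add, cl_star, cl_star]

section

variable [Module.Finite P K]

theorem cl_eq_zero_iff {B : SelfAdjRep K J} (hB : B.toRep.IsIndec) (f : End B) :
    B.cl f = 0 ↔ ¬ IsUnit f :=
  res_eq_zero_iff (unitOrNil hB)

theorem T_isUnit_or_eq_zero {B : SelfAdjRep K J} (hB : B.toRep.IsIndec) (t : B.T) :
    IsUnit t ∨ t = 0 :=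
  res_isUnit_or_eq_zero hB.unitOrNil t

theorem T_nontrivial {B : SelfAdjRep K J} (hB : B.toRep.IsIndec) : Nontrivial B.T :=
  res_nontrivial hB.unitOrNil

end

/-- `Z` is `B` with a form that differs from the form of `B` by an automorphism of class `t`. -/
def Realizes (Z B : SelfAdjRep K J) (t : B.T) : Prop :=
  ∃ τ : B ≅ Z, B.cl (τ.hom ≫ dag τ.hom) = t

theorem realizes_self (B : SelfAdjRep K J) : Realizes B B 1 := by
  refine ⟨Iso.refl B, ?_⟩
  rw [Iso.refl_hom, dag_id, Category.id_comp]
  exact map_one B.cl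

/-- The maps `f̃_v⁻¹` form an isomorphism of representations from `B` to `B^f`. Its Gram
endomorphism is `f⁻¹`, because exactly one of `u`, `u*` lies in `S₀`. -/
theorem realizes_twist (B : SelfAdjRep K J) {S₀ : Set C} (hS₀ : J.IsHalf S₀) (f : SelfAdjAut B) :
    Realizes (B.twist hS₀ f) B (B.toT f.iso.hom) := by
  let τ₀ : B.functor ≅ (Rep.twist B S₀ f).functor :=
    NatIso.ofComponents (fun a => (f.tilde S₀ a).symm) (fun {a b} α => by
      change B.functor.map α ≫ (f.tilde S₀ b).inv =
        (f.tilde S₀ a).inv ≫ (f.tilde S₀ a).hom ≫ B.functor.map α ≫ (f.tilde S₀ b).inv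
      simp)
  let τ : B ≅ B.twist hS₀ f := isoOf (B := B.twist hS₀ f) τ₀
  let φ : B ≅ B := isoOf f.iso
  have hφ : dag φ.hom = φ.hom := f.adjoint_eq
  have hh : ∀ (c : C) (z : B.functor.obj c), (f.tilde S₀ c).hom ((f.tilde S₀ c).inv z) = z :=
    fun c z => by rw [← ConcreteCategory.comp_apply]; simp
  have hgram : φ.hom ≫ τ.hom ≫ dag τ.hom = 𝟙 B := by
    refine hom_ext fun a x y => ?_
    have h1 : B.pair a (NatTrans.app (φ.hom ≫ τ.hom ≫ dag τ.hom) a x) y =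
        B.pair a ((f.tilde S₀ a).inv (f.iso.hom.app a x)) ((f.tilde S₀ (J.obj a)).inv y) :=
      pair_adjoint (A := B) (B := B.twist hS₀ f) τ.hom
        ((f.tilde S₀ a).inv (f.iso.hom.app a x)) y
    have h2 : (f.tilde S₀ a).inv (f.iso.hom.app a x) =
        f.iso.hom.app a ((f.tilde S₀ a).inv x) := by
      have h3 : f.iso.hom.app a ≫ (f.tilde S₀ a).inv = (f.tilde S₀ a).inv ≫ f.iso.hom.app a := by
        rw [Iso.eq_inv_comp, ← Category.assoc, f.tilde_comm, Category.assoc, Iso.hom_inv_id,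
          Category.comp_id]
      exact ConcreteCategory.congr_hom h3 x
    rw [h1, h2, ← f.pair_tilde hS₀, hh, hh]
    rfl
  -- Preceding `τ` by `φ = f` changes the Gram endomorphism from `f⁻¹` to `f f⁻¹ f° = f`.
  refine ⟨φ ≪≫ τ, ?_⟩
  have h3 : (φ ≪≫ τ).hom ≫ dag (φ ≪≫ τ).hom = φ.hom := by
    have h4 : (φ.hom ≫ τ.hom) ≫ dag (φ.hom ≫ τ.hom) = (φ.hom ≫ τ.hom ≫ dag τ.hom) ≫ φ.hom := by
      rw [dag_comp, hφ]; simp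
    rw [Iso.trans_hom, h4, hgram, Category.id_comp]
  rw [h3]
  rfl

theorem toT_negOne (B : SelfAdjRep K J) : B.toT (SelfAdjAut.negOne B).iso.hom = -1 := by
  change B.toT (-(1 : End B.functor)) = -1
  rw [map_neg, map_one]

/-- A realization of the class `t` embeds isometrically where `B` maps with Gram class `t`. -/
theorem Realizes.exists_isometry [Module.Finite P K] (h2 : (2 : P) ≠ 0) {Z B S : SelfAdjRep K J}
    {t : B.T} (h : Realizes Z B t) (w : B ⟶ S) (hw : B.cl (w ≫ dag w) = t) :
    ∃ z : Z ⟶ S, IsIsometry z := by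
  obtain ⟨τ, hτ⟩ := h
  refine exists_isometry_of_sub_mem (isUnit_two h2 Z) (fun r hr => ?_) τ w ?_
  · exact isNilpotent_of_mem_jacobson (P := P) (E := End B.functor) hr
  · refine Ideal.Quotient.eq.1 ?_
    exact hw.trans hτ.symm

end SelfAdjRep

end Reps

section Reps

open DagCat

variable {P : Type p} [Field P] [StarRing P]
variable {K : Type k} [DivisionRing K] [StarRing K]
variable {C : Type u} [Category.{v} C] [Preadditive C] [Linear P C]
variable [Algebra P K] [StarModule P K] {J : LinearInvolution P C}
variable {ind : Set (Rep P K C)} {ind₀ : Set (SelfAdjRep K J)} {ind₁ : Set (Rep P K C)}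

/-! ## The systems of indecomposable representations -/

theorem IsInd₀.isIndec (hind : IsInd ind) (hind₀ : IsInd₀ J ind ind₀) {B : SelfAdjRep K J}
    (hB : B ∈ ind₀) : B.toRep.IsIndec := by
  obtain ⟨A, hA, hAB⟩ := hind₀.mem B hB
  exact (hind.indec A hA).of_isom hAB

theorem IsInd₀.eq_of_isom (hind₀ : IsInd₀ J ind ind₀) {B B' : SelfAdjRep K J}
    (hB : B ∈ ind₀) (hB' : B' ∈ ind₀) (h : B.toRep.Isom B'.toRep) : B = B' := by
  obtain ⟨A, hA, hAB⟩ := hind₀.mem B hB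
  obtain ⟨D, -, hD⟩ := hind₀.existsUnique A hA ⟨B, hAB⟩
  rw [hD B ⟨hB, hAB⟩, hD B' ⟨hB', hAB.trans h⟩]

/-- If `A` is not isomorphic to `A°`, then `A` and `A'` form a pair from which only one was chosen.
If it is, then `A ≅ A° ≅ A'`. -/
theorem IsInd₁.eq_of_isom_adjoint (hind : IsInd ind) (hind₁ : IsInd₁ J ind ind₁)
    {A A' : Rep P K C} (hA : A ∈ ind₁) (hA' : A' ∈ ind₁) (h : A.Isom (A'.adjoint J)) :
    A = A' := by
  by_cases hs : A.Isom (A.adjoint J)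
  · exact hind.inj A (hind₁.subset hA) A' (hind₁.subset hA')
      (hs.trans (Rep.isom_adjoint_symm h).symm)
  · rcases hind₁.one_of_pair A (hind₁.subset hA) A' (hind₁.subset hA') hs h with h1 | h1
    · exact absurd hA' h1.2
    · exact absurd hA h1.2

theorem IsInd₁.not_isom (hind₁ : IsInd₁ J ind ind₁) {A : Rep P K C} (hA : A ∈ ind₁)
    (B : SelfAdjRep K J) : ¬ A.Isom B.toRep :=
  fun h => hind₁.not_selfAdj A hA ⟨B, h⟩

theorem IsInd₁.not_isom_adjoint (hind₁ : IsInd₁ J ind ind₁) {A : Rep P K C} (hA : A ∈ ind₁)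
    (B : SelfAdjRep K J) : ¬ B.toRep.Isom (A.adjoint J) :=
  fun h => hind₁.not_isom hA B ((Rep.isom_adjoint_symm h).trans B.isom_adjoint.symm)

/-- Every nonzero selfadjoint representation has a direct summand in the lists. -/
theorem exists_summand [Module.Finite P K] (h2 : (2 : P) ≠ 0) (hind : IsInd ind)
    (hind₀ : IsInd₀ J ind ind₀) (hind₁ : IsInd₁ J ind ind₁) (S : SelfAdjRep K J)
    (hS : ¬ Limits.IsZero S.functor) :
    (∃ A : ind₁, ∃ z : A.1.plus J ⟶ S, IsIsometry z) ∨
      ∃ B : ind₀, ∃ w : B.1 ⟶ S, IsUnit (End.of (w ≫ dag w)) := by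
  have transport : ∀ {F G : C ⥤ ModuleCat.{k} Kᵐᵒᵖ} (i : F ⟶ S.functor) (p : S.functor ⟶ F),
      i ≫ p = 𝟙 F → ∀ e : F ≅ G, (e.inv ≫ i) ≫ p ≫ e.hom = 𝟙 G := by
    intro F G i p hip e
    rw [Category.assoc, ← Category.assoc i, hip, Category.id_comp, e.inv_hom_id]
  obtain ⟨A₀, i₀, p₀, hA₀, hip₀⟩ := S.toRep.exists_indec_summand hS
  obtain ⟨A, hA, ⟨e⟩⟩ := hind.complete A₀ hA₀
  have hip := transport i₀ p₀ hip₀ e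
  by_cases hs : A.IsoToSelfAdj J
  · right
    obtain ⟨B, ⟨hB, ⟨g⟩⟩, -⟩ := hind₀.existsUnique A hA hs
    exact ⟨⟨B, hB⟩, exists_isUnit_gram h2 (hind₀.isIndec hind hB) (transport _ _ hip g)⟩
  · left
    by_cases h1 : A ∈ ind₁
    · exact ⟨⟨A, h1⟩,
        (isoToSelfAdj_or_exists_plus_isometry h2 (hind.indec A hA) hip).resolve_left hs⟩
    · have hAA : ¬ A.Isom (A.adjoint J) := fun h => h1 (hind₁.mem_of_isom A hA h hs)
      -- Here the other member of the pair was chosen. The form of `S` turns the summand `A` into a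
      -- summand `A° ≅ B`, to which the dichotomy is applied instead.
      obtain ⟨B, hB, hAB⟩ := hind.complete (A.adjoint J) (hind.indec A hA).adjoint
      have hB1 : B ∈ ind₁ := by
        rcases hind₁.one_of_pair A hA B hB hAA (Rep.isom_adjoint_symm hAB.symm) with h | h
        · exact absurd h.1 h1
        · exact h.1
      obtain ⟨g⟩ := hAB
      obtain ⟨i', p', hip'⟩ := exists_adjoint_summand _ _ hip
      exact ⟨⟨B, hB1⟩, (isoToSelfAdj_or_exists_plus_isometry h2 (hind.indec B hB)
        (transport i' p' hip' g)).resolve_left (hind₁.not_selfAdj B hB1)⟩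

/-! ## Multiplicities in an orthogonal sum -/

/-- The representation with a given key. -/
def keyRep : ind₁ ⊕ ind₀ → Rep P K C := Sum.elim (fun A => A.1) (fun B => B.1.toRep)

/-- `Z` is `A⁺`, or isomorphic to `B`. -/
def IsOfKey (Z : SelfAdjRep K J) : ind₁ ⊕ ind₀ → Prop :=
  Sum.elim (fun A => Z = A.1.plus J) (fun B => Nonempty (B.1 ≅ Z))

theorem keyRep_isIndec (hind : IsInd ind) (hind₀ : IsInd₀ J ind ind₀) (hind₁ : IsInd₁ J ind ind₁)
    (x : ind₁ ⊕ ind₀) : (keyRep x).IsIndec := by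
  rcases x with A | B
  · exact hind.indec _ (hind₁.subset A.2)
  · exact hind₀.isIndec hind B.2

theorem keyRep_injective (hind : IsInd ind) (hind₀ : IsInd₀ J ind ind₀)
    (hind₁ : IsInd₁ J ind ind₁) {x y : ind₁ ⊕ ind₀} (h : (keyRep x).Isom (keyRep y)) : x = y := by
  rcases x with A | B <;> rcases y with A' | B'
  · exact congrArg _ (Subtype.ext (hind.inj _ (hind₁.subset A.2) _ (hind₁.subset A'.2) h))
  · exact absurd h (hind₁.not_isom A.2 _)
  · exact absurd h.symm (hind₁.not_isom A'.2 _)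
  · exact congrArg _ (Subtype.ext (hind₀.eq_of_isom B.2 B'.2 h))

/-- The half `A°` of `A⁺` cannot be a copy of a representation listed under another key. -/
theorem keyRep_adjoint (hind : IsInd ind)
    (hind₁ : IsInd₁ J ind ind₁) {x : ind₁ ⊕ ind₀} {A : ind₁}
    (h : (keyRep x).Isom (A.1.adjoint J)) : x = Sum.inl A := by
  rcases x with A' | B
  · exact congrArg _ (Subtype.ext (hind₁.eq_of_isom_adjoint hind A'.2 A.2 h))
  · exact absurd h (hind₁.not_isom_adjoint A.2 B.1)

theorem HasCopies.reindex {𝓕 : Type*} [Category 𝓕] [Preadditive 𝓕] {A F : 𝓕} {M M' : Type}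
    [Fintype M] [DecidableEq M] [Fintype M'] [DecidableEq M'] (h : HasCopies A F M)
    (e : M' ≃ M) : HasCopies A F M' := by
  obtain ⟨x, y, hxy, h⟩ := h
  refine ⟨fun m => x (e m), fun m => y (e m), fun m m' => ?_, fun a b => ?_⟩
  · rw [hxy]
    simp
  · rw [h]
    exact (Equiv.sum_comp e fun m => res A (x m ≫ b) * res A (a ≫ y m)).symm

section Count

variable [Module.Finite P K]

/-- A composite `A → B → A` outside the radical would be an automorphism and make `A` and `B`
isomorphic. -/
theorem res_comp_eq_zero {A B : Rep P K C} (hA : A.IsIndec) (hB : B.IsIndec) (h : ¬ A.Isom B)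
    (a : A.functor ⟶ B.functor) (b : B.functor ⟶ A.functor) : res A.functor (a ≫ b) = 0 := by
  rw [res_eq_zero_iff hA.unitOrNil]
  exact fun hu => h (nonempty_iso_of_isUnit_comp hB.unitOrNil a b hu hA.unitOrNil.nontrivial)

/-- An object whose key is not `x` has no direct summand with key `x`. -/
theorem res_comp_eq_zero_of_key (hind : IsInd ind) (hind₀ : IsInd₀ J ind ind₀)
    (hind₁ : IsInd₁ J ind ind₁) {x y : ind₁ ⊕ ind₀} (hxy : x ≠ y) {Z : SelfAdjRep K J}
    (hZ : IsOfKey Z y) (a : (keyRep x).functor ⟶ Z.functor) (b : Z.functor ⟶ (keyRep x).functor) :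
    res (keyRep x).functor (a ≫ b) = 0 := by
  have hx := keyRep_isIndec hind hind₀ hind₁ x
  rcases y with A | B
  · obtain rfl : Z = A.1.plus J := hZ
    rw [(plus_isBiprod J A.1).comp_eq a b]
    have hA := hind.indec _ (hind₁.subset A.2)
    refine (RingHom.map_add (res (keyRep x).functor) _ _).trans ?_
    rw [res_comp_eq_zero hx hA fun h =>
        hxy (keyRep_injective (y := Sum.inl A) hind hind₀ hind₁ h),
      res_comp_eq_zero hx (hA.adjoint (J := J)) fun h => hxy (keyRep_adjoint hind hind₁ h),
      add_zero]
  · obtain ⟨e⟩ : Nonempty (B.1 ≅ Z) := hZ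
    have e1 : e.inv ≫ e.hom = 𝟙 Z := e.inv_hom_id
    let eh : B.1.functor ⟶ Z.functor := e.hom
    let ei : Z.functor ⟶ B.1.functor := e.inv
    have e2 : ei ≫ eh = 𝟙 Z.functor := e1
    have h1 : a ≫ b = (a ≫ ei) ≫ eh ≫ b := by
      rw [Category.assoc, ← Category.assoc ei, e2, Category.id_comp]
    rw [h1]
    exact res_comp_eq_zero hx (hind₀.isIndec hind B.2)
      (fun h => hxy (keyRep_injective (y := Sum.inr B) hind hind₀ hind₁ h)) _ _

/-- `A⁺` contains two copies of `A` if `A ≅ A°` and one otherwise. The exact number is immaterial as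
long as it is positive and depends only on the key. -/
theorem exists_copies (hind : IsInd ind) (hind₁ : IsInd₁ J ind ind₁) (x : ind₁ ⊕ ind₀) :
    ∃ (M : Type) (_ : Fintype M) (_ : DecidableEq M), Nonempty M ∧
      ∀ Z : SelfAdjRep K J, IsOfKey Z x → HasCopies (keyRep x).functor Z.functor M := by
  rcases x with A | B
  · by_cases h : A.1.Isom (A.1.adjoint J)
    · refine ⟨Bool, inferInstance, inferInstance, inferInstance, fun Z hZ => ?_⟩
      obtain rfl : Z = A.1.plus J := hZ
      obtain ⟨g⟩ := h
      exact HasCopies.biprod_bool (plus_isBiprod J A.1) g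
    · refine ⟨Unit, inferInstance, inferInstance, inferInstance, fun Z hZ => ?_⟩
      obtain rfl : Z = A.1.plus J := hZ
      have hA := hind.indec _ (hind₁.subset A.2)
      exact HasCopies.biprod_unit (plus_isBiprod J A.1)
        (res_comp_eq_zero hA (hA.adjoint (J := J)) h)
  · refine ⟨Unit, inferInstance, inferInstance, inferInstance, fun Z hZ => ?_⟩
    obtain ⟨e⟩ : Nonempty (B.1 ≅ Z) := hZ
    exact HasCopies.of_iso (A := B.1.functor) (F := Z.functor)
      ⟨e.hom, e.inv, e.hom_inv_id, e.inv_hom_id⟩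

open Classical in
/-- The number of summands with a given key is determined by the sum. -/
theorem card_key_le (hind : IsInd ind) (hind₀ : IsInd₀ J ind ind₀)
    (hind₁ : IsInd₁ J ind ind₁) {S : SelfAdjRep K J} {ι ι' : Type} [Fintype ι] [Fintype ι']
    {X : ι → SelfAdjRep K J} {X' : ι' → SelfAdjRep K J} {w : ∀ i, X i ⟶ S} {w' : ∀ i, X' i ⟶ S}
    (hw : IsOrthSum X S w) (hw' : IsOrthSum X' S w') (κ : ι → ind₁ ⊕ ind₀) (κ' : ι' → ind₁ ⊕ ind₀)
    (hκ : ∀ i, IsOfKey (X i) (κ i)) (hκ' : ∀ i, IsOfKey (X' i) (κ' i)) (x : ind₁ ⊕ ind₀) :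
    Fintype.card {i // κ i = x} ≤ Fintype.card {i // κ' i = x} := by
  obtain ⟨M, _, _, hM, hcop⟩ := exists_copies hind hind₁ x
  have key : ∀ {ι : Type} [Fintype ι] {X : ι → SelfAdjRep K J} {w : ∀ i, X i ⟶ S}
      (_ : IsOrthSum X S w) (κ : ι → ind₁ ⊕ ind₀) (_ : ∀ i, IsOfKey (X i) (κ i)),
      HasCopies (keyRep x).functor S.functor (Σ i, {_m : M // κ i = x}) := by
    intro ι _ X w hw κ hκ
    refine HasCopies.sum (F := fun i => (X i).functor) (fun i => w i)
      (fun i => (dag (w i) : S ⟶ X i))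
      hw.isometry (fun i j hij => hw.orth i j hij) hw.sum fun i => ?_
    by_cases h : κ i = x
    · refine (hcop (X i) (h ▸ hκ i)).reindex (Equiv.subtypeUnivEquiv fun _ => h)
    · have : IsEmpty {_m : M // κ i = x} := ⟨fun m => h m.2⟩
      exact (HasCopies.empty (res_comp_eq_zero_of_key hind hind₀ hind₁ (Ne.symm h)
        (hκ i))).reindex (Equiv.equivOfIsEmpty _ _)
  have hcard : ∀ {ι : Type} [Fintype ι] (κ : ι → ind₁ ⊕ ind₀),
      Fintype.card (Σ i, {_m : M // κ i = x}) =
        Fintype.card {i // κ i = x} * Fintype.card M := by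
    intro ι _ κ
    rw [← Fintype.card_prod]
    exact Fintype.card_congr
      ⟨fun m => ⟨⟨m.1, m.2.2⟩, m.2.1⟩, fun m => ⟨m.1.1, m.2, m.1.2⟩, fun _ => rfl, fun _ => rfl⟩
  have := HasCopies.card_le (keyRep_isIndec hind hind₀ hind₁ x).unitOrNil (key hw κ hκ)
    (key hw' κ' hκ')
  -- Each summand with key `x` contributes the same positive number of copies, which cancels.
  rw [hcard, hcard] at this
  exact Nat.le_of_mul_le_mul_right this Fintype.card_pos

end Count

end Reps

open Classical in
theorem exists_equiv_of_card_fiber {L : Type*} {n m : ℕ} (l : Fin n → L) (l' : Fin m → L)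
    (h : ∀ x, Fintype.card {i // l i = x} = Fintype.card {j // l' j = x}) :
    ∃ e : Fin n ≃ Fin m, ∀ i, l i = l' (e i) := by
  let E : ∀ x, {i // l i = x} ≃ {j // l' j = x} := fun x => Fintype.equivOfCardEq (h x)
  refine ⟨(Equiv.sigmaFiberEquiv l).symm.trans
    ((Equiv.sigmaCongrRight E).trans (Equiv.sigmaFiberEquiv l')), fun i => ?_⟩
  exact ((E (l i)) ⟨i, rfl⟩).2.symm

/-! ## Diagonal forms over a division ring -/

section Diagonal

variable {T : Type*} [Ring T] [StarRing T]

/-- The diagonal forms with coefficients `d` and `d'` are related by the matrix `W`. -/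
def IsGram {I J : Type*} [Fintype J] [DecidableEq I] (d : I → T) (d' : J → T) (W : I → J → T) :
    Prop :=
  ∀ i k, ∑ j, W i j * d' j * star (W k j) = if i = k then d i else 0

theorem exists_left_kernel_of_isUnit {T : Type*} [Ring T] [Nontrivial T]
    (hT : ∀ t : T, IsUnit t ∨ t = 0) {I J : Type*} [Fintype I] [Fintype J] (M : I → J → T)
    (h : Fintype.card J < Fintype.card I) : ∃ x : I → T, x ≠ 0 ∧ ∀ j, ∑ i, x i * M i j = 0 :=
  let _ : DivisionRing T := DivisionRing.ofIsUnitOrEqZero hT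
  exists_left_kernel M h

open Classical in
/-- Sylvester's law of inertia. -/
theorem IsGram.inertia [Nontrivial T] (hT : ∀ t : T, IsUnit t ∨ t = 0)
    (hpos : ∀ {ι : Type} [Fintype ι] (x : ι → T), ∑ i, x i * star (x i) = 0 → ∀ i, x i = 0)
    {I J : Type} [Fintype I] [Fintype J] {d : I → T} {d' : J → T} {W : I → J → T}
    (hW : IsGram d d' W) (c : T) (hc : c = 1 ∨ c = -1) (hd' : ∀ j, d' j = 1 ∨ d' j = -1) :
    Fintype.card {i // d i = c} ≤ Fintype.card {j // d' j = c} := by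
  by_contra hlt
  rw [not_le] at hlt
  -- If `d` has more coefficients `c` than `d'`, some nonzero `x` on the `c`-part of `d` is sent by
  -- `W` to a vector `z` with no component on the `c`-part of `d'`.
  obtain ⟨x, hx, hker⟩ := exists_left_kernel_of_isUnit hT
    (fun (i : {i // d i = c}) (j : {j // d' j = c}) => W i j) hlt
  have hcc : ∀ t : T, t * c = c * t := fun t => by
    rcases hc with hc | hc <;> simp [hc]
  let z : J → T := fun j => ∑ i, x i * W i j
  have hz0 : ∀ j, d' j = c → z j = 0 := fun j hj => hker ⟨j, hj⟩
  have hdc : ∀ j, d' j ≠ c → d' j = -c := fun j hj => by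
    rcases hc with hc | hc <;> rcases hd' j with h | h
    · exact absurd (h.trans hc.symm) hj
    · rw [h, hc]
    · rw [h, hc, neg_neg]
    · exact absurd (h.trans hc.symm) hj
  -- The value of the form is `c ∑ x x̄` computed with `d`, and `-c ∑ z z̄` computed with `d'`.
  have h1 : ∑ j, z j * d' j * star (z j) = c * ∑ i, x i * star (x i) := by
    have h2 : ∀ j, z j * d' j * star (z j) =
        ∑ i, ∑ k : {i // d i = c}, x i * (W i j * d' j * star (W k j)) * star (x k) := fun j => by
      simp only [z, star_sum, Finset.sum_mul, Finset.mul_sum, star_mul, mul_assoc]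
      exact Finset.sum_comm
    simp only [h2]
    rw [Finset.sum_comm, Finset.mul_sum]
    refine Finset.sum_congr rfl fun i _ => ?_
    rw [Finset.sum_comm]
    have h3 : ∀ k : {i // d i = c}, ∑ j, x i * (W i j * d' j * star (W k j)) * star (x k) =
        x i * (if (i : I) = k then d i else 0) * star (x k) := fun k => by
      rw [← hW i k, Finset.mul_sum, Finset.sum_mul]
    simp only [h3]
    rw [Finset.sum_eq_single i]
    · rw [if_pos rfl, i.2, hcc, mul_assoc]
    · intro k _ hk
      rw [if_neg fun h => hk (Subtype.ext h).symm]
      simp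
    · simp
  have h4 : ∀ j, z j * d' j * star (z j) = -(c * (z j * star (z j))) := fun j => by
    by_cases hj : d' j = c
    · simp [hz0 j hj]
    · rw [hdc j hj, mul_neg, hcc, neg_mul, mul_assoc]
  simp only [h4] at h1
  rw [Finset.sum_neg_distrib, ← Finset.mul_sum, neg_eq_iff_add_eq_zero, ← mul_add] at h1
  have hcu : c * c = 1 := by rcases hc with hc | hc <;> simp [hc]
  have h5 : ∑ j, z j * star (z j) + ∑ i, x i * star (x i) = 0 := by
    rw [← one_mul (∑ j, z j * star (z j) + _), ← hcu, mul_assoc, h1, mul_zero]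
  -- Anisotropy is applied to `x` and `z` jointly.
  have h6 := hpos (Sum.elim z x) (by rw [Fintype.sum_sum_type]; exact h5)
  exact hx (funext fun i => h6 (Sum.inr i))

open Classical in
/-- The discriminant of a diagonal form over a field with identity involution. -/
theorem IsGram.discr [Nontrivial T] (hT : ∀ t : T, IsUnit t ∨ t = 0)
    (hcomm : ∀ a b : T, a * b = b * a) (hid : ∀ t : T, star t = t)
    {I J : Type} [Fintype I] [Fintype J] {d : I → T} {d' : J → T} {W : I → J → T}
    (hW : IsGram d d' W) (hIJ : Fintype.card I = Fintype.card J) {ε : T} (hε : ¬ IsSquare ε)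
    (hd : ∀ i, d i = 1 ∨ d i = ε) (hd' : ∀ j, d' j = 1 ∨ d' j = ε)
    (hd1 : ∀ i i', d i ≠ 1 → d i' ≠ 1 → i = i') (hd1' : ∀ i i', d' i ≠ 1 → d' i' ≠ 1 → i = i')
    (t : T) : Fintype.card {i // d i = t} ≤ Fintype.card {j // d' j = t} := by
  let _ : CommRing T := { ‹Ring T› with mul_comm := hcomm }
  have hε1 : ε ≠ 1 := fun h => hε (h ▸ IsSquare.one)
  let e : I ≃ J := Fintype.equivOfCardEq hIJ
  let M : Matrix I I T := Matrix.of fun i k => W i (e k)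
  have hM : M * Matrix.diagonal (fun k => d' (e k)) * M.transpose = Matrix.diagonal d := by
    ext i k
    rw [Matrix.mul_apply, Matrix.diagonal_apply, ← hW i k]
    simp only [Matrix.mul_diagonal, Matrix.transpose_apply, hid]
    exact Equiv.sum_comp e fun j => W i j * d' j * W k j
  -- The discriminants differ by the square of `det M`.
  have hdet : M.det * (∏ j, d' j) * M.det = ∏ i, d i := by
    have := congrArg Matrix.det hM
    rw [Matrix.det_mul, Matrix.det_mul, Matrix.det_transpose, Matrix.det_diagonal,
      Matrix.det_diagonal, Equiv.prod_comp e fun j => d' j] at this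
    exact this
  -- As at most one coefficient differs from `1`, the discriminant is `ε` or `1` according to
  -- whether `ε` occurs; discriminants `1` and `ε` for the same form would make `ε` a square.
  have hprod : ∀ {I : Type} [Fintype I] {d : I → T}, (∀ i, d i = 1 ∨ d i = ε) →
      (∀ i i', d i ≠ 1 → d i' ≠ 1 → i = i') →
      ((∀ i, d i = 1) ∧ ∏ i, d i = 1) ∨ (∃ i, d i = ε) ∧ ∏ i, d i = ε := by
    intro I _ d hd hd1
    by_cases h : ∀ i, d i = 1
    · exact Or.inl ⟨h, Finset.prod_eq_one fun i _ => h i⟩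
    · push Not at h
      obtain ⟨i, hi⟩ := h
      have hiε := (hd i).resolve_left hi
      refine Or.inr ⟨⟨i, hiε⟩, ?_⟩
      rw [Finset.prod_eq_single i, hiε]
      · intro k _ hk
        by_contra hk1
        exact hk (hd1 k i hk1 hi)
      · simp
  have hcount1 : ∀ {I : Type} [Fintype I] {d : I → T}, (∃ i, d i = ε) →
      (∀ i i', d i ≠ 1 → d i' ≠ 1 → i = i') → Fintype.card {i // d i = ε} = 1 := by
    intro I _ d ⟨i, hi⟩ hd1
    rw [Fintype.card_eq_one_iff]
    exact ⟨⟨i, hi⟩, fun k => Subtype.ext (hd1 k i (by rw [k.2]; exact hε1) (by rw [hi]; exact hε1))⟩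
  have hcount0 : ∀ {I : Type} [Fintype I] {d : I → T}, (∀ i, d i = 1) →
      Fintype.card {i // d i = ε} = 0 := by
    intro I _ d h
    rw [Fintype.card_eq_zero_iff]
    exact ⟨fun i => hε1 (by rw [← i.2, h])⟩
  have hεcount : Fintype.card {i // d i = ε} = Fintype.card {j // d' j = ε} := by
    rcases hprod hd hd1 with ⟨h, hp⟩ | ⟨h, hp⟩ <;> rcases hprod hd' hd1' with ⟨h', hp'⟩ | ⟨h', hp'⟩
    · rw [hcount0 h, hcount0 h']
    · exfalso
      rw [hp, hp'] at hdet
      rcases hT M.det with hu | h0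
      · obtain ⟨u, hu⟩ := hu
        refine hε ⟨↑u⁻¹, ?_⟩
        rw [← hu] at hdet
        calc ε = (↑u⁻¹ * ↑u) * ε * (↑u * ↑u⁻¹) := by simp
          _ = ↑u⁻¹ * (↑u * ε * ↑u) * ↑u⁻¹ := by simp only [mul_assoc]
          _ = _ := by rw [hdet, mul_one]
      · rw [h0] at hdet
        simp at hdet
    · exfalso
      rw [hp, hp', mul_one] at hdet
      exact hε ⟨M.det, hdet.symm⟩
    · rw [hcount1 h hd1, hcount1 h' hd1']
  have hsplit : ∀ {I : Type} [Fintype I] {d : I → T}, (∀ i, d i = 1 ∨ d i = ε) →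
      Fintype.card {i // d i = 1} + Fintype.card {i // d i = ε} = Fintype.card I := by
    intro I _ d hd
    rw [← Fintype.card_subtype_or_disjoint]
    · exact Fintype.card_congr (Equiv.subtypeUnivEquiv hd)
    · rw [Pi.disjoint_iff]
      intro i
      rw [Prop.disjoint_iff]
      exact fun ⟨h1, h2⟩ => hε1 (Eq.trans (Eq.symm h2) h1)
  by_cases ht : t = ε
  · rw [ht, hεcount]
  · by_cases ht1 : t = 1
    · have h1 := hsplit hd
      have h2 := hsplit hd'
      rw [ht1]
      omega
    · have : IsEmpty {i // d i = t} := ⟨fun i => (hd i).elim (fun h => ht1 (i.2.symm.trans h))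
        (fun h => ht (i.2.symm.trans h))⟩
      rw [Fintype.card_eq_zero]
      exact Nat.zero_le _

end Diagonal

section Reps

open DagCat

variable {P : Type p} [Field P] [StarRing P]
variable {K : Type k} [DivisionRing K] [StarRing K]
variable {C : Type u} [Category.{v} C] [Preadditive C] [Linear P C]
variable [Algebra P K] [StarModule P K] {J : LinearInvolution P C}
variable {ind : Set (Rep P K C)} {ind₀ : Set (SelfAdjRep K J)} {ind₁ : Set (Rep P K C)}

/-! ## Families of summands -/

/-- A family of selfadjoint representations of the form `A⁺` and `B^t`, each form occurring once. -/
structure IsSummandFamily {L : Type*} (X : L → SelfAdjRep K J)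
    (typ : L → ind₁ ⊕ (Σ B : ind₀, B.1.T)) : Prop where
  inj : Function.Injective typ
  plus : ∀ x A, typ x = Sum.inl A → X x = A.1.plus J
  realizes : ∀ x B t, typ x = Sum.inr ⟨B, t⟩ → SelfAdjRep.Realizes (X x) B.1 t

variable {L : Type*} {X : L → SelfAdjRep K J} {typ : L → ind₁ ⊕ (Σ B : ind₀, B.1.T)}

/-- The key of a summand. -/
def typKey : ind₁ ⊕ (Σ B : ind₀, B.1.T) → ind₁ ⊕ ind₀ := Sum.map id Sigma.fst

theorem IsSummandFamily.isOfKey (hX : IsSummandFamily X typ) (x : L) :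
    IsOfKey (X x) (typKey (typ x)) := by
  rcases h : typ x with A | ⟨B, t⟩
  · exact hX.plus x A h
  · obtain ⟨τ, -⟩ := hX.realizes x B t h
    exact ⟨τ⟩

variable [Module.Finite P K]

theorem IsOfKey.id_ne_zero (hind : IsInd ind) (hind₀ : IsInd₀ J ind ind₀)
    (hind₁ : IsInd₁ J ind ind₁) {Z : SelfAdjRep K J} {x : ind₁ ⊕ ind₀} (hZ : IsOfKey Z x) :
    𝟙 Z ≠ 0 := by
  intro h0
  have h0' : 𝟙 Z.functor = 0 := h0
  rcases x with A | B
  · obtain rfl : Z = A.1.plus J := hZ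
    refine (hind.indec _ (hind₁.subset A.2)).1 ((Limits.IsZero.iff_id_eq_zero _).2 ?_)
    rw [← (plus_isBiprod J A.1).inl_fst, ← Category.comp_id (plusInl J A.1), h0']
    simp
  · obtain ⟨e⟩ : Nonempty (B.1 ≅ Z) := hZ
    refine (hind₀.isIndec hind B.2).1 ((Limits.IsZero.iff_id_eq_zero _).2 ?_)
    have : 𝟙 B.1 = 0 := by
      rw [← e.hom_inv_id, ← Category.comp_id e.hom, h0]
      simp
    exact this

/-- If the complement were all of `S`, then `w† w = 0`, so `w = w w† w = 0` and `1 = w w† = 0`. -/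
theorem finrank_complement_lt {X S S' : SelfAdjRep K J} (hX : 𝟙 X ≠ 0) {w : X ⟶ S}
    (hw : IsIsometry w) {v : S' ⟶ S} (hv : v ≫ dag v = 𝟙 S')
    (hvw : dag v ≫ v + dag w ≫ w = 𝟙 S) :
    Module.finrank P (End S'.functor) < Module.finrank P (End S.functor) := by
  refine finrank_end_lt_of_retract (A := S.toRep) (B := S'.toRep) v (dag v : S ⟶ S') hv
    fun h => hX ?_
  have h' : dag v ≫ v = 𝟙 S := h
  rw [h'] at hvw
  have h0 : dag w ≫ w = 0 := by simpa using hvw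
  have hw' : w ≫ dag w = 𝟙 X := hw
  have h1 : w = 0 := by
    calc w = (w ≫ dag w) ≫ w := by rw [hw', Category.id_comp]
      _ = w ≫ dag w ≫ w := Category.assoc _ _ _
      _ = 0 := by rw [h0]; simp
  rw [← hw', h1]
  simp

/-- Existence of an orthogonal decomposition in which every label that is not plain occurs at most
once. -/
theorem IsSummandFamily.exists_decomp (h2 : (2 : P) ≠ 0) (hind : IsInd ind)
    (hind₀ : IsInd₀ J ind ind₀) (hind₁ : IsInd₁ J ind ind₁) (hX : IsSummandFamily X typ)
    (plain : L → Prop) (hA : ∀ A : ind₁, ∃ x, typ x = Sum.inl A)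
    (hB : ∀ (B : ind₀) (a : B.1.T), star a = a → a ≠ 0 →
      ∃ x t y, typ x = Sum.inr ⟨B, t⟩ ∧ star y * a * y = t)
    (hd : ∀ x, ¬ plain x → ∃ x', plain x' ∧ ∀ (S : SelfAdjRep K J) (w₁ w₂ : X x ⟶ S),
      IsIsometry w₁ → IsIsometry w₂ → w₁ ≫ dag w₂ = 0 → ∃ z : X x' ⟶ S, IsIsometry z)
    (S : SelfAdjRep K J) :
    ∃ (n : ℕ) (l : Fin n → L), (∀ i j, ¬ plain (l i) → l i = l j → i = j) ∧
      ∃ w, IsOrthSum (fun i => X (l i)) S w := by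
  induction hn : Module.finrank P (End S.functor) using Nat.strong_induction_on
    generalizing S with
  | _ N ih =>
    by_cases hS : Limits.IsZero S.functor
    · refine ⟨0, Fin.elim0, fun i => i.elim0, fun i => i.elim0, ⟨fun i => i.elim0,
        fun i => i.elim0, ?_⟩⟩
      have h0' : 𝟙 S.functor = 0 := (Limits.IsZero.iff_id_eq_zero _).1 hS
      have h0 : 𝟙 S = 0 := h0'
      rw [h0]
      simp
    · have hex : ∃ x, ∃ w : X x ⟶ S, IsIsometry w := by
        rcases exists_summand h2 hind hind₀ hind₁ S hS with ⟨A, z, hz⟩ | ⟨B, w, hw⟩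
        · obtain ⟨x, hx⟩ := hA A
          refine ⟨x, ?_⟩
          rw [hX.plus x A hx]
          exact ⟨z, hz⟩
        · have hBi := hind₀.isIndec hind B.2
          obtain ⟨x, t, y, hx, hy⟩ := hB B (B.1.cl (w ≫ dag w))
            (by rw [← SelfAdjRep.cl_dag, dag_comp, dag_dag])
            (fun h => (SelfAdjRep.cl_eq_zero_iff hBi _).1 h hw)
          obtain ⟨g, rfl⟩ := B.1.cl_surjective y
          -- Precomposing `w` with a lift `g` of `y` changes the Gram class `a` to `ȳ a y`, the
          -- class realized by the label `x`.
          refine ⟨x, (hX.realizes x B t hx).exists_isometry h2 (g.asHom ≫ w) ?_⟩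
          rw [← hy, dag_comp, Category.assoc, ← Category.assoc w, SelfAdjRep.cl_comp,
            SelfAdjRep.cl_comp, SelfAdjRep.cl_dag]
      have step : ∀ x (w : X x ⟶ S), IsIsometry w → ∃ (n : ℕ) (l : Fin n → L),
          (∀ i j, ¬ plain (l i) → l i = l j → i = j) ∧
          (∃ u, IsOrthSum (fun i : Fin (n + 1) => X ((Fin.cons x l : Fin (n + 1) → L) i)) S u) ∧
          ∀ i, ∃ u : X (l i) ⟶ S, IsIsometry u ∧ w ≫ dag u = 0 := by
        intro x w hw
        obtain ⟨S', v, hv, hvw⟩ := SelfAdjRep.exists_complement hw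
        have hlt := finrank_complement_lt ((hX.isOfKey x).id_ne_zero hind hind₀ hind₁) hw hv hvw
        rw [hn] at hlt
        obtain ⟨n, l, hl, y, hy⟩ := ih _ hlt S' rfl
        have hcons := IsOrthSum.cons (Y := fun i : Fin (n + 1) =>
          X ((Fin.cons x l : Fin (n + 1) → L) i)) (w := w) hw hv hvw hy
        refine ⟨n, l, hl, ⟨_, hcons⟩, fun i => ⟨y i ≫ v, ?_, ?_⟩⟩
        · exact hcons.isometry i.succ
        · exact hcons.orth 0 i.succ (Fin.succ_ne_zero i).symm
      -- Plain labels are split off as long as possible. When none embeds in `S`, a label that is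
      -- not plain cannot occur twice, since by `hd` two orthogonal copies of it would contain a
      -- plain summand.
      by_cases hp : ∃ x, plain x ∧ ∃ w : X x ⟶ S, IsIsometry w
      · obtain ⟨x, hx, w, hw⟩ := hp
        obtain ⟨n, l, hl, hu, -⟩ := step x w hw
        refine ⟨n + 1, Fin.cons x l, fun i j => ?_, hu⟩
        refine Fin.cases ?_ (fun i => ?_) i <;> refine Fin.cases ?_ (fun j => ?_) j
        · simp
        · intro h _
          exact absurd hx h
        · intro h h'
          rw [h'] at h
          exact absurd hx h
        · intro h h'
          exact congrArg _ (hl i j h h')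
      · obtain ⟨x, w, hw⟩ := hex
        have hx : ¬ plain x := fun h => hp ⟨x, h, w, hw⟩
        obtain ⟨n, l, hl, hu, hlu⟩ := step x w hw
        have hxl : ∀ i, x ≠ l i := by
          rintro i rfl
          obtain ⟨u, hu, hwu⟩ := hlu i
          obtain ⟨x', hx', hz⟩ := hd _ hx
          exact hp ⟨x', hx', hz S w u hw hu hwu⟩
        refine ⟨n + 1, Fin.cons x l, fun i j => ?_, hu⟩
        refine Fin.cases ?_ (fun i => ?_) i <;> refine Fin.cases ?_ (fun j => ?_) j
        · simp
        · intro _ h'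
          exact absurd h' (hxl j)
        · intro _ h'
          exact absurd h'.symm (hxl i)
        · intro h h'
          exact congrArg _ (hl i j h h')

open Classical in
/-- The labels of an orthogonal decomposition are determined up to permutation if the diagonal
forms over the skew fields `T(B)` are. -/
theorem IsSummandFamily.card_le (hind : IsInd ind)
    (hind₀ : IsInd₀ J ind ind₀) (hind₁ : IsInd₁ J ind ind₁) (hX : IsSummandFamily X typ)
    {S : SelfAdjRep K J} {n m : ℕ} {l : Fin n → L} {l' : Fin m → L} {w w'}
    (hw : IsOrthSum (fun i => X (l i)) S w) (hw' : IsOrthSum (fun i => X (l' i)) S w')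
    (hU : ∀ (B : ind₀) (d : {i // ∃ t, typ (l i) = Sum.inr ⟨B, t⟩} → B.1.T)
      (d' : {j // ∃ t, typ (l' j) = Sum.inr ⟨B, t⟩} → B.1.T)
      (W : {i // ∃ t, typ (l i) = Sum.inr ⟨B, t⟩} →
        {j // ∃ t, typ (l' j) = Sum.inr ⟨B, t⟩} → B.1.T),
      (∀ i : {i // ∃ t, typ (l i) = Sum.inr ⟨B, t⟩}, typ (l i.1) = Sum.inr ⟨B, d i⟩) →
      (∀ j : {j // ∃ t, typ (l' j) = Sum.inr ⟨B, t⟩}, typ (l' j.1) = Sum.inr ⟨B, d' j⟩) →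
      IsGram d d' W →
      Fintype.card {i // ∃ t, typ (l i) = Sum.inr ⟨B, t⟩} =
        Fintype.card {j // ∃ t, typ (l' j) = Sum.inr ⟨B, t⟩} →
      ∀ t, Fintype.card {i // d i = t} ≤ Fintype.card {j // d' j = t}) (x : L) :
    Fintype.card {i // l i = x} ≤ Fintype.card {j // l' j = x} := by
  -- The number of summands with each key agrees. This settles the labels `A⁺`, which are determined
  -- by their key; for a key `B` the coefficients in `T(B)` remain to be compared.
  have hkey : ∀ y : ind₁ ⊕ ind₀, Fintype.card {i // typKey (typ (l i)) = y} =
      Fintype.card {j // typKey (typ (l' j)) = y} := fun y => le_antisymm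
    (card_key_le hind hind₀ hind₁ hw hw' (fun i => typKey (typ (l i)))
      (fun j => typKey (typ (l' j))) (fun i => hX.isOfKey _) (fun j => hX.isOfKey _) y)
    (card_key_le hind hind₀ hind₁ hw' hw (fun i => typKey (typ (l' i)))
      (fun j => typKey (typ (l j))) (fun i => hX.isOfKey _) (fun j => hX.isOfKey _) y)
  rcases hx : typ x with A | ⟨B, t⟩
  · have h1 : ∀ y, y = x ↔ typKey (typ y) = Sum.inl A := fun y => by
      constructor
      · rintro rfl
        rw [hx]
        rfl
      · intro hy
        refine hX.inj ?_
        rcases h : typ y with A' | ⟨B', t'⟩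
        · rw [h] at hy
          rw [hx]
          exact congrArg Sum.inl (Sum.inl_injective hy)
        · rw [h] at hy
          cases hy
    simp only [h1]
    exact (hkey _).le
  · have hB : ∀ y, (∃ t, typ y = Sum.inr ⟨B, t⟩) ↔ typKey (typ y) = Sum.inr B := fun y => by
      constructor
      · rintro ⟨t, h⟩
        rw [h]
        rfl
      · intro hy
        rcases h : typ y with A' | ⟨B', t'⟩
        · rw [h] at hy
          cases hy
        · rw [h] at hy
          have hBB : B' = B := Sum.inr_injective hy
          subst hBB
          exact ⟨t', rfl⟩
    have hcardB : Fintype.card {i // ∃ t, typ (l i) = Sum.inr ⟨B, t⟩} =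
        Fintype.card {j // ∃ t, typ (l' j) = Sum.inr ⟨B, t⟩} := by
      simp only [hB]
      exact hkey _
    choose d hd using fun i : {i // ∃ t, typ (l i) = Sum.inr ⟨B, t⟩} => i.2
    choose d' hd' using fun j : {j // ∃ t, typ (l' j) = Sum.inr ⟨B, t⟩} => j.2
    choose τ hτ using fun i => hX.realizes _ B (d i) (hd i)
    choose τ' hτ' using fun j => hX.realizes _ B (d' j) (hd' j)
    -- Summands with a key other than `B` vanish modulo the radical, so only the diagonal forms over
    -- `T(B)` are related.
    obtain ⟨W, hW⟩ := exists_gram B.1.cl B.1.cl_star hw hw' Subtype.val Subtype.val_injective τ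
      Subtype.val Subtype.val_injective τ' (fun j hj a b => by
        have hne : Sum.inr B ≠ typKey (typ (l' j)) := fun h =>
          hj ⟨⟨j, (hB _).2 h.symm⟩, rfl⟩
        exact res_comp_eq_zero_of_key (x := Sum.inr B) hind hind₀ hind₁ hne (hX.isOfKey (l' j))
          a b)
    have hgram : IsGram d d' W := by
      intro i k
      have := hW i k
      simp only [hτ, hτ'] at this
      exact this
    have h1 := hU B d d' W hd hd' hgram hcardB t
    have h2 : Fintype.card {i // l i = x} = Fintype.card {i // d i = t} := by
      refine Fintype.card_congr ⟨fun i => ⟨⟨i.1, t, by rw [i.2, hx]⟩, ?_⟩,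
        fun i => ⟨i.1.1, hX.inj (by rw [hd, i.2, hx])⟩, fun _ => rfl, fun _ => rfl⟩
      have h3 := hd ⟨i.1, t, by rw [i.2, hx]⟩
      have h4 : typ (l i.1) = Sum.inr ⟨B, t⟩ := by rw [i.2, hx]
      exact (eq_of_heq (Sigma.mk.inj (Sum.inr_injective (h4.symm.trans h3))).2).symm
    have h2' : Fintype.card {j // l' j = x} = Fintype.card {j // d' j = t} := by
      refine Fintype.card_congr ⟨fun i => ⟨⟨i.1, t, by rw [i.2, hx]⟩, ?_⟩,
        fun i => ⟨i.1.1, hX.inj (by rw [hd', i.2, hx])⟩, fun _ => rfl, fun _ => rfl⟩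
      have h3 := hd' ⟨i.1, t, by rw [i.2, hx]⟩
      have h4 : typ (l' i.1) = Sum.inr ⟨B, t⟩ := by rw [i.2, hx]
      exact (eq_of_heq (Sigma.mk.inj (Sum.inr_injective (h4.symm.trans h3))).2).symm
    rw [h2, h2']
    exact h1

end Reps

/-! ## Real closed fields -/

section RealClosed

variable {P : Type*} [Field P] [IsRealClosed P]

/-- Dividing by `a ^ 2` would write `-1` as a sum of squares. -/
theorem eq_zero_of_sq_add_sq_add_sq {a b c : P} (h : a ^ 2 + b ^ 2 + c ^ 2 = 0) : a = 0 := by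
  by_contra ha
  refine IsSemireal.one_add_ne_zero (R := P) (s := (b / a) * (b / a) + (c / a) * (c / a)) ?_ ?_
  · exact (IsSumSq.mul_self _).add (IsSumSq.mul_self _)
  · field_simp
    linear_combination h

theorem eq_zero_of_sq_add_sq {a b : P} (h : a ^ 2 + b ^ 2 = 0) : a = 0 :=
  eq_zero_of_sq_add_sq_add_sq (b := b) (c := 0) (by linear_combination h)

theorem exists_sq_or_neg_sq (a : P) : ∃ q, a = q ^ 2 ∨ a = -q ^ 2 := by
  rcases IsRealClosed.isSquare_or_isSquare_neg a with ⟨q, h⟩ | ⟨q, h⟩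
  · exact ⟨q, Or.inl (by linear_combination h)⟩
  · exact ⟨q, Or.inr (by linear_combination -h)⟩

/-- If instead `a² + b² = -q²`, then `q = 0`. -/
theorem exists_sq_eq_sq_add_sq (a b : P) : ∃ q, a ^ 2 + b ^ 2 = q ^ 2 := by
  obtain ⟨q, h | h⟩ := exists_sq_or_neg_sq (a ^ 2 + b ^ 2)
  · exact ⟨q, h⟩
  · have hq : q = 0 := eq_zero_of_sq_add_sq_add_sq (b := a) (c := b) (by linear_combination h)
    exact ⟨q, by rw [h, hq]; ring⟩

/-- `a - ā` is `±q²` and is negated by the involution, so `q² + q̄² = 0`. Hence the involution on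
the real closed field `P` is trivial. -/
theorem star_eq_of_isRealClosed [StarRing P] (a : P) : star a = a := by
  obtain ⟨q, h⟩ := exists_sq_or_neg_sq (a - star a)
  have h1 : star (a - star a) = -(a - star a) := by rw [star_sub, star_star]; ring
  have h2 : q ^ 2 + star q ^ 2 = 0 := by
    rcases h with h | h <;> rw [h] at h1 <;> simp only [star_neg, star_pow] at h1
    · linear_combination h1
    · linear_combination -h1
  have hq := eq_zero_of_sq_add_sq h2
  rcases h with h | h <;> rw [hq] at h <;> linear_combination -h

/-- Square roots in the field `P(i)`. -/
theorem exists_complex_sqrt (a b : P) : ∃ c d : P, c ^ 2 - d ^ 2 = a ∧ 2 * c * d = b := by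
  have h2 : (2 : P) ≠ 0 := two_ne_zero
  obtain ⟨N, hN⟩ := exists_sq_eq_sq_add_sq a b
  -- The usual formula: with `N² = a² + b²`, the real part satisfies `c² = (a + N)/2`, and `d =
  -- b/(2c)`.
  have key : ∀ N c : P, a ^ 2 + b ^ 2 = N ^ 2 → c ≠ 0 → (a + N) / 2 = c ^ 2 →
      ∃ c d : P, c ^ 2 - d ^ 2 = a ∧ 2 * c * d = b := by
    intro N c hN hc h
    refine ⟨c, b / (2 * c), ?_, by field_simp⟩
    have hN' : N = 2 * c ^ 2 - a := by field_simp at h; linear_combination h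
    rw [hN'] at hN
    field_simp
    linear_combination -hN
  by_cases hb : b = 0
  · obtain ⟨q, hq | hq⟩ := exists_sq_or_neg_sq a
    · exact ⟨q, 0, by rw [hq]; ring, by rw [hb]; ring⟩
    · exact ⟨0, q, by rw [hq]; ring, by rw [hb]; ring⟩
  obtain ⟨c, hc⟩ := exists_sq_or_neg_sq ((a + N) / 2)
  have hc0 : c ≠ 0 := fun hc0 => hb <| by
    have hN' : N = -a := by
      rcases hc with hc | hc <;> rw [hc0] at hc <;> field_simp at hc <;> linear_combination hc
    rw [hN'] at hN
    exact pow_eq_zero_iff (two_ne_zero) |>.1 (by linear_combination hN)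
  rcases hc with hc | hc
  · exact key N c hN hc0 hc
  -- If `(a + N)/2 = -c²`, the other sign of `N` works: the product of `(a + N)/2` and `(a - N)/2`
  -- is `-b²/4`, so `(a - N)/2 = (b/(2c))²`.
  · refine key (-N) (b / (2 * c)) (by linear_combination hN)
      (div_ne_zero hb (mul_ne_zero h2 hc0)) ?_
    have hN' : N = -2 * c ^ 2 - a := by field_simp at hc; linear_combination hc
    rw [hN'] at hN ⊢
    field_simp
    linear_combination -hN

/-! ### The algebraic closure of a real closed field -/

open IntermediateField Polynomial Module

theorem mem_adjoin_i {L : Type*} [Field L] [Algebra P L] [Algebra.IsAlgebraic P L] {i : L}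
    (hi : i ^ 2 = -1) {x : L} (hx : x ∈ P⟮i⟯) :
    ∃ a b : P, x = algebraMap P L a + algebraMap P L b * i := by
  rw [← mem_toSubalgebra,
    adjoin_simple_toSubalgebra_of_isAlgebraic (Algebra.IsAlgebraic.isAlgebraic i)] at hx
  induction hx using Algebra.adjoin_induction with
  | mem x hx =>
    obtain rfl : x = i := hx
    exact ⟨0, 1, by simp⟩
  | algebraMap r => exact ⟨r, 0, by simp⟩
  | add x y _ _ hx hy =>
    obtain ⟨a, b, rfl⟩ := hx
    obtain ⟨c, d, rfl⟩ := hy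
    exact ⟨a + c, b + d, by simp only [map_add]; ring⟩
  | mul x y _ _ hx hy =>
    obtain ⟨a, b, rfl⟩ := hx
    obtain ⟨c, d, rfl⟩ := hy
    refine ⟨a * c - b * d, a * d + b * c, ?_⟩
    simp only [map_add, map_sub, map_mul]
    linear_combination (algebraMap P L b * algebraMap P L d) * hi

/-- The minimal polynomial of a primitive element is irreducible of odd degree, and it has a root in
`P`. -/
theorem finrank_eq_one_of_odd {E : Type*} [Field E] [Algebra P E] [FiniteDimensional P E]
    (h : Odd (finrank P E)) : finrank P E = 1 := by
  obtain ⟨θ, hθ⟩ := Field.exists_primitive_element P E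
  have hintegral : IsIntegral P θ := Algebra.IsIntegral.isIntegral θ
  have hdeg : (minpoly P θ).natDegree = finrank P E := by
    rw [← IntermediateField.adjoin.finrank hintegral, hθ, IntermediateField.finrank_top']
  obtain ⟨r, hr⟩ := IsRealClosed.exists_isRoot_of_odd_natDegree (f := minpoly P θ) (by rwa [hdeg])
  rw [← hdeg]
  exact natDegree_eq_of_degree_eq_some
    (degree_eq_one_of_irreducible_of_root (minpoly.irreducible hintegral) hr)

/-- The fixed field of a Sylow 2-subgroup has odd degree over `P`, so it is `P`, and the Galois
group is a 2-group. -/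
theorem exists_finrank_eq_two_pow (L : Type*) [Field L] [Algebra P L] [FiniteDimensional P L]
    [IsGalois P L] : ∃ n, finrank P L = 2 ^ n := by
  have : Fact (Nat.Prime 2) := ⟨Nat.prime_two⟩
  let Q : Sylow 2 Gal(L/P) := default
  have h1 : finrank P (fixedField (Q : Subgroup Gal(L/P))) = (Q : Subgroup Gal(L/P)).index := by
    rw [finrank_eq_fixingSubgroup_index, fixingSubgroup_fixedField]
  have h2 : Odd (Q : Subgroup Gal(L/P)).index := by
    rw [← Nat.not_even_iff_odd, even_iff_two_dvd]
    exact Q.not_dvd_index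
  rw [← h1] at h2
  have h3 := finrank_eq_one_of_odd h2
  rw [h1, Subgroup.index_eq_one] at h3
  have h4 := Q.isPGroup'
  obtain ⟨n, hn⟩ := IsPGroup.iff_card.1 h4
  refine ⟨n, ?_⟩
  rw [← hn, ← IsGalois.card_aut_eq_finrank, h3]
  simp

/-- If `L` were larger than `P(i)`, a subgroup of index 2 in the 2-group `Gal(L/P(i))` would give a
quadratic extension of `P(i)`. But all elements of `P(i)` are squares, so the quadratic formula
provides a root. -/
theorem adjoin_i_eq_top {L : Type*} [Field L] [Algebra P L] [FiniteDimensional P L] [IsGalois P L]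
    {i : L} (hi : i ^ 2 = -1) : P⟮i⟯ = ⊤ := by
  have : Fact (Nat.Prime 2) := ⟨Nat.prime_two⟩
  obtain ⟨n, hn⟩ := exists_finrank_eq_two_pow (P := P) L
  have hdvd : finrank P⟮i⟯ L ∣ 2 ^ n := ⟨_, by
    rw [← hn, mul_comm, finrank_mul_finrank P P⟮i⟯ L]⟩
  obtain ⟨m, -, hm⟩ := (Nat.dvd_prime_pow Nat.prime_two).1 hdvd
  rcases m with _ | m
  · rwa [pow_zero, finrank_eq_one_iff_eq_top] at hm
  exfalso
  have hsq : ∀ z : P⟮i⟯, ∃ s, z = s ^ 2 := by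
    intro z
    obtain ⟨a, b, hab⟩ := mem_adjoin_i hi z.2
    obtain ⟨c, d, rfl, rfl⟩ := exists_complex_sqrt a b
    refine ⟨algebraMap P _ c + algebraMap P _ d * AdjoinSimple.gen P i, Subtype.ext ?_⟩
    rw [hab]
    change _ = (algebraMap P L c + algebraMap P L d * i) ^ 2
    simp only [map_sub, map_mul, map_pow, map_ofNat]
    linear_combination -(algebraMap P L d) ^ 2 * hi
  obtain ⟨M, hM⟩ := Sylow.exists_subgroup_card_pow_prime (G := Gal(L/P⟮i⟯)) 2 (n := m)
    (by rw [IsGalois.card_aut_eq_finrank, hm]; exact pow_dvd_pow 2 (Nat.le_succ m))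
  have h1 : finrank (fixedField M) L = 2 ^ m := by rw [finrank_fixedField_eq_card, hM]
  have h2 : finrank P⟮i⟯ (fixedField M) = 2 := by
    have := finrank_mul_finrank P⟮i⟯ (fixedField M) L
    rw [h1, hm, pow_succ'] at this
    exact Nat.eq_of_mul_eq_mul_right (by positivity) this
  obtain ⟨θ, hθ⟩ := Field.exists_primitive_element P⟮i⟯ (fixedField M)
  have hintegral : IsIntegral P⟮i⟯ θ := Algebra.IsIntegral.isIntegral θ
  have hdeg : (minpoly P⟮i⟯ θ).natDegree = 2 := by
    rw [← IntermediateField.adjoin.finrank hintegral, hθ, IntermediateField.finrank_top', h2]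
  have hirr := minpoly.irreducible hintegral
  have hmonic := minpoly.monic hintegral
  generalize minpoly P⟮i⟯ θ = f at hdeg hirr hmonic
  obtain ⟨s, hs⟩ := hsq (discrim 1 (f.coeff 1) (f.coeff 0))
  have hroot : f.IsRoot ((-f.coeff 1 + s) / 2) := by
    rw [IsRoot, eval_eq_sum_range, hdeg]
    have : f.coeff 2 = 1 := by rw [← hdeg]; exact hmonic
    simp only [Finset.sum_range_succ, Finset.sum_range_zero, this, discrim] at hs ⊢
    field_simp
    linear_combination -hs
  have h3 : f.natDegree = 1 :=
    natDegree_eq_of_degree_eq_some (degree_eq_one_of_irreducible_of_root hirr hroot)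
  rw [hdeg] at h3
  exact absurd h3 (by norm_num)

/-- An algebraically closed algebraic extension of a real closed field `P` is `P(i)`. -/
theorem exists_eq_add_mul_i {Ω : Type*} [Field Ω] [Algebra P Ω] [IsAlgClosure P Ω] {i : Ω}
    (hi : i ^ 2 = -1) (x : Ω) : ∃ a b : P, x = algebraMap P Ω a + algebraMap P Ω b * i := by
  have := IsAlgClosure.isAlgebraic (R := P) (K := Ω)
  have hfin : FiniteDimensional P (adjoin P {i, x}) :=
    finiteDimensional_adjoin fun y _ => Algebra.IsIntegral.isIntegral y
  -- A finite Galois extension of `P` containing both `i` and `x`.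
  let L := normalClosure P (adjoin P {i, x}) Ω
  have hle : adjoin P {i, x} ≤ L := le_normalClosure _
  have hsub := subset_adjoin P ({i, x} : Set Ω)
  let i' : L := ⟨i, hle (hsub (by simp))⟩
  let x' : L := ⟨x, hle (hsub (by simp))⟩
  have hi' : i' ^ 2 = -1 := Subtype.ext hi
  have hx' : x' ∈ P⟮i'⟯ := by rw [adjoin_i_eq_top hi']; trivial
  obtain ⟨a, b, h⟩ := mem_adjoin_i hi' hx'
  exact ⟨a, b, congrArg Subtype.val h⟩

end RealClosed

/-! ## Division algebras over a real closed field -/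

section DivisionAlgebra

open Polynomial

variable {P : Type*} [Field P] [IsRealClosed P] {T : Type*} [DivisionRing T] [Algebra P T]

theorem inv_mul_inv_smul_sq {s : P} (hs : s ≠ 0) :
    (s⁻¹ * s⁻¹) • algebraMap P T (s ^ 2) = 1 := by
  have h : s⁻¹ * s⁻¹ * s ^ 2 = 1 := by field_simp
  rw [Algebra.smul_def, ← map_mul, h, map_one]

theorem eq_algebraMap_of_sq {a : T} {q : P} (h : a * a = algebraMap P T (q ^ 2)) :
    ∃ r, a = algebraMap P T r := by
  have h1 : (a - algebraMap P T q) * (a + algebraMap P T q) = 0 := by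
    rw [sub_mul, mul_add, mul_add, h, Algebra.commutes q a, ← map_mul, ← sq]
    abel
  rcases mul_eq_zero.1 h1 with h1 | h1
  · exact ⟨q, sub_eq_zero.1 h1⟩
  · exact ⟨-q, by rw [map_neg]; exact eq_neg_of_add_eq_zero_left h1⟩

theorem algebraMap_ne_i {i : T} (hi : i * i = -1) (r : P) : i ≠ algebraMap P T r := by
  rintro rfl
  have h1 : algebraMap P T (r ^ 2 + 1 ^ 2) = 0 := by
    rw [map_add, sq, map_mul, hi]
    simp
  have h2 := eq_zero_of_sq_add_sq ((map_eq_zero_iff _ (algebraMap P T).injective).1 h1)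
  rw [h2] at hi
  simp at hi

theorem eq_or_eq_neg_of_commute {i j : T} (hi : i * i = -1) (hj : j * j = -1) (h : i * j = j * i) :
    j = i ∨ j = -i := by
  have h1 : (j - i) * (j + i) = 0 := by
    rw [sub_mul, mul_add, mul_add, hi, hj, h]
    abel
  rcases mul_eq_zero.1 h1 with h1 | h1
  · exact Or.inl (sub_eq_zero.1 h1)
  · exact Or.inr (eq_neg_of_add_eq_zero_left h1)

/-- A root of the minimal polynomial of `a` in the algebraic closure is `r + s i`, which is also a
root of `(X - r)² + s²`. -/
theorem exists_mul_self_sub [Module.Finite P T] (a : T) : ∃ r s : P,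
    (a - algebraMap P T r) * (a - algebraMap P T r) = -algebraMap P T (s ^ 2) := by
  have hintegral : IsIntegral P a := Algebra.IsIntegral.isIntegral a
  have hirr := minpoly.irreducible hintegral
  obtain ⟨i, hi⟩ := IsAlgClosed.exists_pow_nat_eq (-1 : AlgebraicClosure P) (n := 2) (by norm_num)
  obtain ⟨x, hx⟩ := IsAlgClosed.exists_aeval_eq_zero (AlgebraicClosure P) (minpoly P a)
    hirr.degree_pos.ne'
  obtain ⟨r, s, hrs⟩ := exists_eq_add_mul_i (P := P) hi x
  refine ⟨r, s, ?_⟩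
  have hdvd : minpoly P a ∣ (X - C r) * (X - C r) + C (s ^ 2) := by
    rw [minpoly.eq_of_irreducible_of_monic hirr hx (minpoly.monic hintegral)]
    refine minpoly.dvd _ _ ?_
    simp only [map_add, map_mul, map_sub, aeval_X, aeval_C, hrs, map_pow]
    linear_combination (algebraMap P (AlgebraicClosure P) s) ^ 2 * hi
  obtain ⟨g, hg⟩ := hdvd
  have h1 := congrArg (aeval a) hg
  rw [map_mul, minpoly.aeval, zero_mul] at h1
  simp only [map_add, map_mul, map_sub, aeval_X, aeval_C] at h1
  exact eq_neg_of_add_eq_zero_left h1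

/-- An element outside of `P` generates a copy of `P(i)`. -/
theorem exists_imaginary_unit [Module.Finite P T] {a : T} (ha : ∀ r, a ≠ algebraMap P T r) :
    ∃ (r s : P) (i : T), i * i = -1 ∧ i = s⁻¹ • (a - algebraMap P T r) ∧
      a = algebraMap P T r + s • i := by
  obtain ⟨r, s, h⟩ := exists_mul_self_sub (P := P) a
  have hs : s ≠ 0 := by
    rintro rfl
    refine ha r (sub_eq_zero.1 ?_)
    simpa using h
  refine ⟨r, s, s⁻¹ • (a - algebraMap P T r), ?_, rfl, ?_⟩
  · rw [smul_mul_smul_comm, h, smul_neg, inv_mul_inv_smul_sq hs]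
  · rw [smul_smul, mul_inv_cancel₀ hs, one_smul]
    abel

/-- The centralizer of `i` is `P(i)`: the imaginary unit generated by `x` commutes with `i` and can
only be `±i`. -/
theorem exists_of_commute [Module.Finite P T] {i x : T} (hi : i * i = -1) (h : i * x = x * i) :
    ∃ r s : P, x = algebraMap P T r + s • i := by
  by_cases hx : ∃ r, x = algebraMap P T r
  · obtain ⟨r, hr⟩ := hx
    exact ⟨r, 0, by simpa using hr⟩
  · push Not at hx
    obtain ⟨r, s, j, hj, hj', hx'⟩ := exists_imaginary_unit hx
    have hij : i * j = j * i := by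
      rw [hj', mul_smul_comm, smul_mul_assoc, mul_sub, sub_mul, h, Algebra.commutes r i]
    rcases eq_or_eq_neg_of_commute hi hj hij with rfl | rfl
    · exact ⟨r, s, hx'⟩
    · exact ⟨r, -s, by rw [hx', smul_neg, neg_smul]⟩

/-- A root in the algebraic closure of `F` has the form `r + s i` with `r, s` in `P`, so it lies in
`F`. -/
theorem isAlgClosed_of_i {F : Type*} [Field F] [Algebra P F] [Module.Finite P F] {i : F}
    (hi : i * i = -1) : IsAlgClosed F := by
  refine IsAlgClosed.of_exists_root _ fun f _ hf => ?_
  obtain ⟨x, hx⟩ := IsAlgClosed.exists_aeval_eq_zero (AlgebraicClosure F) f hf.degree_pos.ne'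
  have : IsAlgClosure P (AlgebraicClosure F) :=
    ⟨inferInstance, Algebra.IsAlgebraic.trans P F (AlgebraicClosure F)⟩
  obtain ⟨r, s, h⟩ := exists_eq_add_mul_i (P := P) (i := algebraMap F (AlgebraicClosure F) i)
    (by rw [← map_pow, sq, hi]; simp) x
  refine ⟨algebraMap P F r + algebraMap P F s * i, ?_⟩
  apply (algebraMap F (AlgebraicClosure F)).injective
  rw [map_zero, ← hx, h, ← Polynomial.aeval_algebraMap_apply_eq_algebraMap_eval]
  simp [← IsScalarTower.algebraMap_apply]

theorem exists_j [Module.Finite P T] {i y : T} (hi : i * i = -1) (hy : i * y ≠ y * i) :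
    ∃ j : T, j * j = -1 ∧ j * i = -(i * j) := by
  have h2 : (2 : T) ≠ 0 := by
    rw [← map_ofNat (algebraMap P T) 2]
    exact (map_ne_zero_iff _ (algebraMap P T).injective).2 two_ne_zero
  have hi0 : i ≠ 0 := by rintro rfl; simp at hi
  obtain ⟨z, hz, hiz⟩ : ∃ z : T, z ≠ 0 ∧ z * i = -(i * z) := by
    -- Up to a factor 2, this is the part of `y` anticommuting with `i`; it is nonzero because `y`
    -- does not commute with `i`.
    refine ⟨y + i * y * i, fun h0 => hy ?_, ?_⟩
    · have : i * (y + i * y * i) = 0 := by rw [h0, mul_zero]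
      rw [mul_add, ← mul_assoc, ← mul_assoc, hi, neg_one_mul, neg_mul] at this
      exact add_neg_eq_zero.1 this
    · rw [mul_add, add_mul, mul_assoc _ i i, hi, ← mul_assoc i, ← mul_assoc i, hi]
      simp
  have hzz : i * (z * z) = z * z * i := by
    rw [mul_assoc z z i, hiz, mul_neg, ← mul_assoc z i z, hiz, neg_mul, neg_neg, mul_assoc]
  obtain ⟨r, s, hrs⟩ := exists_of_commute (P := P) hi hzz
  -- `z²` commutes with `z`, whereas `i` anticommutes with it, so `z²` has no `i`-component.
  have hs : s • i = 0 := by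
    have h3 : z * (z * z) = z * z * z := (mul_assoc _ _ _).symm
    rw [hrs, mul_add, add_mul, Algebra.commutes r z, add_right_inj, mul_smul_comm, hiz,
      smul_mul_assoc] at h3
    have h4 : (2 : T) * (s • i * z) = 0 := by
      rw [two_mul, smul_mul_assoc]
      nth_rewrite 1 [← h3]
      rw [smul_neg]
      abel
    exact (mul_eq_zero.1 ((mul_eq_zero.1 h4).resolve_left h2)).resolve_right hz
  rw [hs, add_zero] at hrs
  -- If `z²` were a square in `P`, `z` would lie in `P` and commute with `i`. So `z² = -q²`, and
  -- `z/q` is the required unit.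
  obtain ⟨q, hq | hq⟩ := exists_sq_or_neg_sq r
  · exfalso
    rw [hq] at hrs
    obtain ⟨t, rfl⟩ := eq_algebraMap_of_sq hrs
    rw [Algebra.commutes t i] at hiz
    have h4 : (2 : T) * (i * algebraMap P T t) = 0 := by
      rw [two_mul]
      nth_rewrite 1 [hiz]
      abel
    exact (mul_ne_zero hi0 hz) ((mul_eq_zero.1 h4).resolve_left h2)
  · have hq0 : q ≠ 0 := by
      rintro rfl
      rw [hq] at hrs
      simp at hrs
      exact hz hrs
    refine ⟨q⁻¹ • z, ?_, ?_⟩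
    · rw [smul_mul_smul_comm, hrs, hq, map_neg, smul_neg, inv_mul_inv_smul_sq hq0]
    · rw [smul_mul_assoc, hiz, mul_smul_comm, smul_neg]

theorem quaternion_eq_zero {x : Quaternion P} (h : Quaternion.normSq x = 0) : x = 0 := by
  rw [Quaternion.normSq_def'] at h
  obtain ⟨p, hp⟩ := exists_sq_eq_sq_add_sq x.re x.imI
  obtain ⟨q, hq⟩ := exists_sq_eq_sq_add_sq x.imJ x.imK
  have h1 : p ^ 2 + q ^ 2 = 0 := by rw [← hp, ← hq, ← add_assoc]; exact h
  have h2 := eq_zero_of_sq_add_sq h1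
  have h3 : q = 0 := eq_zero_of_sq_add_sq (b := p) (by linear_combination h1)
  rw [h2] at hp
  rw [h3] at hq
  refine Quaternion.ext _ _ ?_ ?_ ?_ ?_
  · exact eq_zero_of_sq_add_sq (b := x.imI) (by linear_combination hp)
  · exact eq_zero_of_sq_add_sq (b := x.re) (by linear_combination hp)
  · exact eq_zero_of_sq_add_sq (b := x.imK) (by linear_combination hq)
  · exact eq_zero_of_sq_add_sq (b := x.imJ) (by linear_combination hq)

theorem exists_quaternion_units : ∃ x y : Quaternion P, (x.re = 0 ∧ x.imI = 1 ∧ x.imJ = 0 ∧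
    x.imK = 0) ∧ y.re = 0 ∧ y.imI = 0 ∧ y.imJ = 1 ∧ y.imK = 0 :=
  ⟨⟨0, 1, 0, 0⟩, ⟨0, 0, 1, 0⟩, ⟨rfl, rfl, rfl, rfl⟩, rfl, rfl, rfl, rfl⟩

theorem exists_quaternion_not_commute : ∃ x y : Quaternion P, x * y ≠ y * x := by
  obtain ⟨x, y, ⟨h1, h2, h3, h4⟩, h5, h6, h7, h8⟩ := exists_quaternion_units (P := P)
  refine ⟨x, y, fun h => ?_⟩
  have h9 := congrArg QuaternionAlgebra.imK h
  rw [Quaternion.imK_mul, Quaternion.imK_mul, h1, h2, h3, h4, h5, h6, h7, h8] at h9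
  exact two_ne_zero (α := P) (by linear_combination h9)

theorem star_eq_of_central {q : Quaternion P} (hq : ∀ x, q * x = x * q) : star q = q := by
  obtain ⟨x, y, ⟨h1, h2', h3, h4⟩, h5, h6, h7, h8⟩ := exists_quaternion_units (P := P)
  have hx := congrArg QuaternionAlgebra.imK (hq x)
  have hx2 := congrArg QuaternionAlgebra.imJ (hq x)
  have hy := congrArg QuaternionAlgebra.imK (hq y)
  rw [Quaternion.imK_mul, Quaternion.imK_mul, h1, h2', h3, h4] at hx
  rw [Quaternion.imJ_mul, Quaternion.imJ_mul, h1, h2', h3, h4] at hx2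
  rw [Quaternion.imK_mul, Quaternion.imK_mul, h5, h6, h7, h8] at hy
  refine Quaternion.ext _ _ (Quaternion.re_star _) ?_ ?_ ?_
  · rw [Quaternion.imI_star]
    linear_combination -hy
  · rw [Quaternion.imJ_star]
    linear_combination hx
  · rw [Quaternion.imK_star]
    linear_combination -hx2

/-- Frobenius' theorem. -/
theorem exists_quaternion_equiv [Module.Finite P T] {i y : T} (hi : i * i = -1)
    (hy : i * y ≠ y * i) : Nonempty (T ≃ₐ[P] Quaternion P) := by
  obtain ⟨j, hj, hji⟩ := exists_j (P := P) hi hy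
  let b : QuaternionAlgebra.Basis T (-1 : P) 0 (-1 : P) :=
    { i := i
      j := j
      k := i * j
      i_mul_i := by simpa using hi
      j_mul_j := by simpa using hj
      i_mul_j := rfl
      j_mul_i := by simpa using hji }
  let φ : Quaternion P →ₐ[P] T := b.liftHom
  have hφ : ∀ a b c d : P, φ (⟨a, b, c, d⟩ : Quaternion P) =
      algebraMap P T a + b • i + c • j + d • (i * j) := fun a b c d => rfl
  refine ⟨(AlgEquiv.ofBijective φ ⟨?_, fun t => ?_⟩).symm⟩
  · rw [injective_iff_map_eq_zero]
    intro x hx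
    refine quaternion_eq_zero ((map_eq_zero_iff _ (algebraMap P T).injective).1 ?_)
    -- An element of the kernel has its norm in the kernel, and the norm is a scalar.
    have h0 : φ ((Quaternion.normSq x : P) : Quaternion P) = 0 := by
      rw [← Quaternion.star_mul_self, map_mul, hx, mul_zero]
    exact (φ.commutes _).symm.trans h0
  · have h2 : (2 : P) ≠ 0 := two_ne_zero
    -- `2t` is the sum of `t - i t i`, which commutes with `i`, and `t + i t i`, which does so after
    -- multiplication by `j`. Both are described by the centralizer `P(i)`.
    have hc : ∀ t : T, i * (t - i * t * i) = (t - i * t * i) * i := fun t => by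
      rw [mul_sub, sub_mul, mul_assoc _ i i, hi, ← mul_assoc i, ← mul_assoc i, hi]
      simp
      abel
    have hd : ∀ t : T, i * ((t + i * t * i) * j) = (t + i * t * i) * j * i := fun t => by
      rw [mul_assoc _ j i, hji, mul_neg, ← mul_assoc, ← mul_assoc, ← neg_mul]
      congr 1
      rw [mul_add, add_mul, mul_assoc _ i i, hi, ← mul_assoc i, ← mul_assoc i, hi]
      simp
    obtain ⟨r, s, h⟩ := exists_of_commute (P := P) hi (hc t)
    obtain ⟨r', s', h'⟩ := exists_of_commute (P := P) hi (hd t)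
    have h'' : t + i * t * i = -(r' • j + s' • (i * j)) := by
      have : (t + i * t * i) * j * j = (algebraMap P T r' + s' • i) * j := by rw [h']
      rw [mul_assoc _ j j, hj, mul_neg_one, add_mul (algebraMap P T r'), smul_mul_assoc,
        ← Algebra.smul_def] at this
      rw [← this, neg_neg]
    have h3 : (2 : P) • t = (algebraMap P T r + s • i) + -(r' • j + s' • (i * j)) := by
      rw [← h, ← h'', two_smul]
      abel
    refine ⟨_, (hφ (2⁻¹ * r) (2⁻¹ * s) (-(2⁻¹ * r')) (-(2⁻¹ * s'))).trans ?_⟩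
    have h4 : t = (2 : P)⁻¹ • (2 : P) • t := by rw [smul_smul, inv_mul_cancel₀ h2, one_smul]
    rw [h4, h3]
    simp only [Algebra.algebraMap_eq_smul_one, smul_add, smul_neg, smul_smul, neg_smul, neg_add]
    abel

/-! ### Involutions -/

variable [StarRing P] [StarRing T] [StarModule P T]

theorem star_algebraMap_eq (r : P) : star (algebraMap P T r) = algebraMap P T r := by
  rw [Algebra.algebraMap_eq_smul_one, star_smul, star_one, star_eq_of_isRealClosed]

/-! ### Involutions whose selfadjoint elements all lie in `P` -/

section Positive

theorem exists_star_mul_mul_eq_one_or_neg_one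
    (hP : ∀ a : T, star a = a → ∃ r, a = algebraMap P T r) (a : T) (ha : star a = a)
    (ha0 : a ≠ 0) : ∃ y, star y * a * y = 1 ∨ star y * a * y = -1 := by
  obtain ⟨r, rfl⟩ := hP a ha
  obtain ⟨q, hq⟩ := exists_sq_or_neg_sq r
  have hq0 : q ≠ 0 := by
    rintro rfl
    rcases hq with h | h <;> simp [h] at ha0
  refine ⟨algebraMap P T q⁻¹, ?_⟩
  rw [star_algebraMap_eq, ← map_mul, ← map_mul, ← map_one (algebraMap P T), ← map_neg]
  refine hq.imp (fun h => ?_) (fun h => ?_) <;> rw [h] <;> congr 1 <;> field_simp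

/-- Write `x = h + s` with `h` in `P` and `s` skew. Then `s²` is selfadjoint, hence in `P`, and `s²
= -q²`, so `x x̄ = h² + q²` is a square that vanishes only with `x`. -/
theorem mul_star_eq_sq (hP : ∀ a : T, star a = a → ∃ r, a = algebraMap P T r) (x : T) :
    ∃ q : P, x * star x = algebraMap P T (q ^ 2) ∧ (q = 0 → x = 0) := by
  have h2 : (2 : P) ≠ 0 := two_ne_zero
  obtain ⟨h, hh⟩ := hP ((2 : P)⁻¹ • (x + star x)) (by
    rw [star_smul, star_add, star_star, star_eq_of_isRealClosed, add_comm])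
  obtain ⟨s, hs⟩ : ∃ s, s = (2 : P)⁻¹ • (x - star x) := ⟨_, rfl⟩
  have hss : star s = -s := by
    rw [hs, star_smul, star_sub, star_star, star_eq_of_isRealClosed, ← smul_neg, neg_sub]
  have hx : x = algebraMap P T h + s := by
    rw [← hh, hs, ← smul_add, add_add_sub_cancel, ← two_smul P x, smul_smul, inv_mul_cancel₀ h2,
      one_smul]
  obtain ⟨c, hc⟩ := hP (s * s) (by rw [star_mul, hss, neg_mul_neg])
  obtain ⟨q, hq⟩ : ∃ q : P, c = -q ^ 2 := by
    obtain ⟨q, hq | hq⟩ := exists_sq_or_neg_sq c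
    -- A skew `s` whose square is a square of `P` lies in `P`; the involution fixes `P`, so `s = 0`.
    · rw [hq] at hc
      obtain ⟨t, ht⟩ := eq_algebraMap_of_sq hc
      have hs0 : (2 : P) • s = 0 := by
        rw [two_smul]
        nth_rewrite 1 [ht]
        rw [← star_algebraMap_eq, ← ht, hss, neg_add_cancel]
      have hs0' : s = 0 := (smul_eq_zero.1 hs0).resolve_left h2
      rw [hs0', mul_zero, ← hq, eq_comm, map_eq_zero_iff _ (algebraMap P T).injective] at hc
      exact ⟨0, by simp [hc]⟩
    · exact ⟨q, hq⟩
  obtain ⟨w, hw⟩ := exists_sq_eq_sq_add_sq h q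
  refine ⟨w, ?_, ?_⟩
  · rw [← hw, hx, star_add, star_algebraMap_eq, hss, mul_add, add_mul, add_mul, mul_neg, mul_neg,
      hc, hq, Algebra.commutes h s, ← map_mul]
    simp only [map_add, map_neg, map_mul, sq]
    abel
  · rintro rfl
    have h0 : h = 0 := eq_zero_of_sq_add_sq (b := q) (by linear_combination hw)
    have q0 : q = 0 := eq_zero_of_sq_add_sq (b := h) (by linear_combination hw)
    have s0 : s = 0 := by
      rw [hq, q0] at hc
      simpa using hc
    rw [hx, h0, s0, map_zero, add_zero]

theorem exists_sum_eq_algebraMap_sq (hP : ∀ a : T, star a = a → ∃ r, a = algebraMap P T r)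
    {ι : Type*} (x : ι → T) (s : Finset ι) :
    ∃ q : P, ∑ i ∈ s, x i * star (x i) = algebraMap P T (q ^ 2) ∧
      (q = 0 → ∀ i ∈ s, x i = 0) := by
  classical
  induction s using Finset.induction_on with
  | empty => exact ⟨0, by simp⟩
  | insert i s hi ih =>
    obtain ⟨q, hq, h⟩ := ih
    obtain ⟨p, hp, h'⟩ := mul_star_eq_sq hP (x i)
    obtain ⟨w, hw⟩ := exists_sq_eq_sq_add_sq p q
    refine ⟨w, by rw [Finset.sum_insert hi, hq, hp, ← map_add, hw], ?_⟩
    rintro rfl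
    have p0 : p = 0 := eq_zero_of_sq_add_sq (b := q) (by linear_combination hw)
    have q0 : q = 0 := eq_zero_of_sq_add_sq (b := p) (by linear_combination hw)
    simpa using ⟨h' p0, h q0⟩

theorem eq_zero_of_sum_mul_star (hP : ∀ a : T, star a = a → ∃ r, a = algebraMap P T r)
    {ι : Type*} [Fintype ι] (x : ι → T) (hx : ∑ i, x i * star (x i) = 0) (i : ι) : x i = 0 := by
  obtain ⟨q, hq, h⟩ := exists_sum_eq_algebraMap_sq hP x Finset.univ
  rw [hx, eq_comm, map_eq_zero_iff _ (algebraMap P T).injective] at hq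
  exact h (by simpa using hq) i (Finset.mem_univ i)

end Positive

/-- The involution has a fixed element outside of `P`. -/
theorem exists_star_mul_mul_eq_one [Module.Finite P T] {h : T} (hh : star h = h)
    (hP : ∀ r, h ≠ algebraMap P T r) (a : T) (ha : star a = a) (ha0 : a ≠ 0) :
    ∃ y, star y * a * y = 1 := by
  have key : ∀ z : T, star z = z → z * z = a → ∃ y, star y * a * y = 1 := by
    intro z hz hza
    have hz0 : z ≠ 0 := by rintro rfl; simp [← hza] at ha0
    refine ⟨z⁻¹, ?_⟩
    rw [star_inv₀, hz, ← hza, ← mul_assoc, inv_mul_cancel₀ hz0, one_mul, mul_inv_cancel₀ hz0]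
  -- The imaginary unit generated by a selfadjoint element is selfadjoint, so the involution is
  -- trivial on that copy of `P(i)`, where all square roots exist.
  have hstar : ∀ {b : T}, star b = b → (∀ r, b ≠ algebraMap P T r) → ∃ (r s : P) (i : T),
      i * i = -1 ∧ star i = i ∧ b = algebraMap P T r + s • i := by
    intro b hb hbP
    obtain ⟨r, s, i, hi, hi', hb'⟩ := exists_imaginary_unit hbP
    refine ⟨r, s, i, hi, ?_, hb'⟩
    rw [hi', star_smul, star_sub, hb, star_algebraMap_eq, star_eq_of_isRealClosed]
  have main : ∀ (r s : P) (i : T), i * i = -1 → star i = i → a = algebraMap P T r + s • i →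
      ∃ y, star y * a * y = 1 := by
    intro r s i hi hi' h
    obtain ⟨c, d, rfl, rfl⟩ := exists_complex_sqrt r s
    refine key (algebraMap P T c + d • i) ?_ ?_
    · rw [star_add, star_algebraMap_eq, star_smul, hi', star_eq_of_isRealClosed]
    · rw [h, mul_add, add_mul, add_mul, smul_mul_smul_comm, hi]
      simp only [Algebra.algebraMap_eq_smul_one, smul_mul_assoc, mul_smul_comm,
        one_mul, mul_one, smul_smul, sub_smul, two_mul, add_mul, add_smul, sq, smul_neg]
      rw [mul_comm d c]
      abel
  -- An `a` in `P` takes its square root in the copy of `P(i)` generated by `h`, any other `a` in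
  -- the one it generates itself.
  by_cases haP : ∃ r, a = algebraMap P T r
  · obtain ⟨r, hr⟩ := haP
    obtain ⟨-, -, i, hi, hi', -⟩ := hstar hh hP
    exact main r 0 i hi hi' (by rw [hr]; simp)
  · push Not at haP
    obtain ⟨r, s, i, hi, hi', h⟩ := hstar ha haP
    exact main r s i hi hi' h

/-- `h` yields a selfadjoint imaginary unit `i`. If `i` is central, `T = P(i)` with identity
involution. Otherwise `T` is the quaternion algebra, and the standard involution would fix only
scalars. -/
theorem isAlgClosedField_or_isNonstdQuaternion [Module.Finite P T] {h : T} (hh : star h = h)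
    (hP : ∀ r, h ≠ algebraMap P T r) :
    (IsAlgClosedField T ∧ IdInvolution T) ∨ IsNonstdQuaternion P T := by
  obtain ⟨r, s, i, hi, hi', -⟩ := exists_imaginary_unit hP
  have his : star i = i := by
    rw [hi', star_smul, star_sub, hh, star_algebraMap_eq, star_eq_of_isRealClosed]
  by_cases hc : ∀ y, i * y = y * i
  · left
    have hall : ∀ t : T, ∃ r s : P, t = algebraMap P T r + s • i :=
      fun t => exists_of_commute hi (hc t)
    have hfield : IsField T := by
      refine ⟨⟨0, 1, zero_ne_one⟩, fun x y => ?_, fun {x} hx => ⟨x⁻¹, mul_inv_cancel₀ hx⟩⟩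
      obtain ⟨a, b, rfl⟩ := hall x
      rw [add_mul, mul_add, Algebra.commutes, smul_mul_assoc, mul_smul_comm, hc]
    refine ⟨⟨hfield, ?_⟩, fun t => ?_⟩
    · let _ : Field T := hfield.toField
      exact isAlgClosed_of_i (P := P) hi
    · obtain ⟨a, b, rfl⟩ := hall t
      rw [star_add, star_algebraMap_eq, star_smul, his, star_eq_of_isRealClosed]
  · right
    push Not at hc
    obtain ⟨y, hy⟩ := hc
    obtain ⟨e⟩ := exists_quaternion_equiv (P := P) hi hy
    refine ⟨e.toRingEquiv, h, fun heq => ?_⟩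
    rw [hh] at heq
    have h1 : star (e h) = e h := heq.symm
    rw [Quaternion.star_eq_self] at h1
    refine hP (e h).re (e.injective ?_)
    exact h1.trans (e.commutes _).symm

/-- An algebraically closed `T` with identity involution has a selfadjoint square root of `-1`,
which cannot lie in `P`. On quaternions the hypothesis forces the standard involution: a skew
element has its square in `P`, so its image is pure or real. -/
theorem not_isAlgClosedField_or_isNonstdQuaternion
    (hP : ∀ a : T, star a = a → ∃ r, a = algebraMap P T r) :
    ¬ ((IsAlgClosedField T ∧ IdInvolution T) ∨ IsNonstdQuaternion P T) := by
  have h2 : (2 : P) ≠ 0 := two_ne_zero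
  rintro (⟨⟨hf, hac⟩, hid⟩ | ⟨e, t, ht⟩)
  · obtain ⟨i, hi⟩ : ∃ i : T, i * i = -1 := by
      let _ : Field T := hf.toField
      obtain ⟨i, hi⟩ := IsAlgClosed.exists_pow_nat_eq (-1 : T) (n := 2) (by norm_num)
      exact ⟨i, by rw [← sq]; exact hi⟩
    obtain ⟨r, hr⟩ := hP i (hid i)
    exact algebraMap_ne_i hi r hr
  · refine ht ?_
    -- `e` is only a ring isomorphism, so scalars are recognized in the quaternions by being
    -- central.
    have hcentP : ∀ (r : P) (x : Quaternion P),
        e (algebraMap P T r) * x = x * e (algebraMap P T r) := fun r x => by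
      rw [← e.apply_symm_apply x, ← map_mul, ← map_mul, Algebra.commutes]
    obtain ⟨h, hh⟩ := hP ((2 : P)⁻¹ • (t + star t)) (by
      rw [star_smul, star_add, star_star, star_eq_of_isRealClosed, add_comm])
    obtain ⟨s, hs⟩ : ∃ s, s = (2 : P)⁻¹ • (t - star t) := ⟨_, rfl⟩
    have hss : star s = -s := by
      rw [hs, star_smul, star_sub, star_star, star_eq_of_isRealClosed, ← smul_neg, neg_sub]
    have hx : t = algebraMap P T h + s := by
      rw [← hh, hs, ← smul_add, add_add_sub_cancel, ← two_smul P t, smul_smul, inv_mul_cancel₀ h2,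
        one_smul]
    obtain ⟨c, hc⟩ := hP (s * s) (by rw [star_mul, hss, neg_mul_neg])
    have hse : star (e s) = -e s := by
      have h1 : star (e s * e s) = e s * e s := by
        rw [← map_mul, hc]
        exact star_eq_of_central (hcentP c)
      have hI := congrArg QuaternionAlgebra.imI h1
      have hJ := congrArg QuaternionAlgebra.imJ h1
      have hK := congrArg QuaternionAlgebra.imK h1
      rw [Quaternion.imI_star, Quaternion.imI_mul] at hI
      rw [Quaternion.imJ_star, Quaternion.imJ_mul] at hJ
      rw [Quaternion.imK_star, Quaternion.imK_mul] at hK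
      by_cases hre : (e s).re = 0
      · refine Quaternion.ext _ _ ?_ ?_ ?_ ?_ <;> simp [hre]
      · exfalso
        -- A skew `s` with real nonzero image is central. Multiplying any skew `u` by it gives a
        -- selfadjoint element, so all skew elements are central and `T` would be commutative.
        have hreal : star (e s) = e s := by
          refine Quaternion.ext _ _ (Quaternion.re_star _) ?_ ?_ ?_
          · rw [Quaternion.imI_star]
            exact mul_left_cancel₀ (mul_ne_zero h2 hre) (by linear_combination hI)
          · rw [Quaternion.imJ_star]
            exact mul_left_cancel₀ (mul_ne_zero h2 hre) (by linear_combination hJ)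
          · rw [Quaternion.imK_star]
            exact mul_left_cancel₀ (mul_ne_zero h2 hre) (by linear_combination hK)
        rw [Quaternion.star_eq_self] at hreal
        have hs0 : s ≠ 0 := by
          rintro rfl
          rw [map_zero] at hre
          exact hre rfl
        have hsc : ∀ b, s * b = b * s := fun b => e.injective (by
          rw [map_mul, map_mul, hreal]
          exact Algebra.commutes (e s).re (e b))
        have hskew : ∀ u : T, star u = -u → ∀ b, u * b = b * u := by
          intro u hu b
          obtain ⟨r, hr⟩ := hP (s * u) (by rw [star_mul, hu, hss, neg_mul_neg, hsc])
          refine mul_left_cancel₀ hs0 ?_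
          rw [← mul_assoc, hr, Algebra.commutes, ← hr, ← mul_assoc, ← hsc, mul_assoc]
        have hcomm : ∀ a b : T, a * b = b * a := by
          intro a b
          obtain ⟨r, hr⟩ := hP (a + star a) (by rw [star_add, star_star, add_comm])
          have h5 := hskew (a - star a) (by rw [star_sub, star_star, neg_sub]) b
          have h6 : (2 : P) • a = algebraMap P T r + (a - star a) := by
            rw [← hr, two_smul]
            abel
          have h7 : (2 : P) • (a * b) = (2 : P) • (b * a) := by
            rw [← smul_mul_assoc, ← mul_smul_comm, h6, add_mul, mul_add, h5, Algebra.commutes]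
          exact (smul_right_injective T h2) h7
        obtain ⟨x, y, hxy⟩ := exists_quaternion_not_commute (P := P)
        exact hxy (e.symm.injective (by rw [map_mul, map_mul, hcomm]))
    rw [hx, star_add, star_algebraMap_eq, hss, map_add, map_add, star_add, hse,
      star_eq_of_central (hcentP h), map_neg]

end DivisionAlgebra

/-! ## Algebraically closed fields with involution -/

section AlgClosed

variable {P : Type*} [Field P] [IsAlgClosed P] [StarRing P]

/-- Suppose `ī = i`. For `t² = c - c̄` the conjugate of `t` is `±i t`, and conjugating again gives
`t = -t`. So `c = c̄` for all `c`. -/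
theorem star_i_eq_neg (h2 : (2 : P) ≠ 0) (hne : ¬ IdInvolution P) {i : P} (hi : i * i = -1) :
    star i = -i := by
  have hsi : star i * star i = -1 := by rw [← star_mul, hi, star_neg, star_one]
  have h0 : (star i - i) * (star i + i) = 0 := by linear_combination hsi - hi
  refine (mul_eq_zero.1 h0).elim (fun h => ?_) eq_neg_of_add_eq_zero_left
  exfalso
  have hi' : star i = i := sub_eq_zero.1 h
  simp only [IdInvolution, not_forall] at hne
  obtain ⟨c, hc⟩ := hne
  obtain ⟨t, ht⟩ := IsAlgClosed.exists_pow_nat_eq (c - star c) (n := 2) (by norm_num)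
  have hst : star t ^ 2 = -t ^ 2 := by rw [← star_pow, ht, star_sub, star_star]; ring
  have h1 : (star t - i * t) * (star t + i * t) = 0 := by linear_combination hst - t ^ 2 * hi
  have h3 : t = -t := by
    rcases mul_eq_zero.1 h1 with h | h
    · have h4 : star t = i * t := sub_eq_zero.1 h
      have h5 := congrArg star h4
      rw [star_star, star_mul, hi', h4] at h5
      linear_combination h5 + t * hi
    · have h4 : star t = -(i * t) := eq_neg_of_add_eq_zero_left h
      have h5 := congrArg star h4
      rw [star_star, star_neg, star_mul, hi', h4] at h5
      linear_combination h5 + t * hi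
  have h4 : t = 0 := (mul_eq_zero.1 (show 2 * t = 0 by linear_combination h3)).resolve_left h2
  rw [h4] at ht
  exact hc (sub_eq_zero.1 (by simpa using ht.symm)).symm

/-- A sum of two norms is a norm. -/
theorem exists_norm_add_norm (h2 : (2 : P) ≠ 0) (hne : ¬ IdInvolution P) (x y : P) :
    ∃ w, x * star x + y * star y = w * star w ∧ (w = 0 → x = 0 ∧ y = 0) := by
  obtain ⟨i, hi⟩ := IsAlgClosed.exists_pow_nat_eq (-1 : P) (n := 2) (by norm_num)
  rw [sq] at hi
  have hsi := star_i_eq_neg h2 hne hi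
  -- If `x = z²`, then `x x̄` is the square of the selfadjoint `z z̄`. A sum of two such squares `a²
  -- + b²` is the norm of `a + i b` because `ī = -i`.
  have key : ∀ x : P, ∃ a, star a = a ∧ x * star x = a ^ 2 := by
    intro x
    obtain ⟨z, hz⟩ := IsAlgClosed.exists_pow_nat_eq x (n := 2) (by norm_num)
    refine ⟨z * star z, by rw [star_mul, star_star], ?_⟩
    rw [← hz, star_pow]
    ring
  obtain ⟨a, ha, hxa⟩ := key x
  obtain ⟨b, hb, hyb⟩ := key y
  have hi0 : i ≠ 0 := by rintro rfl; simp at hi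
  have hab : a + i * b = 0 → a = 0 ∧ b = 0 := fun h => by
    have h1 := congrArg star h
    rw [star_add, star_mul, ha, hb, hsi, star_zero] at h1
    have ha0 : a = 0 :=
      (mul_eq_zero.1 (show 2 * a = 0 by linear_combination h + h1)).resolve_left h2
    rw [ha0, zero_add] at h
    exact ⟨ha0, (mul_eq_zero.1 h).resolve_left hi0⟩
  have hnorm : ∀ {x a : P}, x * star x = a ^ 2 → a = 0 → x = 0 := by
    rintro x a h rfl
    simpa using h
  refine ⟨a + i * b, ?_, fun h => ⟨hnorm hxa (hab h).1, hnorm hyb (hab h).2⟩⟩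
  rw [star_add, star_mul, ha, hb, hsi, hxa, hyb]
  linear_combination b ^ 2 * hi

theorem exists_sum_eq_norm (h2 : (2 : P) ≠ 0) (hne : ¬ IdInvolution P) {ι : Type*} (x : ι → P)
    (s : Finset ι) :
    ∃ w, ∑ i ∈ s, x i * star (x i) = w * star w ∧ (w = 0 → ∀ i ∈ s, x i = 0) := by
  classical
  induction s using Finset.induction_on with
  | empty => exact ⟨0, by simp⟩
  | insert i s hi ih =>
    obtain ⟨q, hq, h⟩ := ih
    obtain ⟨w, hw, hw'⟩ := exists_norm_add_norm h2 hne (x i) q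
    refine ⟨w, by rw [Finset.sum_insert hi, hq, hw], fun h0 => ?_⟩
    simpa using ⟨(hw' h0).1, h (hw' h0).2⟩

variable {T : Type*} [Ring T] [IsDomain T] [Algebra P T] [Module.Finite P T] [StarRing T]
  [StarModule P T]

/-- A finite-dimensional algebra without zero divisors over an algebraically closed field is the
field itself. -/
theorem exists_algebraMap_eq (t : T) : ∃ r, t = algebraMap P T r := by
  obtain ⟨r, hr⟩ := (IsAlgClosed.algebraMap_bijective_of_isIntegral (k := P) (K := T)).2 t
  exact ⟨r, hr.symm⟩

theorem star_algebraMap' (r : P) : star (algebraMap P T r) = algebraMap P T (star r) := by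
  rw [Algebra.algebraMap_eq_smul_one, star_smul, star_one, Algebra.algebraMap_eq_smul_one]

/-- Identity involution. -/
theorem exists_star_mul_mul_eq_one_of_isAlgClosed (hid : IdInvolution P) (a : T) (ha0 : a ≠ 0) :
    ∃ y, star y * a * y = 1 := by
  obtain ⟨r, rfl⟩ := exists_algebraMap_eq (P := P) a
  obtain ⟨q, hq⟩ := IsAlgClosed.exists_pow_nat_eq r (n := 2) (by norm_num)
  have hq0 : q ≠ 0 := by
    rintro rfl
    simp [← hq] at ha0
  refine ⟨algebraMap P T q⁻¹, ?_⟩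
  rw [star_algebraMap', hid, ← map_mul, ← map_mul, ← map_one (algebraMap P T), ← hq]
  congr 1
  field_simp

/-- Nonidentity involution. -/
theorem exists_star_mul_mul_eq_one_or_neg_one_of_isAlgClosed (P : Type*) [Field P]
    [IsAlgClosed P] [StarRing P] {T : Type*} [Ring T] [IsDomain T] [Algebra P T]
    [Module.Finite P T] [StarRing T] [StarModule P T] (a : T) (ha : star a = a) (ha0 : a ≠ 0) :
    ∃ y, star y * a * y = 1 ∨ star y * a * y = -1 := by
  obtain ⟨r, rfl⟩ := exists_algebraMap_eq (P := P) a
  rw [star_algebraMap'] at ha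
  have hr : star r = r := (algebraMap P T).injective ha
  obtain ⟨q, hq⟩ := IsAlgClosed.exists_pow_nat_eq r (n := 2) (by norm_num)
  have hq0 : q ≠ 0 := by
    rintro rfl
    simp [← hq] at ha0
  -- `q² = r` is selfadjoint, so `q̄ = ±q`; scaling `r` by `q⁻¹` gives this sign.
  have h0 : (star q - q) * (star q + q) = 0 := by
    have : star q ^ 2 = q ^ 2 := by rw [← star_pow, hq, hr]
    linear_combination this
  refine ⟨algebraMap P T q⁻¹, ?_⟩
  rw [star_algebraMap', star_inv₀, ← map_mul, ← map_mul, ← map_one (algebraMap P T), ← map_neg,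
    ← hq]
  refine (mul_eq_zero.1 h0).imp (fun h => ?_) (fun h => ?_)
  · rw [sub_eq_zero.1 h]
    congr 1
    field_simp
  · rw [eq_neg_of_add_eq_zero_left h]
    congr 1
    field_simp

theorem eq_zero_of_sum_mul_star_of_isAlgClosed (h2 : (2 : P) ≠ 0) (hne : ¬ IdInvolution P)
    {ι : Type*} [Fintype ι] (x : ι → T) (hx : ∑ i, x i * star (x i) = 0) (i : ι) : x i = 0 := by
  choose r hr using fun i => exists_algebraMap_eq (P := P) (x i)
  obtain ⟨w, hw, h⟩ := exists_sum_eq_norm h2 hne r Finset.univ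
  have h1 : algebraMap P T (∑ i, r i * star (r i)) = 0 := by
    rw [map_sum, ← hx]
    refine Finset.sum_congr rfl fun i _ => ?_
    rw [map_mul, ← star_algebraMap', ← hr]
  rw [map_eq_zero_iff _ (algebraMap P T).injective, hw] at h1
  rw [hr, h (by simpa using h1) i (Finset.mem_univ i), map_zero]

end AlgClosed

/-! ## Finite fields with involution -/

section FiniteField

open Polynomial

theorem card_mod_two {F : Type*} [Field F] [Fintype F] (h2 : (2 : F) ≠ 0) :
    Fintype.card F % 2 = 1 := by
  refine FiniteField.odd_card_of_char_ne_two fun h => h2 ?_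
  have := ringChar.spec F 2
  rw [h] at this
  exact_mod_cast this.2 dvd_rfl

/-- The values of `a x²` and of `c - b y²` are too numerous to be disjoint. -/
theorem exists_sq_add_mul_sq {F : Type*} [Field F] [Finite F] (h2 : (2 : F) ≠ 0) {a b : F}
    (ha : a ≠ 0) (hb : b ≠ 0) (c : F) : ∃ x y, a * x ^ 2 + b * y ^ 2 = c := by
  let _ := Fintype.ofFinite F
  obtain ⟨x, y, h⟩ := FiniteField.exists_root_sum_quadratic (f := C a * X ^ 2 - C c)
    (g := C b * X ^ 2) (by
      rw [degree_sub_eq_left_of_degree_lt, degree_C_mul_X_pow _ ha]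
      · rfl
      · rw [degree_C_mul_X_pow _ ha]
        exact degree_C_le.trans_lt (by norm_num))
    (by rw [degree_C_mul_X_pow _ hb]; rfl) (card_mod_two h2)
  refine ⟨x, y, ?_⟩
  simp at h
  linear_combination h

variable {T : Type*} [Field T] [Finite T]

theorem isSquare_mul_of_not {a b : T} (ha : ¬ IsSquare a)
    (hb : ¬ IsSquare b) : IsSquare (a * b) := by
  classical
  let _ := Fintype.ofFinite T
  have ha0 : a ≠ 0 := by rintro rfl; exact ha IsSquare.zero
  have hb0 : b ≠ 0 := by rintro rfl; exact hb IsSquare.zero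
  rw [← quadraticChar_one_iff_isSquare (mul_ne_zero ha0 hb0), map_mul,
    quadraticChar_neg_one_iff_not_isSquare.2 ha, quadraticChar_neg_one_iff_not_isSquare.2 hb]
  norm_num

/-- Identity involution. -/
theorem exists_mul_mul_eq_one_or_nonsq {ε : T} (hε : ¬ IsSquare ε) {a : T}
    (ha0 : a ≠ 0) : ∃ y, y * a * y = 1 ∨ y * a * y = ε := by
  by_cases ha : IsSquare a
  · obtain ⟨z, rfl⟩ := ha
    have hz : z ≠ 0 := by rintro rfl; simp at ha0
    exact ⟨z⁻¹, Or.inl (by field_simp)⟩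
  · obtain ⟨z, hz⟩ := isSquare_mul_of_not ha hε
    have hε0 : ε ≠ 0 := by rintro rfl; exact hε IsSquare.zero
    have hz0 : z ≠ 0 := by rintro rfl; simp [ha0, hε0] at hz
    -- Since `a ε = z²`, this gives `ε² a / z² = ε`.
    refine ⟨ε * z⁻¹, Or.inr ?_⟩
    field_simp
    linear_combination hz

variable [StarRing T]

/-- With `s` skew, the norm of `x + y s` for selfadjoint `x, y` is `x² - s² y²`, a binary form over
the finite fixed field. It represents every fixed element, in particular `a⁻¹`. -/
theorem exists_star_mul_mul_eq_one_of_finite (h2 : (2 : T) ≠ 0) (hne : ¬ IdInvolution T) (a : T)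
    (ha : star a = a) (ha0 : a ≠ 0) : ∃ y, star y * a * y = 1 := by
  simp only [IdInvolution, not_forall] at hne
  obtain ⟨c, hc⟩ := hne
  obtain ⟨s, hs⟩ : ∃ s, s = c - star c := ⟨_, rfl⟩
  have hss : star s = -s := by rw [hs, star_sub, star_star, neg_sub]
  have hs0 : s ≠ 0 := by rw [hs]; exact sub_ne_zero.2 (Ne.symm hc)
  have hd : -(s * s) ∈ selfAdjoint T := by
    rw [selfAdjoint.mem_iff, star_neg, star_mul, hss, neg_mul_neg]
  have h2' : (2 : selfAdjoint T) ≠ 0 := fun h => h2 (congrArg Subtype.val h)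
  obtain ⟨x, y, h⟩ := exists_sq_add_mul_sq h2' (a := (1 : selfAdjoint T)) (b := ⟨_, hd⟩)
    one_ne_zero (fun h => by
      have := congrArg Subtype.val h
      simp [hs0] at this) (⟨a, ha⟩⁻¹)
  have hxy : (x : T) ^ 2 + -(s * s) * (y : T) ^ 2 = a⁻¹ := by
    have := congrArg Subtype.val h
    simpa using this
  have hx : star (x : T) = x := x.2
  have hy : star (y : T) = y := y.2
  refine ⟨x + y * s, ?_⟩
  rw [star_add, star_mul, hx, hy, hss]
  have : (↑x + -s * ↑y) * a * (↑x + ↑y * s) = ((x : T) ^ 2 + -(s * s) * (y : T) ^ 2) * a := by ring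
  rw [this, hxy, inv_mul_cancel₀ ha0]

end FiniteField

/-! ## The skew field `T(B)` as an algebra with involution -/

section Reps

variable {P : Type p} [Field P] [StarRing P]
variable {K : Type k} [DivisionRing K] [StarRing K]
variable {C : Type u} [Category.{v} C] [Preadditive C] [Linear P C]
variable [Algebra P K] {J : LinearInvolution P C}

namespace SelfAdjRep

noncomputable instance (B : SelfAdjRep K J) : Algebra P B.T :=
  inferInstanceAs (Algebra P (End B.functor ⧸ Ring.jacobson (End B.functor)))

theorem toT_smul (B : SelfAdjRep K J) (r : P) (f : End B.functor) : B.toT (r • f) = r • B.toT f :=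
  rfl

instance [Module.Finite P K] (B : SelfAdjRep K J) : Module.Finite P B.T :=
  Module.Finite.of_surjective
    ({ toFun := B.toT
       map_add' := fun f g => map_add B.toT f g
       map_smul' := fun r f => B.toT_smul r f } : End B.functor →ₗ[P] B.T)
    fun t => Quotient.inductionOn' t fun f => ⟨f, rfl⟩

theorem adjoint_smul [StarModule P K] {A B : SelfAdjRep K J} (r : P) (f : A.functor ⟶ B.functor) :
    adjoint (A := A) (B := B) (r • f) = star r • adjoint (A := A) (B := B) f := by
  refine hom_ext fun a x y => ?_
  rw [pair_adjoint]
  have h1 : (r • f).app (J.obj a) y = op (algebraMap P K r) • f.app (J.obj a) y := rfl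
  have h3 : (star r • adjoint (A := A) (B := B) f).app a x =
    op (algebraMap P K (star r)) • (adjoint (A := A) (B := B) f).app a x := rfl
  have h2 : star (algebraMap P K r) = algebraMap P K (star r) := by
    rw [Algebra.algebraMap_eq_smul_one, star_smul, star_one, Algebra.algebraMap_eq_smul_one]
  rw [h1, h3, LinearMap.map_smulₛₗ, starOp_apply, unop_op, h2, map_smul, LinearMap.smul_apply,
    pair_adjoint, smul_eq_mul]
  exact Algebra.commutes _ _

instance [StarModule P K] (B : SelfAdjRep K J) : StarModule P B.T where
  star_smul r t := by
    obtain ⟨f, rfl⟩ : ∃ f, B.toT f = t := Quotient.inductionOn' t fun f => ⟨f, rfl⟩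
    rw [← toT_smul, star_toT, star_toT, adjoint_smul, toT_smul]

open DagCat in
/-- Two orthogonal copies of a realization of `ε` contain a realization of `t` if the form
`⟨ε, ε⟩` represents `t`. -/
theorem Realizes.exists_isometry_of_two [Module.Finite P K] (h2 : (2 : P) ≠ 0)
    {Z Z' B S : SelfAdjRep K J} {ε t : B.T} (hZ : Realizes Z B ε) (hZ' : Realizes Z' B t)
    {y₁ y₂ : B.T} (hy : star y₁ * ε * y₁ + star y₂ * ε * y₂ = t) {w₁ w₂ : Z ⟶ S}
    (hw₁ : IsIsometry w₁) (hw₂ : IsIsometry w₂) (h : w₁ ≫ dag w₂ = 0) :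
    ∃ z : Z' ⟶ S, IsIsometry z := by
  obtain ⟨τ, hτ⟩ := hZ
  obtain ⟨g₁, rfl⟩ := B.cl_surjective y₁
  obtain ⟨g₂, rfl⟩ := B.cl_surjective y₂
  have h' : w₂ ≫ dag w₁ = 0 := by
    have := congrArg dag h
    rwa [dag_comp, dag_dag, dag_zero] at this
  have e₁ : w₁ ≫ dag w₁ = 𝟙 Z := hw₁
  have e₂ : w₂ ≫ dag w₂ = 𝟙 Z := hw₂
  have main : ∀ (a b : B ⟶ Z), (a ≫ w₁ + b ≫ w₂) ≫ dag (a ≫ w₁ + b ≫ w₂) =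
      a ≫ dag a + b ≫ dag b := by
    intro a b
    have aux : ∀ (a b : B ⟶ Z) (u v : Z ⟶ S) (r : Z ⟶ Z), u ≫ dag v = r →
        (a ≫ u) ≫ dag (b ≫ v) = a ≫ r ≫ dag b := by
      rintro a b u v r rfl
      rw [dag_comp]
      simp
    rw [dag_add, Preadditive.add_comp, Preadditive.comp_add, Preadditive.comp_add,
      aux a a _ _ _ e₁, aux a b _ _ _ h, aux b a _ _ _ h', aux b b _ _ _ e₂]
    simp
  have hcl : ∀ g : B ⟶ B, B.cl ((g ≫ τ.hom) ≫ dag (g ≫ τ.hom)) =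
      star (B.cl g) * ε * B.cl g := by
    intro g
    rw [dag_comp, Category.assoc, ← Category.assoc τ.hom, cl_comp, cl_comp, hτ, cl_dag]
  refine hZ'.exists_isometry h2 ((g₁.asHom ≫ τ.hom) ≫ w₁ + (g₂.asHom ≫ τ.hom) ≫ w₂) ?_
  rw [main]
  refine (map_add B.cl _ _).trans ?_
  rw [hcl, hcl]
  exact hy

end SelfAdjRep

/-! ## Uniqueness -/

section Unique

variable [StarModule P K] [Module.Finite P K] {ind : Set (Rep P K C)} {ind₀ : Set (SelfAdjRep K J)}
  {ind₁ : Set (Rep P K C)} {L : Type*} {X : L → SelfAdjRep K J}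
  {typ : L → ind₁ ⊕ (Σ B : ind₀, B.1.T)}

open Classical in
-- The hypothesis `hU` is symmetric in the two families, so one inequality of counts for diagonal
-- forms suffices.
theorem IsSummandFamily.exists_equiv (hind : IsInd ind)
    (hind₀ : IsInd₀ J ind ind₀) (hind₁ : IsInd₁ J ind ind₁) (hX : IsSummandFamily X typ)
    (Adm : ∀ n : ℕ, (Fin n → L) → Prop)
    (hU : ∀ (n m : ℕ) (l : Fin n → L) (l' : Fin m → L), Adm n l → Adm m l' →
      ∀ (B : ind₀) (I I' : Type) [Fintype I] [Fintype I'] (ι : I → Fin n) (ι' : I' → Fin m)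
        (d : I → B.1.T) (d' : I' → B.1.T) (W : I → I' → B.1.T),
        Function.Injective ι → Function.Injective ι' →
        (∀ i, typ (l (ι i)) = Sum.inr ⟨B, d i⟩) → (∀ j, typ (l' (ι' j)) = Sum.inr ⟨B, d' j⟩) →
        IsGram d d' W → Fintype.card I = Fintype.card I' →
        ∀ t, Fintype.card {i // d i = t} ≤ Fintype.card {j // d' j = t})
    (S : SelfAdjRep K J) (n m : ℕ) (l : Fin n → L) (l' : Fin m → L) (hl : Adm n l)
    (hl' : Adm m l') (h : S.Congruent (SelfAdjRep.orthSum fun i => X (l i)))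
    (h' : S.Congruent (SelfAdjRep.orthSum fun i => X (l' i))) :
    ∃ e : Fin n ≃ Fin m, ∀ i, l i = l' (e i) := by
  obtain ⟨w, hw⟩ := (SelfAdjRep.congruent_orthSum_iff _ _).1 h
  obtain ⟨w', hw'⟩ := (SelfAdjRep.congruent_orthSum_iff _ _).1 h'
  refine exists_equiv_of_card_fiber l l' fun x => le_antisymm ?_ ?_
  · exact hX.card_le hind hind₀ hind₁ hw hw' (fun B d d' W hd hd' hW hc =>
      hU n m l l' hl hl' B _ _ _ _ d d' W Subtype.val_injective Subtype.val_injective hd hd'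
        (by convert hW) hc) x
  · exact hX.card_le hind hind₀ hind₁ hw' hw (fun B d d' W hd hd' hW hc =>
      hU m n l' l hl' hl B _ _ _ _ d d' W Subtype.val_injective Subtype.val_injective hd hd'
        (by convert hW) hc) x

end Unique

/-! ### Counting the coefficients of diagonal forms -/

section Diagonal

variable {T : Type*} [Ring T] [StarRing T] {I I' : Type} [Fintype I] [Fintype I']

open Classical in
theorem card_le_of_forall_eq {d : I → T} {d' : I' → T} {c : T} (hd : ∀ i, d i = c)
    (hd' : ∀ i, d' i = c) (h : Fintype.card I = Fintype.card I') (t : T) :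
    Fintype.card {i // d i = t} ≤ Fintype.card {j // d' j = t} := by
  by_cases ht : t = c
  · subst ht
    rw [Fintype.card_congr (Equiv.subtypeUnivEquiv hd), h,
      Fintype.card_congr (Equiv.subtypeUnivEquiv hd')]
  · have : IsEmpty {i // d i = t} := ⟨fun i => ht (i.2.symm.trans (hd i))⟩
    simp

open Classical in
theorem IsGram.card_le_of_inertia [Nontrivial T] (hT : ∀ t : T, IsUnit t ∨ t = 0)
    (hpos : ∀ {ι : Type} [Fintype ι] (x : ι → T), ∑ i, x i * star (x i) = 0 → ∀ i, x i = 0)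
    {d : I → T} {d' : I' → T} {W : I → I' → T} (hW : IsGram d d' W)
    (hd : ∀ i, d i = 1 ∨ d i = -1) (hd' : ∀ j, d' j = 1 ∨ d' j = -1) (t : T) :
    Fintype.card {i // d i = t} ≤ Fintype.card {j // d' j = t} := by
  by_cases ht : t = 1 ∨ t = -1
  · exact hW.inertia hT hpos t ht hd'
  · have : IsEmpty {i // d i = t} := ⟨fun i => ht (i.2 ▸ hd i)⟩
    simp

end Diagonal

end Reps

/-! ## The centre of `K` -/

section Centre

variable {P : Type*} [Field P] {K : Type*} [DivisionRing K] [Algebra P K]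

theorem exists_algebraMap_eq_of_central [Algebra.IsCentral P K] {x : K}
    (hx : ∀ y, x * y = y * x) : ∃ r, algebraMap P K r = x := by
  have : x ∈ Subalgebra.center P K := Subalgebra.mem_center_iff.2 fun y => (hx y).symm
  exact Algebra.mem_bot.1 (Algebra.IsCentral.out this)

theorem algebraMap_bijective_of_isField [Algebra.IsCentral P K] (h : IsField K) :
    Function.Bijective (algebraMap P K) :=
  ⟨(algebraMap P K).injective, fun x => exists_algebraMap_eq_of_central (h.mul_comm x)⟩

theorem finite_of_isField [Algebra.IsCentral P K] (h : IsField K) : Module.Finite P K :=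
  Module.Finite.of_surjective (Algebra.linearMap P K) (algebraMap_bijective_of_isField h).2

/-- The isomorphism need not be `P`-linear, but its inverse maps scalars to scalars, so the preimage
of a basis still spans. -/
theorem finite_of_quaternion [Algebra.IsCentral P K] (e : K ≃+* Quaternion P) :
    Module.Finite P K := by
  classical
  have hc : ∀ a : P, ∃ r, algebraMap P K r = e.symm (algebraMap P (Quaternion P) a) := fun a =>
    exists_algebraMap_eq_of_central fun y => e.injective (by
      rw [map_mul, map_mul, e.apply_symm_apply, Algebra.commutes])
  choose σ hσ using hc
  let b := Module.finBasis P (Quaternion P)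
  refine ⟨⟨Finset.univ.image fun n => e.symm (b n), ?_⟩⟩
  rw [eq_top_iff]
  rintro x -
  have hx := congrArg e.symm (b.sum_repr (e x))
  simp only [Algebra.smul_def, map_sum, map_mul, e.symm_apply_apply, ← hσ] at hx
  rw [← hx]
  refine sum_mem fun n _ => ?_
  rw [← Algebra.smul_def]
  exact Submodule.smul_mem _ _ (Submodule.subset_span (by simp))

theorem isRealClosed_of_ringEquiv {F G : Type*} [Field F] [Field G] [IsRealClosed G]
    (e : F ≃+* G) : IsRealClosed F where
  one_add_ne_zero {s} hs h := by
    refine IsSemireal.one_add_ne_zero (R := G) (s := e s) ?_ ?_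
    · clear h
      induction hs with
      | zero => rw [map_zero]; exact IsSumSq.zero
      | sq_add a _ ih =>
        rw [map_add, map_mul]
        exact IsSumSq.sq_add _ ih
    rw [← map_one e, ← map_add, h, map_zero]
  isSquare_or_isSquare_neg x := by
    rcases IsRealClosed.isSquare_or_isSquare_neg (e x) with h | h
    · exact Or.inl (by simpa using h.map e.symm)
    · exact Or.inr (by simpa using h.map e.symm)
  exists_isRoot_of_odd_natDegree {f} hf := by
    obtain ⟨x, hx⟩ := IsRealClosed.exists_isRoot_of_odd_natDegree (f := f.map e.toRingHom)
      (by rwa [Polynomial.natDegree_map_eq_of_injective e.injective])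
    refine ⟨e.symm x, e.injective ?_⟩
    have h1 : e (f.eval (e.symm x)) = (f.map e.toRingHom).eval (e (e.symm x)) :=
      (Polynomial.eval_map_apply e.toRingHom _).symm
    rw [h1, e.apply_symm_apply, map_zero]
    exact hx

theorem isAlgClosed_of_ringEquiv {F G : Type*} [Field F] [Field G] [IsAlgClosed G]
    (e : F ≃+* G) : IsAlgClosed F := by
  refine IsAlgClosed.of_exists_root _ fun f _ hf => ?_
  obtain ⟨x, hx⟩ := IsAlgClosed.exists_eval₂_eq_zero e.toRingHom f hf.degree_pos.ne'
  refine ⟨e.symm x, e.injective ?_⟩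
  have h1 : e (f.eval (e.symm x)) = (f.map e.toRingHom).eval (e (e.symm x)) :=
    (Polynomial.eval_map_apply e.toRingHom _).symm
  rw [h1, e.apply_symm_apply, map_zero, Polynomial.eval_map]
  exact hx

theorem isRealClosed_of_isRealClosedField [Algebra.IsCentral P K] (h : IsRealClosedField K) :
    IsRealClosed P := by
  obtain ⟨hf, hK⟩ := h
  exact @isRealClosed_of_ringEquiv P K _ hf.toField hK
    (RingEquiv.ofBijective (algebraMap P K) (algebraMap_bijective_of_isField hf))

theorem isAlgClosed_of_isAlgClosedField [Algebra.IsCentral P K] (h : IsAlgClosedField K) :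
    IsAlgClosed P := by
  obtain ⟨hf, hK⟩ := h
  exact @isAlgClosed_of_ringEquiv P K _ hf.toField hK
    (RingEquiv.ofBijective (algebraMap P K) (algebraMap_bijective_of_isField hf))

theorem idInvolution_iff [StarRing P] [StarRing K] [StarModule P K]
    (h : Function.Bijective (algebraMap P K)) : IdInvolution P ↔ IdInvolution K := by
  have hs : ∀ r, star (algebraMap P K r) = algebraMap P K (star r) := fun r => by
    rw [Algebra.algebraMap_eq_smul_one, star_smul, star_one, Algebra.algebraMap_eq_smul_one]
  constructor
  · intro hP x
    obtain ⟨r, rfl⟩ := h.2 x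
    rw [hs, hP]
  · intro hK r
    exact h.1 (by rw [← hs, hK])

theorem two_ne_zero_of_algebra (h : (2 : K) ≠ 0) : (2 : P) ≠ 0 := fun h0 => h (by
  rw [← map_ofNat (algebraMap P K) 2, h0, map_zero])

end Centre

section Reps

variable {P : Type p} [Field P] [StarRing P]
variable {K : Type k} [DivisionRing K] [StarRing K]
variable {C : Type u} [Category.{v} C] [Preadditive C] [Linear P C]
variable [Algebra P K] [StarModule P K] {J : LinearInvolution P C}

/-! ## Hermitian forms over `T(B)` -/

namespace SelfAdjRep

variable [Module.Finite P K] {B : SelfAdjRep K J}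

/-- `T(B)` is a skew field. -/
@[reducible] noncomputable def divisionRingT (hB : B.toRep.IsIndec) : DivisionRing B.T :=
  let _ := T_nontrivial hB
  DivisionRing.ofIsUnitOrEqZero (T_isUnit_or_eq_zero hB)

theorem T_two_ne_zero (h2 : (2 : P) ≠ 0) (hB : B.toRep.IsIndec) : (2 : B.T) ≠ 0 := by
  have := T_nontrivial hB
  rw [← map_ofNat (algebraMap P B.T) 2]
  exact (map_ne_zero_iff _ (algebraMap P B.T).injective).2 h2

theorem T_one_ne_neg_one (h2 : (2 : P) ≠ 0) (hB : B.toRep.IsIndec) : (1 : B.T) ≠ -1 := fun h =>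
  T_two_ne_zero h2 hB (by rw [← one_add_one_eq_two]; nth_rewrite 2 [h]; exact add_neg_cancel 1)

theorem T_isAlgClosed_id [IsAlgClosed P] (hid : IdInvolution P) (hB : B.toRep.IsIndec) (a : B.T)
    (ha0 : a ≠ 0) : ∃ y, star y * a * y = 1 :=
  let _ := divisionRingT hB
  exists_star_mul_mul_eq_one_of_isAlgClosed hid a ha0

theorem T_isAlgClosed [IsAlgClosed P] (hB : B.toRep.IsIndec) (a : B.T) (ha : star a = a)
    (ha0 : a ≠ 0) : ∃ y, star y * a * y = 1 ∨ star y * a * y = -1 :=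
  let _ := divisionRingT hB
  exists_star_mul_mul_eq_one_or_neg_one_of_isAlgClosed P a ha ha0

theorem T_isAlgClosed_pos [IsAlgClosed P] (h2 : (2 : P) ≠ 0) (hne : ¬ IdInvolution P)
    (hB : B.toRep.IsIndec) {ι : Type} [Fintype ι] (x : ι → B.T)
    (hx : ∑ i, x i * star (x i) = 0) (i : ι) : x i = 0 :=
  let _ := divisionRingT hB
  eq_zero_of_sum_mul_star_of_isAlgClosed h2 hne x hx i

theorem T_isRealClosed_of_mem [IsRealClosed P] (hB : B.toRep.IsIndec)
    (hP : ∀ a : B.T, star a = a → ∃ r, a = algebraMap P B.T r) (a : B.T) (ha : star a = a)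
    (ha0 : a ≠ 0) : ∃ y, star y * a * y = 1 ∨ star y * a * y = -1 :=
  let _ := divisionRingT hB
  exists_star_mul_mul_eq_one_or_neg_one hP a ha ha0

theorem T_isRealClosed_pos [IsRealClosed P] (hB : B.toRep.IsIndec)
    (hP : ∀ a : B.T, star a = a → ∃ r, a = algebraMap P B.T r) {ι : Type} [Fintype ι]
    (x : ι → B.T) (hx : ∑ i, x i * star (x i) = 0) (i : ι) : x i = 0 :=
  let _ := divisionRingT hB
  eq_zero_of_sum_mul_star hP x hx i

theorem T_isRealClosed_of_not_mem [IsRealClosed P] (hB : B.toRep.IsIndec) {h : B.T}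
    (hh : star h = h) (hP : ∀ r, h ≠ algebraMap P B.T r) (a : B.T) (ha : star a = a)
    (ha0 : a ≠ 0) : ∃ y, star y * a * y = 1 :=
  let _ := divisionRingT hB
  exists_star_mul_mul_eq_one hh hP a ha ha0

/-- Replaces the exceptional algebras of case (c) by the condition that decides which forms occur.
-/
theorem T_isRealClosed_iff [IsRealClosed P] (hB : B.toRep.IsIndec) :
    ((IsAlgClosedField B.T ∧ IdInvolution B.T) ∨ IsNonstdQuaternion P B.T) ↔
      ∃ h : B.T, star h = h ∧ ∀ r, h ≠ algebraMap P B.T r := by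
  let _ := divisionRingT hB
  constructor
  · intro h
    by_contra hcon
    push Not at hcon
    exact not_isAlgClosedField_or_isNonstdQuaternion hcon h
  · rintro ⟨h, hh, hP⟩
    exact isAlgClosedField_or_isNonstdQuaternion hh hP

section Finite

variable [Finite P]

instance finite_T : Finite B.T := Module.finite_of_finite P

theorem T_mul_comm (hB : B.toRep.IsIndec) (a b : B.T) : a * b = b * a :=
  let _ := divisionRingT hB
  let _ : Field B.T := littleWedderburn B.T
  mul_comm a b

theorem T_finite_id (hB : B.toRep.IsIndec) {ε : B.T} (hε : ¬ IsSquare ε) {a : B.T}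
    (ha0 : a ≠ 0) : ∃ y, y * a * y = 1 ∨ y * a * y = ε :=
  let _ := divisionRingT hB
  let _ : Field B.T := littleWedderburn B.T
  exists_mul_mul_eq_one_or_nonsq hε ha0

theorem T_finite_represents (h2 : (2 : P) ≠ 0) (hB : B.toRep.IsIndec) {ε : B.T} (hε : ε ≠ 0)
    (c : B.T) : ∃ x y, x * ε * x + y * ε * y = c := by
  let _ := divisionRingT hB
  let _ : Field B.T := littleWedderburn B.T
  obtain ⟨x, y, h⟩ := exists_sq_add_mul_sq (T_two_ne_zero h2 hB) hε hε c
  exact ⟨x, y, by rw [← h]; ring⟩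

theorem T_finite_of_ne_id (h2 : (2 : P) ≠ 0) (hB : B.toRep.IsIndec) (hne : ¬ IdInvolution B.T)
    (a : B.T) (ha : star a = a) (ha0 : a ≠ 0) : ∃ y, star y * a * y = 1 :=
  let _ := divisionRingT hB
  let _ : Field B.T := littleWedderburn B.T
  exists_star_mul_mul_eq_one_of_finite (T_two_ne_zero h2 hB) hne a ha ha0

end Finite

end SelfAdjRep

/-! ## The decomposition theorems -/

section Decomposition

open SelfAdjRep

variable [Module.Finite P K] {ind : Set (Rep P K C)} {ind₀ : Set (SelfAdjRep K J)}
  {ind₁ : Set (Rep P K C)}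

/-- Every form on `B` is equivalent to that of `B`, so the count of keys already determines the
labels. -/
theorem hasUniqueOrthDecomp_isAlgClosed_id [IsAlgClosed P] (h2 : (2 : P) ≠ 0)
    (hid : IdInvolution P) (hind : IsInd ind)
    (hind₀ : IsInd₀ J ind ind₀) (hind₁ : IsInd₁ J ind ind₁) :
    HasUniqueOrthDecomp (Sum.elim (fun A : ind₁ => A.1.plus J) (fun B : ind₀ => B.1))
      (fun _ _ => True) := by
  let typ : ind₁ ⊕ ind₀ → ind₁ ⊕ (Σ B : ind₀, B.1.T) := Sum.map id fun B => ⟨B, 1⟩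
  have htyp : ∀ x B t, typ x = Sum.inr ⟨B, t⟩ → x = Sum.inr B ∧ t = 1 := by
    rintro (A | B) B' t h
    · cases h
    · have h' := Sum.inr_injective h
      cases h'
      exact ⟨rfl, rfl⟩
  have hX : IsSummandFamily (Sum.elim (fun A : ind₁ => A.1.plus J) (fun B : ind₀ => B.1)) typ := by
    refine ⟨?_, ?_, ?_⟩
    · exact Function.Injective.sumMap Function.injective_id fun B B' h => congrArg Sigma.fst h
    · rintro (A | B) A' h
      · cases h
        rfl
      · cases h
    · intro x B t h
      obtain ⟨rfl, rfl⟩ := htyp x B t h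
      exact realizes_self B.1
  intro S
  constructor
  · obtain ⟨n, l, -, w, hw⟩ := hX.exists_decomp h2 hind hind₀ hind₁ (fun _ => True)
      (fun A => ⟨Sum.inl A, rfl⟩) (fun B a _ ha0 => by
        obtain ⟨y, hy⟩ := T_isAlgClosed_id hid (hind₀.isIndec hind B.2) a ha0
        exact ⟨Sum.inr B, 1, y, rfl, hy⟩) (fun _ h => absurd trivial h) S
    exact ⟨n, l, trivial, (congruent_orthSum_iff _ _).2 ⟨w, hw⟩⟩
  · refine hX.exists_equiv hind hind₀ hind₁ (fun _ _ => True) ?_ S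
    intro n m l l' _ _ B I I' _ _ ι ι' d d' W _ _ hd hd' _ hc
    exact card_le_of_forall_eq (fun i => (htyp _ _ _ (hd i)).2) (fun i => (htyp _ _ _ (hd' i)).2) hc

/-- The coefficients reduce to `±1` and are counted by inertia, available because sums of norms are
anisotropic. -/
theorem hasUniqueOrthDecomp_isAlgClosed [IsAlgClosed P] (h2 : (2 : P) ≠ 0)
    (hne : ¬ IdInvolution P) {S₀ : Set C} (hS₀ : J.IsHalf S₀) (hind : IsInd ind)
    (hind₀ : IsInd₀ J ind ind₀) (hind₁ : IsInd₁ J ind ind₁) :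
    HasUniqueOrthDecomp (Sum.elim (fun A : ind₁ => A.1.plus J) (Sum.elim (fun B : ind₀ => B.1)
      (fun B : ind₀ => B.1.twist hS₀ (SelfAdjAut.negOne B.1)))) (fun _ _ => True) := by
  let typ : ind₁ ⊕ (ind₀ ⊕ ind₀) → ind₁ ⊕ (Σ B : ind₀, B.1.T) :=
    Sum.map id (Sum.elim (fun B => ⟨B, 1⟩) (fun B => ⟨B, -1⟩))
  have hX : IsSummandFamily (Sum.elim (fun A : ind₁ => A.1.plus J) (Sum.elim (fun B : ind₀ => B.1)
      (fun B : ind₀ => B.1.twist hS₀ (SelfAdjAut.negOne B.1)))) typ := by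
    refine ⟨?_, ?_, ?_⟩
    · refine Function.Injective.sumMap Function.injective_id (Function.Injective.sumElim ?_ ?_ ?_)
      · exact fun B B' h => congrArg Sigma.fst h
      · exact fun B B' h => congrArg Sigma.fst h
      · intro B B' h
        obtain rfl : B = B' := congrArg Sigma.fst h
        exact T_one_ne_neg_one h2 (hind₀.isIndec hind B.2) (eq_of_heq (Sigma.mk.inj h).2)
    · rintro (A | B | B) A' h
      · cases h
        rfl
      · cases h
      · cases h
    · rintro (A | B | B) B' t h
      · cases h
      · have h' := Sum.inr_injective h
        cases h'
        exact realizes_self B.1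
      · have h' := Sum.inr_injective h
        cases h'
        rw [← toT_negOne]
        exact realizes_twist B.1 hS₀ _
  have htyp : ∀ x B t, typ x = Sum.inr ⟨B, t⟩ → t = 1 ∨ t = -1 := by
    rintro (A | B | B) B' t h
    · cases h
    · have h' := Sum.inr_injective h
      cases h'
      exact Or.inl rfl
    · have h' := Sum.inr_injective h
      cases h'
      exact Or.inr rfl
  intro S
  constructor
  · obtain ⟨n, l, -, w, hw⟩ := hX.exists_decomp h2 hind hind₀ hind₁ (fun _ => True)
      (fun A => ⟨Sum.inl A, rfl⟩) (fun B a ha ha0 => by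
        obtain ⟨y, hy | hy⟩ := T_isAlgClosed (hind₀.isIndec hind B.2) a ha ha0
        · exact ⟨Sum.inr (Sum.inl B), 1, y, rfl, hy⟩
        · exact ⟨Sum.inr (Sum.inr B), -1, y, rfl, hy⟩) (fun _ h => absurd trivial h) S
    exact ⟨n, l, trivial, (congruent_orthSum_iff _ _).2 ⟨w, hw⟩⟩
  · refine hX.exists_equiv hind hind₀ hind₁ (fun _ _ => True) ?_ S
    intro n m l l' _ _ B I I' _ _ ι ι' d d' W _ _ hd hd' hW hc
    have hB := hind₀.isIndec hind B.2
    have := T_nontrivial hB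
    exact hW.card_le_of_inertia (T_isUnit_or_eq_zero hB) (T_isAlgClosed_pos h2 hne hB)
      (fun i => htyp _ _ _ (hd i)) (fun i => htyp _ _ _ (hd' i))

/-! ### Decompositions into the summands `A⁺` and `B^a` -/

section Label

/-- The form of a labelled summand. -/
def labelTyp : Label ind₁ ind₀ → ind₁ ⊕ (Σ B : ind₀, B.1.T) :=
  Sum.map id (Sigma.map id fun _ => Subtype.val)

theorem labelTyp_eq_inr {x : Label ind₁ ind₀} {B : ind₀} {t : B.1.T}
    (h : labelTyp x = Sum.inr ⟨B, t⟩) : ∃ h', x = Sum.inr ⟨B, ⟨t, h'⟩⟩ := by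
  rcases x with A | ⟨B', t', h'⟩
  · cases h
  · have h1 := Sum.inr_injective h
    cases h1
    exact ⟨h', rfl⟩

theorem isSummandFamily_label (c : AutChoice ind₀) {S₀ : Set C} (hS₀ : J.IsHalf S₀) :
    IsSummandFamily (c.summand ind₁ hS₀) labelTyp := by
  refine ⟨?_, ?_, ?_⟩
  · exact Function.Injective.sumMap Function.injective_id
      (Function.injective_id.sigma_map fun _ => Subtype.val_injective)
  · rintro (A | ⟨B, t⟩) A' h
    · cases h
      rfl
    · cases h
  · intro x B t h
    obtain ⟨h', rfl⟩ := labelTyp_eq_inr h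
    have := realizes_twist B.1 hS₀ (c.aut B ⟨t, h'⟩)
    rwa [c.toT_aut] at this

/-- Existence of a decomposition into summands with labels satisfying `ok`. -/
theorem exists_label_decomp (h2 : (2 : P) ≠ 0) (hind : IsInd ind)
    (hind₀ : IsInd₀ J ind ind₀) (hind₁ : IsInd₁ J ind ind₁) (c : AutChoice ind₀) {S₀ : Set C}
    (hS₀ : J.IsHalf S₀) (ok : ∀ B : ind₀, B.1.T → Prop) (plain : ∀ B : ind₀, B.1.T → Prop)
    (hok : ∀ (B : ind₀) (a : B.1.T), star a = a → a ≠ 0 →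
      ∃ t y, ok B t ∧ t ≠ 0 ∧ star y * a * y = t)
    (hd : ∀ (B : ind₀) (ε : B.1.T), ok B ε → ¬ plain B ε → ∃ t y₁ y₂, ok B t ∧ plain B t ∧
      star t = t ∧ t ≠ 0 ∧ star y₁ * ε * y₁ + star y₂ * ε * y₂ = t) (S : SelfAdjRep K J) :
    ∃ (n : ℕ) (l : Fin n → Label ind₁ ind₀),
      ((∀ i B t, l i = Sum.inr ⟨B, t⟩ → ok B t.1) ∧
      (∀ i j B t t', l i = Sum.inr ⟨B, t⟩ → l j = Sum.inr ⟨B, t'⟩ → ¬ plain B t.1 → t = t' →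
        i = j)) ∧
      S.Congruent (SelfAdjRep.orthSum fun i => c.summand ind₁ hS₀ (l i)) := by
  -- Restricting to the allowed labels makes every decomposition over `L'` satisfy `ok`.
  let L' := {x : Label ind₁ ind₀ // ∀ B t, x = Sum.inr ⟨B, t⟩ → ok B t.1}
  have hX := isSummandFamily_label (ind₁ := ind₁) c hS₀
  have hX' : IsSummandFamily (fun x : L' => c.summand ind₁ hS₀ x.1) (fun x => labelTyp x.1) :=
    ⟨hX.inj.comp Subtype.val_injective, fun x => hX.plus x.1, fun x => hX.realizes x.1⟩
  have mk : ∀ (B : ind₀) (t : B.1.T) (_ : ok B t) (_ : star t = t ∧ t ≠ 0), ∃ x : L',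
      labelTyp x.1 = Sum.inr ⟨B, t⟩ := by
    intro B t h1 h3
    refine ⟨⟨Sum.inr ⟨B, ⟨t, h3⟩⟩, ?_⟩, rfl⟩
    intro B' t' h
    have h' := Sum.inr_injective h
    cases h'
    exact h1
  obtain ⟨n, l, hl, w, hw⟩ := hX'.exists_decomp h2 hind hind₀ hind₁
    (fun x => ∀ B t, labelTyp x.1 = Sum.inr ⟨B, t⟩ → plain B t)
    (fun A => ⟨⟨Sum.inl A, fun _ _ h => by cases h⟩, rfl⟩)
    (fun B a ha ha0 => by
      obtain ⟨t, y, ht, ht0, hy⟩ := hok B a ha ha0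
      obtain ⟨x, hx⟩ := mk B t ht
        ⟨by rw [← hy, star_mul, star_mul, star_star, ha, mul_assoc], ht0⟩
      exact ⟨x, t, y, hx, hy⟩)
    (fun x hx => by
      push Not at hx
      obtain ⟨B, ε, hx, hp⟩ := hx
      obtain ⟨h', hx'⟩ := labelTyp_eq_inr hx
      obtain ⟨t, y₁, y₂, ht, htp, hts, ht0, hy⟩ := hd B ε (x.2 _ _ hx') hp
      obtain ⟨x', hx''⟩ := mk B t ht ⟨hts, ht0⟩
      refine ⟨x', fun B' t' h => ?_, fun S w₁ w₂ hw₁ hw₂ hw => ?_⟩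
      · have h1 := Sum.inr_injective (hx''.symm.trans h)
        cases h1
        exact htp
      · exact (hX'.realizes x B ε hx).exists_isometry_of_two h2 (hX'.realizes x' B t hx'') hy
          hw₁ hw₂ hw) S
  refine ⟨n, fun i => (l i).1, ⟨fun i => (l i).2, fun i j B t t' hi hj hp htt => ?_⟩,
    (congruent_orthSum_iff _ _).2 ⟨w, hw⟩⟩
  subst htt
  refine hl i j (fun h => hp (h B t.1 ?_)) (Subtype.ext (hi.trans hj.symm))
  exact congrArg labelTyp hi

/-- Either some selfadjoint element of `T(B)` lies outside `P` and every coefficient becomes `1`, or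
all lie in `P` and inertia distinguishes `1` from `-1`. -/
theorem hasUniqueOrthDecomp_isRealClosed [IsRealClosed P] (hind : IsInd ind)
    (hind₀ : IsInd₀ J ind ind₀) (hind₁ : IsInd₁ J ind ind₁) (c : AutChoice ind₀) {S₀ : Set C}
    (hS₀ : J.IsHalf S₀) :
    HasUniqueOrthDecomp (c.summand ind₁ hS₀)
      (fun _ l => ∀ i B t, l i = Sum.inr ⟨B, t⟩ →
        t.1 = 1 ∨ (t.1 = -1 ∧ ¬ ((IsAlgClosedField B.1.T ∧ IdInvolution B.1.T) ∨
          IsNonstdQuaternion P B.1.T))) := by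
  have h2 : (2 : P) ≠ 0 := two_ne_zero
  intro S
  constructor
  · obtain ⟨n, l, hl, h⟩ := exists_label_decomp h2 hind hind₀ hind₁ c hS₀
      (fun B t => t = 1 ∨ (t = -1 ∧ ¬ ((IsAlgClosedField B.1.T ∧ IdInvolution B.1.T) ∨
          IsNonstdQuaternion P B.1.T))) (fun _ _ => True) (fun B a ha ha0 => by
        have hB := hind₀.isIndec hind B.2
        have := T_nontrivial hB
        rw [T_isRealClosed_iff hB]
        by_cases hP : ∃ h : B.1.T, star h = h ∧ ∀ r, h ≠ algebraMap P B.1.T r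
        · obtain ⟨h, hh, hhP⟩ := hP
          obtain ⟨y, hy⟩ := T_isRealClosed_of_not_mem hB hh hhP a ha ha0
          exact ⟨1, y, Or.inl rfl, one_ne_zero, hy⟩
        · have hP' := hP
          push Not at hP'
          obtain ⟨y, hy | hy⟩ := T_isRealClosed_of_mem hB hP' a ha ha0
          · exact ⟨1, y, Or.inl rfl, one_ne_zero, hy⟩
          · exact ⟨-1, y, Or.inr ⟨rfl, hP⟩, neg_ne_zero.2 one_ne_zero, hy⟩)
      (fun _ _ _ h => absurd trivial h) S
    exact ⟨n, l, hl.1, h⟩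
  · refine (isSummandFamily_label c hS₀).exists_equiv hind hind₀ hind₁ _ ?_ S
    intro n m l l' hl hl' B I I' _ _ ι ι' d d' W _ _ hd hd' hW hc
    have hB := hind₀.isIndec hind B.2
    have := T_nontrivial hB
    have hlab : ∀ {n : ℕ} {l : Fin n → Label ind₁ ind₀}, (∀ i B t, l i = Sum.inr ⟨B, t⟩ →
        t.1 = 1 ∨ (t.1 = -1 ∧ ¬ ((IsAlgClosedField B.1.T ∧ IdInvolution B.1.T) ∨
          IsNonstdQuaternion P B.1.T))) → ∀ i t, labelTyp (l i) = Sum.inr ⟨B, t⟩ →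
        t = 1 ∨ (t = -1 ∧ ¬ ((IsAlgClosedField B.1.T ∧ IdInvolution B.1.T) ∨
          IsNonstdQuaternion P B.1.T)) := by
      intro n l hl i t h
      obtain ⟨h', hx⟩ := labelTyp_eq_inr h
      exact hl i B _ hx
    by_cases hcase : (IsAlgClosedField B.1.T ∧ IdInvolution B.1.T) ∨ IsNonstdQuaternion P B.1.T
    · exact card_le_of_forall_eq
        (fun i => (hlab hl _ _ (hd i)).resolve_right fun h => h.2 hcase)
        (fun i => (hlab hl' _ _ (hd' i)).resolve_right fun h => h.2 hcase) hc
    · rw [T_isRealClosed_iff hB] at hcase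
      push Not at hcase
      exact hW.card_le_of_inertia (T_isUnit_or_eq_zero hB) (T_isRealClosed_pos hB hcase)
        (fun i => (hlab hl _ _ (hd i)).imp_right And.left)
        (fun i => (hlab hl' _ _ (hd' i)).imp_right And.left)

theorem hasUniqueOrthDecomp_finite [Finite P] (h2 : (2 : P) ≠ 0) (hind : IsInd ind)
    (hind₀ : IsInd₀ J ind ind₀) (hind₁ : IsInd₁ J ind ind₁) (c : AutChoice ind₀) {S₀ : Set C}
    (hS₀ : J.IsHalf S₀) (nonsq : ∀ B : ind₀, B.1.T)
    (hnonsq : ∀ B : ind₀, IdInvolution B.1.T → ¬ IsSquare (nonsq B)) :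
    HasUniqueOrthDecomp (c.summand ind₁ hS₀)
      (fun _ l =>
        (∀ i B t, l i = Sum.inr ⟨B, t⟩ →
          t.1 = 1 ∨ (t.1 = nonsq B ∧ IdInvolution B.1.T)) ∧
        (∀ i j B t t', l i = Sum.inr ⟨B, t⟩ → l j = Sum.inr ⟨B, t'⟩ →
          t.1 ≠ 1 → t'.1 ≠ 1 → i = j)) := by
  have hn0 : ∀ B : ind₀, IdInvolution B.1.T → nonsq B ≠ 0 := fun B hid h =>
    hnonsq B hid (h ▸ IsSquare.zero)
  intro S
  constructor
  · obtain ⟨n, l, hl, h⟩ := exists_label_decomp h2 hind hind₀ hind₁ c hS₀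
      (fun B t => t = 1 ∨ (t = nonsq B ∧ IdInvolution B.1.T)) (fun _ t => t = 1)
      (fun B a ha ha0 => by
        have hB := hind₀.isIndec hind B.2
        have := T_nontrivial hB
        by_cases hid : IdInvolution B.1.T
        · obtain ⟨y, hy | hy⟩ := T_finite_id hB (hnonsq B hid) ha0
          · exact ⟨1, y, Or.inl rfl, one_ne_zero, by rw [hid y, hy]⟩
          · exact ⟨nonsq B, y, Or.inr ⟨rfl, hid⟩, hn0 B hid, by rw [hid y, hy]⟩
        · obtain ⟨y, hy⟩ := T_finite_of_ne_id h2 hB hid a ha ha0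
          exact ⟨1, y, Or.inl rfl, one_ne_zero, hy⟩)
      (fun B ε hε hε1 => by
        have hB := hind₀.isIndec hind B.2
        have := T_nontrivial hB
        obtain ⟨rfl, hid⟩ := hε.resolve_left hε1
        -- The form `⟨ε, ε⟩` represents `1`, so two summands with the nonsquare can be traded for
        -- one with `1`.
        obtain ⟨x, y, hxy⟩ := T_finite_represents h2 hB (hn0 B hid) 1
        exact ⟨1, x, y, Or.inl rfl, rfl, star_one _, one_ne_zero, by rw [hid x, hid y, hxy]⟩) S
    refine ⟨n, l, ⟨hl.1, fun i j B t t' hi hj ht ht' => hl.2 i j B t t' hi hj ht ?_⟩, h⟩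
    exact Subtype.ext (((hl.1 i B t hi).resolve_left ht).1.trans
      ((hl.1 j B t' hj).resolve_left ht').1.symm)
  · refine (isSummandFamily_label c hS₀).exists_equiv hind hind₀ hind₁ _ ?_ S
    intro n m l l' hl hl' B I I' _ _ ι ι' d d' W hι hι' hd hd' hW hc
    have hB := hind₀.isIndec hind B.2
    have := T_nontrivial hB
    have hlab : ∀ {n : ℕ} {l : Fin n → Label ind₁ ind₀}, (∀ i B t, l i = Sum.inr ⟨B, t⟩ →
        t.1 = 1 ∨ (t.1 = nonsq B ∧ IdInvolution B.1.T)) → ∀ i t,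
        labelTyp (l i) = Sum.inr ⟨B, t⟩ → t = 1 ∨ (t = nonsq B ∧ IdInvolution B.1.T) := by
      intro n l hl i t h
      obtain ⟨h', hx⟩ := labelTyp_eq_inr h
      exact hl i B _ hx
    have honce : ∀ {n : ℕ} {l : Fin n → Label ind₁ ind₀}, (∀ i j B t t', l i = Sum.inr ⟨B, t⟩ →
        l j = Sum.inr ⟨B, t'⟩ → t.1 ≠ 1 → t'.1 ≠ 1 → i = j) → ∀ i j t t',
        labelTyp (l i) = Sum.inr ⟨B, t⟩ → labelTyp (l j) = Sum.inr ⟨B, t'⟩ → t ≠ 1 → t' ≠ 1 →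
        i = j := by
      intro n l hl i j t t' h h'
      obtain ⟨_, hx⟩ := labelTyp_eq_inr h
      obtain ⟨_, hx'⟩ := labelTyp_eq_inr h'
      exact hl i j B _ _ hx hx'
    by_cases hid : IdInvolution B.1.T
    -- With identity involution, rank and discriminant determine whether the nonsquare occurs.
    · exact hW.discr (T_isUnit_or_eq_zero hB) (T_mul_comm hB) hid hc (hnonsq B hid)
        (fun i => (hlab hl.1 _ _ (hd i)).imp_right And.left)
        (fun i => (hlab hl'.1 _ _ (hd' i)).imp_right And.left)
        (fun i i' h h' => hι (honce hl.2 _ _ _ _ (hd i) (hd i') h h'))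
        (fun i i' h h' => hι' (honce hl'.2 _ _ _ _ (hd' i) (hd' i') h h'))
    · exact card_le_of_forall_eq
        (fun i => (hlab hl.1 _ _ (hd i)).resolve_right fun h => hid h.2)
        (fun i => (hlab hl'.1 _ _ (hd' i)).resolve_right fun h => hid h.2) hc

end Label

end Decomposition

end Reps

end SelfAdj

theorem theorem2
    -- `K` is a skew field of characteristic not 2 with involution, and `P` is its centre
    {P : Type p} [Field P] [StarRing P]
    {K : Type k} [DivisionRing K] [StarRing K] [Algebra P K] [StarModule P K]
    [Algebra.IsCentral P K] (two_ne : (2 : K) ≠ 0)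
    -- `C` is a linear category with involution
    {C : Type u} [Category.{v} C] [Preadditive C] [Linear P C] (J : SelfAdj.LinearInvolution P C)
    -- the choices of `S₀`, of the indecomposable representations and of the automorphisms `f_a`
    {S₀ : Set C} (hS₀ : J.IsHalf S₀)
    {ind : Set (SelfAdj.Rep P K C)} (hind : SelfAdj.IsInd ind)
    {ind₀ : Set (SelfAdj.SelfAdjRep K J)} (hind₀ : SelfAdj.IsInd₀ J ind ind₀)
    {ind₁ : Set (SelfAdj.Rep P K C)} (hind₁ : SelfAdj.IsInd₁ J ind ind₁)
    (c : SelfAdj.AutChoice ind₀) :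
    -- (a)
    (SelfAdj.IsAlgClosedField K → SelfAdj.IdInvolution K →
      SelfAdj.HasUniqueOrthDecomp
        (Sum.elim (fun A : ind₁ => A.1.plus J) (fun B : ind₀ => B.1))
        (fun _ _ => True)) ∧
    -- (b)
    (SelfAdj.IsAlgClosedField K → ¬ SelfAdj.IdInvolution K →
      SelfAdj.HasUniqueOrthDecomp
        (Sum.elim (fun A : ind₁ => A.1.plus J)
          (Sum.elim (fun B : ind₀ => B.1)
            (fun B : ind₀ => B.1.twist hS₀ (SelfAdj.SelfAdjAut.negOne B.1))))
        (fun _ _ => True)) ∧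
    -- (c)
    (SelfAdj.IsRealClosedField K ∨ (IsRealClosed P ∧ Nonempty (K ≃+* Quaternion P)) →
      SelfAdj.HasUniqueOrthDecomp (c.summand ind₁ hS₀)
        (fun _ l => ∀ i B t, l i = Sum.inr ⟨B, t⟩ →
          t.1 = 1 ∨
            (t.1 = -1 ∧
              ¬ ((SelfAdj.IsAlgClosedField B.1.T ∧ SelfAdj.IdInvolution B.1.T) ∨
                SelfAdj.IsNonstdQuaternion P B.1.T)))) ∧
    -- (d), with a fixed nonsquare in every `T(B)` whose involution is the identity
    (Finite K → ∀ nonsq : ∀ B : ind₀, B.1.T,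
      (∀ B : ind₀, SelfAdj.IdInvolution B.1.T → ¬ IsSquare (nonsq B)) →
      SelfAdj.HasUniqueOrthDecomp (c.summand ind₁ hS₀)
        (fun _ l =>
          (∀ i B t, l i = Sum.inr ⟨B, t⟩ →
            t.1 = 1 ∨ (t.1 = nonsq B ∧ SelfAdj.IdInvolution B.1.T)) ∧
          (∀ i j B t t', l i = Sum.inr ⟨B, t⟩ → l j = Sum.inr ⟨B, t'⟩ →
            t.1 ≠ 1 → t'.1 ≠ 1 → i = j))) := by
  -- The decomposition results need only the type of the centre `P` and the finiteness of `K` over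
  -- `P`; both are derived from the hypothesis on `K` in each case.
  have h2 : (2 : P) ≠ 0 := SelfAdj.two_ne_zero_of_algebra two_ne
  refine ⟨fun hK hid => ?_, fun hK hne => ?_, fun hK => ?_, fun hK nonsq hnonsq => ?_⟩
  · have := SelfAdj.isAlgClosed_of_isAlgClosedField (P := P) hK
    obtain ⟨hf, -⟩ := hK
    have := SelfAdj.finite_of_isField (P := P) hf
    exact SelfAdj.hasUniqueOrthDecomp_isAlgClosed_id h2
      ((SelfAdj.idInvolution_iff (SelfAdj.algebraMap_bijective_of_isField hf)).2 hid)
      hind hind₀ hind₁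
  · have := SelfAdj.isAlgClosed_of_isAlgClosedField (P := P) hK
    obtain ⟨hf, -⟩ := hK
    have := SelfAdj.finite_of_isField (P := P) hf
    exact SelfAdj.hasUniqueOrthDecomp_isAlgClosed h2
      (fun h => hne ((SelfAdj.idInvolution_iff (SelfAdj.algebraMap_bijective_of_isField hf)).1 h))
      hS₀ hind hind₀ hind₁
  · have : IsRealClosed P ∧ Module.Finite P K := by
      rcases hK with hK | ⟨hP, ⟨e⟩⟩
      · exact ⟨SelfAdj.isRealClosed_of_isRealClosedField hK,
          SelfAdj.finite_of_isField hK.1⟩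
      · exact ⟨hP, SelfAdj.finite_of_quaternion e⟩
    obtain ⟨_, _⟩ := this
    exact SelfAdj.hasUniqueOrthDecomp_isRealClosed hind hind₀ hind₁ c hS₀
  · have : Finite P := Finite.of_injective _ (algebraMap P K).injective
    have : Module.Finite P K := Module.Finite.of_finite
    exact SelfAdj.hasUniqueOrthDecomp_finite h2 hind hind₀ hind₁ c hS₀ nonsq hnonsq
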